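/- Theorem 4 (consistency of 2SBMA). Let $Z_k\in\mathbb R^{p_Z}$ ($p_Z\ge 1$) be instruments and $X_k\in\mathbb R^{p_X}$ covariates, $k=1,2,\dots$, and put $V_k=(Z_k,X_k)$. Suppose that $$Y_k=(W_k,X_k)\cdot\beta+\eta_k,\qquad W_k=V_k\cdot\theta+\epsilon_k,$$ where the pairs $(\eta_k,\epsilon_k)$ are independent, identically distributed $N(0,\Sigma)$ with $\Sigma$ positive definite, the sequence $(\eta_k,\epsilon_k)_k$ is independent of the (random or fixed) sequence $(V_k)_k$, and $\frac1n\sum_{k\le n}V_kV_k'\to_p Q$ with $Q$ positive definite. For a sample of size $n$ write $Y,W$ for the vectors and $Z,X$ for the matrices of the first $n$ observations, and $V=(Z\ X)$. Two-stage least squares in the full model is $\hat\beta^{2SLS}=(\hat U'\hat U)^{-1}\hat U'Y$ with $\hat U=(V\hat\theta\ \ X)$ and $\hat\theta=(V'V)^{-1}V'W$. For a matrix $A$ with $n$ rows and $p$ columns and a vector $y\in\mathbb R^n$, let $\hat b=(A'A)^{-1}A'y$ and $\hat s=\|y-A\hat b\|^2/n$. The integrated likelihood of the regression of $y$ on $A$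 under the unit information prior is $$m(y,A)=\int_0^\infty\!\!\int_{\mathbb R^p}s^{-n/2}e^{-\|y-Ab\|^2/(2s)}\,\varphi(b,s)\,db\,ds,$$ where $\varphi$ is the density of the normal law under which $b$ and $s$ are independent, $b\sim N(\hat b,\,n\hat s(A'A)^{-1})$ and $s\sim N(\hat s,2\hat s^2)$; that is, its mean is the maximum likelihood estimate and its covariance is the inverse of the average information in one observation. (It is $0$ if $A'A$ is singular.) Let $\mathcal M$ be a collection of first-stage models $M$ (subsets of the columns of $V$) that contains the true one $\{a:\theta_a\ne0\}$, and $\mathcal L$ a collection of second-stage models $L$ (subsets of the columns of $(W\ X)$) that contains the true one $\{a:\beta_a\ne0\}$; let the prior model weights $pr(M)$ and $pr(L\mid M)$ be positive and independent of $n$. Let $V^{(M)}$ consist of the columns of $V$ in $M$, let $\hat W^{(M)}=V^{(M)}(V^{(M)\prime}V^{(M)})^{-1}V^{(M)\prime}W$ and $\hat\epsilon^{(M)}=W-\hat W^{(M)}$, and let $\hat U^{(M,L)}$ consist of the columns of $(\hat W^{(M)}\ X)$ in $L$. Let $\hat\beta^{(M,L)}$ be $(\hat U^{(M,L)\prime}\hat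 U^{(M,L)})^{-1}\hat U^{(M,L)\prime}Y$, with zeros for the excluded coefficients (and $0$ if the inverse does not exist). With $$\pi_M=\frac{m(W,V^{(M)})\,pr(M)}{\sum_{M'\in\mathcal M}m(W,V^{(M')})\,pr(M')},\qquad \nu_{M,L}=\frac{m(Y,D^{(M,L)})\,pr(L\mid M)}{\sum_{L'\in\mathcal L}m(Y,D^{(M,L')})\,pr(L'\mid M)}$$ (read as $0$ if the denominator vanishes), where $D^{(M,L)}=(\hat U^{(M,L)}\ \ \hat\epsilon^{(M)})$, the 2SBMA estimator is $$\hat\beta^{2SBMA}=\sum_{M\in\mathcal M}\sum_{L\in\mathcal L}\pi_M\,\nu_{M,L}\,\hat\beta^{(M,L)}.$$ If $\hat\beta^{2SLS}\to_p\beta$ as $n\to\infty$, then $\hat\beta^{2SBMA}\to_p\beta$. The same holds if the first-stage residual is omitted in the second-stage likelihoods, that is, for $D^{(M,L)}=\hat U^{(M,L)}$. -/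

import Mathlib

open MeasureTheory ProbabilityTheory Filter Topology
open scoped Matrix

noncomputable section

namespace TwoSBMA

section Regression

variable {n : ℕ} {κ : Type*} [Fintype κ] [DecidableEq κ]

/-- The least squares coefficient `(A'A)⁻¹ A'y`. -/
def ols (A : Matrix (Fin n) κ ℝ) (y : Fin n → ℝ) : κ → ℝ :=
  (Aᵀ * A)⁻¹ *ᵥ (Aᵀ *ᵥ y)

/-- The residual sum of squares `(y - A b)'(y - A b)`. -/
def sqResid (A : Matrix (Fin n) κ ℝ) (y : Fin n → ℝ) (b : κ → ℝ) : ℝ :=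
  (y - A *ᵥ b) ⬝ᵥ (y - A *ᵥ b)

/-- The Gaussian regression likelihood `s^(-n/2) exp (-(y - A b)'(y - A b) / (2 s))` with
coefficient `b` and variance `s`. -/
def regLikelihood (A : Matrix (Fin n) κ ℝ) (y : Fin n → ℝ) (b : κ → ℝ) (s : ℝ) : ℝ :=
  s ^ (-(n : ℝ) / 2) * Real.exp (-(sqResid A y b) / (2 * s))

/-- The maximum likelihood estimate of the variance. -/
def varMLE (A : Matrix (Fin n) κ ℝ) (y : Fin n → ℝ) : ℝ :=
  sqResid A y (ols A y) / n

/-- The average information of one observation about the coefficients, at the maximum likelihood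
estimate. -/
def unitInfoCoeff (A : Matrix (Fin n) κ ℝ) (y : Fin n → ℝ) : Matrix κ κ ℝ :=
  ((n : ℝ) * varMLE A y)⁻¹ • (Aᵀ * A)

/-- The average information of one observation about the variance, at the maximum likelihood
estimate. The information between the coefficients and the variance is zero there. -/
def unitInfoVar (A : Matrix (Fin n) κ ℝ) (y : Fin n → ℝ) : ℝ :=
  (2 * varMLE A y ^ 2)⁻¹

/-- The density of the unit information prior of `(b, s)`: the normal density centred at the
maximum likelihood estimate whose precision matrix is the average information of one
observation. -/
def uipDensity (A : Matrix (Fin n) κ ℝ) (y : Fin n → ℝ) (b : κ → ℝ) (s : ℝ) : ℝ :=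
  ((2 * Real.pi) ^ (-(Fintype.card κ : ℝ) / 2) * Real.sqrt (unitInfoCoeff A y).det *
      Real.exp (-((b - ols A y) ⬝ᵥ (unitInfoCoeff A y *ᵥ (b - ols A y))) / 2)) *
    (Real.sqrt (unitInfoVar A y / (2 * Real.pi)) *
      Real.exp (-(unitInfoVar A y * (s - varMLE A y) ^ 2) / 2))

/-- The integrated likelihood of the regression of `y` on `A` under the unit information prior;
the variance ranges over the positive reals. (The prior mass of the positive variances is the same
number for all regressions, so normalising by it would not change any posterior probability.) -/
def integratedLikelihood (A : Matrix (Fin n) κ ℝ) (y : Fin n → ℝ) : ℝ :=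
  ∫ p : (κ → ℝ) × ℝ in Set.univ ×ˢ Set.Ioi 0,
    regLikelihood A y p.1 p.2 * uipDensity A y p.1 p.2

end Regression

section TwoStage

variable {n pZ pX : ℕ}

/-- `(W X)`, for a single column `W`. -/
def withCol (w : Fin n → ℝ) (X : Matrix (Fin n) (Fin pX) ℝ) :
    Matrix (Fin n) (Unit ⊕ Fin pX) ℝ :=
  Matrix.fromCols (Matrix.replicateCol Unit w) X

/-- The submatrix of the columns in `S`. -/
def keepCols {m κ : Type*} (A : Matrix m κ ℝ) (S : Finset κ) : Matrix m S ℝ :=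
  A.submatrix id Subtype.val

/-- A first stage model: the set of retained columns of `V = (Z X)`. -/
abbrev FirstModel (pZ pX : ℕ) := Finset (Fin pZ ⊕ Fin pX)

/-- A second stage model: the set of retained columns of `U = (W X)`. -/
abbrev SecondModel (pX : ℕ) := Finset (Unit ⊕ Fin pX)

variable (Z : Matrix (Fin n) (Fin pZ) ℝ) (X : Matrix (Fin n) (Fin pX) ℝ) (W Y : Fin n → ℝ)

/-- The two-stage least squares estimator in the full model. -/
def twoSLS : Unit ⊕ Fin pX → ℝ :=
  ols (withCol (Matrix.fromCols Z X *ᵥ ols (Matrix.fromCols Z X) W) X) Y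

/-- The columns of `V = (Z X)` in the first stage model `M`. -/
def firstDesign (M : FirstModel pZ pX) : Matrix (Fin n) M ℝ :=
  keepCols (Matrix.fromCols Z X) M

/-- The fitted value of `W` under the first stage model `M`. -/
def fitted (M : FirstModel pZ pX) : Fin n → ℝ :=
  firstDesign Z X M *ᵥ ols (firstDesign Z X M) W

/-- The columns of `(W X)` in the second stage model `L`, where `W`, if it is one of them, is
replaced by its fitted value under `M`. -/
def secondDesign (M : FirstModel pZ pX) (L : SecondModel pX) : Matrix (Fin n) L ℝ :=
  keepCols (withCol (fitted Z X W M) X) L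

/-- The constrained two-stage least squares estimator under `M` and `L`, as a full vector:
excluded coefficients are zero. -/
def constrained2SLS (M : FirstModel pZ pX) (L : SecondModel pX) : Unit ⊕ Fin pX → ℝ :=
  fun a => if h : a ∈ L then ols (secondDesign Z X W M L) Y ⟨a, h⟩ else 0

/-- The second stage regressors together with the first stage residual under `M`, whose
coefficient is the parameter `φ` of the conditional likelihood. -/
def controlDesign (M : FirstModel pZ pX) (L : SecondModel pX) : Matrix (Fin n) (L ⊕ Unit) ℝ :=
  Matrix.fromCols (secondDesign Z X W M L) (Matrix.replicateCol Unit (W - fitted Z X W M))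

/-- The integrated second stage likelihood of `L` given `M`. If `control` is true, it is that of
the conditional likelihood of `Y` with parameters `(β, φ, ω)`; if it is false, the residual term
is dropped, so that likelihood and prior are centred at the constrained two-stage least squares
estimator for every pair of models. -/
def secondScore (control : Bool) (M : FirstModel pZ pX) (L : SecondModel pX) : ℝ :=
  if control then integratedLikelihood (controlDesign Z X W M L) Y
  else integratedLikelihood (secondDesign Z X W M L) Y

/-- The posterior probability of the first stage model `M` in the collection `𝓜`, for prior
model weights `prM`. -/
def firstPosterior (𝓜 : Finset (FirstModel pZ pX)) (prM : FirstModel pZ pX → ℝ)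
    (M : FirstModel pZ pX) : ℝ :=
  integratedLikelihood (firstDesign Z X M) W * prM M /
    ∑ M' ∈ 𝓜, integratedLikelihood (firstDesign Z X M') W * prM M'

/-- The posterior probability of the second stage model `L` in the collection `𝓛` given the first
stage model `M`, for prior model weights `prL M`. -/
def secondPosterior (control : Bool) (𝓛 : Finset (SecondModel pX))
    (prL : FirstModel pZ pX → SecondModel pX → ℝ)
    (M : FirstModel pZ pX) (L : SecondModel pX) : ℝ :=
  secondScore Z X W Y control M L * prL M L /
    ∑ L' ∈ 𝓛, secondScore Z X W Y control M L' * prL M L'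

/-- The two-stage Bayesian model averaging estimator. -/
def twoSBMA (control : Bool) (𝓜 : Finset (FirstModel pZ pX)) (𝓛 : Finset (SecondModel pX))
    (prM : FirstModel pZ pX → ℝ) (prL : FirstModel pZ pX → SecondModel pX → ℝ) :
    Unit ⊕ Fin pX → ℝ :=
  ∑ M ∈ 𝓜, ∑ L ∈ 𝓛,
    (firstPosterior Z X W 𝓜 prM M * secondPosterior Z X W Y control 𝓛 prL M L) •
      constrained2SLS Z X W Y M L

end TwoStage

/-- The matrix of the first `n` observations of a sequence of random rows. -/
def sampleMat {Ω : Type*} {p : ℕ} (x : ℕ → Ω → Fin p → ℝ) (n : ℕ) (ω : Ω) :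
    Matrix (Fin n) (Fin p) ℝ :=
  Matrix.of fun k => x k ω

/-- The vector of the first `n` observations of a sequence of random variables. -/
def sampleVec {Ω : Type*} (y : ℕ → Ω → ℝ) (n : ℕ) (ω : Ω) : Fin n → ℝ :=
  fun k => y k ω

end TwoSBMA

end

/-!
The proof separates the asymptotics from the probability. The sets of pairs `(n, ω)` whose sections
have a probability that tends to one form a filter `inProb P`, and convergence in probability to a
constant is convergence along this filter (`tendstoInMeasure_iff_tendsto_inProb`). So it suffices to
argue deterministically along a filter once the moments are known to converge there.

*Model selection.* The coefficients and the scale of the variance integrate out of the likelihood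
(`integratedLikelihood_eq`): it is `ŝ ^ (-n / 2)` times a factor that depends only on `n` and on the
number `p` of regressors, and that falls short of its value at `p = 0` at most by a polynomial
factor in `n` (`evidenceFactor_zero_le`). Hence a model whose limiting residual variance exceeds
that of another one has posterior odds that vanish exponentially fast (`tendsto_evidence_ratio`).
All designs are linear images of the array `(Z X U)` of regressors and errors, whose mean Gram
matrix converges, so that the limits of all least squares estimates and residual variances are
projections in the limiting inner product (`submodel_limits`): the models that contain the true one
are consistent and have the smallest residual variance. In the second stage, the residual variances
refer to the reduced form error or, if the first stage residual is a regressor, to the part of the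
`Y` error that is uncorrelated with the `W` error.

*First stage models that omit a relevant column.* Their weight vanishes exponentially fast, but the
estimates of the second stage may be unbounded under them, as the fitted value of `W` may be nearly
collinear with the covariates. A least squares fit cannot be longer than `Y`, so its coordinates in
the columns of `V` are bounded (`fit_coordinates_bounded`); as the first stage coefficients are not
smaller than order `1 / n`, by anti-concentration of the normal law (`IndepNoise.ols_separated`),
the estimates are at most of order `n` (`MomentLimits.constrained2SLS_isBigO`), unless the design is
singular and the coefficient zero.

*Identification.* The second stage has a nonsingular limit only if some instrument is relevant. This
is where the consistency of two-stage least squares is used (`exists_relevant_instrument`):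
otherwise the fitted value, purged of the covariates, would be bounded in probability, while given
the regressors and the first stage errors the estimation error is normal with a standard deviation
inversely proportional to its length.
-/

noncomputable section

namespace TwoSBMA

/-! ### Gaussian integrals and the integrated likelihood -/

section GaussianIntegral

variable {κ : Type*} [Fintype κ] [DecidableEq κ]

open scoped MatrixOrder in
lemma exists_isUnit_eq_transpose_mul_self {Λ : Matrix κ κ ℝ} (hΛ : Λ.PosDef) :
    ∃ B : Matrix κ κ ℝ, IsUnit B ∧ Λ = Bᵀ * B := by
  obtain ⟨B, h⟩ := CStarAlgebra.nonneg_iff_eq_star_mul_self.mp hΛ.posSemidef.nonneg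
  refine ⟨B, ?_, by simpa [Matrix.star_eq_conjTranspose] using h⟩
  have := hΛ.isUnit
  rw [h] at this
  rw [Matrix.isUnit_iff_isUnit_det] at this ⊢
  rw [Matrix.det_mul] at this
  exact isUnit_of_mul_isUnit_right this

lemma gaussian_prod_eq (c : ℝ) (B : Matrix κ κ ℝ) (x : κ → ℝ) :
    Real.exp (-(c * (x ⬝ᵥ ((Bᵀ * B) *ᵥ x))) / 2) =
      ∏ i, Real.exp (-(c / 2) * (Matrix.toLin' B x i) ^ 2) := by
  rw [← Real.exp_sum, ← Finset.mul_sum]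
  congr 1
  have : x ⬝ᵥ ((Bᵀ * B) *ᵥ x) = ∑ i, (Matrix.toLin' B x i) ^ 2 := by
    rw [← Matrix.mulVec_mulVec, Matrix.dotProduct_mulVec, Matrix.vecMul_transpose]
    simp [dotProduct, sq]
  rw [this]; ring

lemma integrable_integral_gaussian_form {Λ : Matrix κ κ ℝ} (hΛ : Λ.PosDef) {c : ℝ} (hc : 0 < c) :
    Integrable (fun x : κ → ℝ => Real.exp (-(c * (x ⬝ᵥ (Λ *ᵥ x))) / 2)) ∧
    ∫ x : κ → ℝ, Real.exp (-(c * (x ⬝ᵥ (Λ *ᵥ x))) / 2) =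
      (2 * Real.pi) ^ ((Fintype.card κ : ℝ) / 2) * c ^ (-(Fintype.card κ : ℝ) / 2) /
        Real.sqrt Λ.det := by
  obtain ⟨B, hB, rfl⟩ := exists_isUnit_eq_transpose_mul_self hΛ
  have hdet : B.det ≠ 0 := ((Matrix.isUnit_iff_isUnit_det B).mp hB).ne_zero
  simp_rw [gaussian_prod_eq]
  have hmap := Real.map_matrix_volume_pi_eq_smul_volume_pi hdet
  have hmeas : Measurable (Matrix.toLin' B) :=
    (LinearMap.continuous_of_finiteDimensional _).measurable
  have hg : Integrable (fun y : κ → ℝ => ∏ i, Real.exp (-(c / 2) * (y i) ^ 2)) :=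
    Integrable.fintype_prod (fun _ => integrable_exp_neg_mul_sq (by positivity))
  have hg' : Integrable (fun y : κ → ℝ => ∏ i, Real.exp (-(c / 2) * (y i) ^ 2))
      (Measure.map (Matrix.toLin' B) volume) := by
    rw [hmap]; exact hg.smul_measure ENNReal.ofReal_ne_top
  refine ⟨hg'.comp_measurable hmeas, ?_⟩
  -- the substitution `y = B x` turns the quadratic form into a sum of squares
  have h1 := integral_map (μ := (volume : Measure (κ → ℝ))) hmeas.aemeasurable
    hg'.aestronglyMeasurable
  rw [← h1, hmap, integral_smul_measure,
    integral_fintype_prod_volume_eq_prod (fun _ t => Real.exp (-(c / 2) * t ^ 2))]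
  simp only [integral_gaussian, Finset.prod_const, Finset.card_univ, Matrix.det_mul,
    Matrix.det_transpose, Real.sqrt_mul_self_eq_abs, abs_inv, ENNReal.toReal_ofReal, inv_nonneg,
    abs_nonneg, smul_eq_mul]
  have h2 : Real.pi / (c / 2) = (2 * Real.pi) * c⁻¹ := by field_simp
  rw [h2, Real.sqrt_eq_rpow, ← Real.rpow_natCast, ← Real.rpow_mul (by positivity),
    Real.mul_rpow (by positivity) (by positivity), Real.inv_rpow hc.le, ← Real.rpow_neg hc.le]
  rw [div_eq_mul_inv, mul_comm]
  congr 2 <;> [ring_nf; ring_nf]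

end GaussianIntegral

section LeastSquares

variable {n : ℕ} {κ : Type*} [Fintype κ]

lemma gram_posSemidef (A : Matrix (Fin n) κ ℝ) : (Aᵀ * A).PosSemidef := by
  simpa using Matrix.posSemidef_conjTranspose_mul_self A

lemma dotProduct_mulVec_eq (A : Matrix (Fin n) κ ℝ) (y : Fin n → ℝ) (b : κ → ℝ) :
    y ⬝ᵥ (A *ᵥ b) = (Aᵀ *ᵥ y) ⬝ᵥ b := by
  rw [Matrix.dotProduct_mulVec, Matrix.mulVec_transpose]

variable [DecidableEq κ]

lemma gram_posDef {A : Matrix (Fin n) κ ℝ} (hA : (Aᵀ * A).det ≠ 0) : (Aᵀ * A).PosDef :=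
  (gram_posSemidef A).posDef_iff_det_ne_zero.mpr hA

lemma normal_equations {A : Matrix (Fin n) κ ℝ} (hA : (Aᵀ * A).det ≠ 0) (y : Fin n → ℝ) :
    (Aᵀ * A) *ᵥ ols A y = Aᵀ *ᵥ y := by
  rw [ols, Matrix.mulVec_mulVec, Matrix.mul_nonsing_inv _ (isUnit_iff_ne_zero.mpr hA),
    Matrix.one_mulVec]

lemma ols_eq_zero {A : Matrix (Fin n) κ ℝ} (hA : (Aᵀ * A).det = 0) (y : Fin n → ℝ) :
    ols A y = 0 := by
  rw [ols, Matrix.nonsing_inv_apply_not_isUnit _ (by simp [hA]), Matrix.zero_mulVec]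

/-- The least squares residual is orthogonal to the columns of the design. -/
lemma resid_dotProduct {A : Matrix (Fin n) κ ℝ} (hA : (Aᵀ * A).det ≠ 0) (y : Fin n → ℝ)
    (d : κ → ℝ) : (y - A *ᵥ ols A y) ⬝ᵥ (A *ᵥ d) = 0 := by
  rw [dotProduct_mulVec_eq, Matrix.mulVec_sub, Matrix.mulVec_mulVec, normal_equations hA, sub_self,
    zero_dotProduct]

/-- Pythagoras, around the least squares fit. -/
lemma sqResid_eq {A : Matrix (Fin n) κ ℝ} (hA : (Aᵀ * A).det ≠ 0) (y : Fin n → ℝ) (b : κ → ℝ) :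
    sqResid A y b = n * varMLE A y + (b - ols A y) ⬝ᵥ ((Aᵀ * A) *ᵥ (b - ols A y)) := by
  rcases Nat.eq_zero_or_pos n with rfl | hn
  · have h0 : Aᵀ * A = 0 := by ext i j; simp [Matrix.mul_apply]
    rw [h0]; simp [sqResid]
  have h1 : y - A *ᵥ b = (y - A *ᵥ ols A y) - A *ᵥ (b - ols A y) := by
    rw [Matrix.mulVec_sub]; abel
  have h2 : (n : ℝ) * varMLE A y = sqResid A y (ols A y) := by
    rw [varMLE]; field_simp
  have h3 : (b - ols A y) ⬝ᵥ ((Aᵀ * A) *ᵥ (b - ols A y)) =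
      (A *ᵥ (b - ols A y)) ⬝ᵥ (A *ᵥ (b - ols A y)) := by
    rw [← Matrix.mulVec_mulVec, Matrix.dotProduct_mulVec, Matrix.vecMul_transpose]
  have h4 := resid_dotProduct hA y (b - ols A y)
  rw [h2, h3, sqResid, h1, sqResid]
  generalize y - A *ᵥ ols A y = r at *
  generalize A *ᵥ (b - ols A y) = f at *
  rw [sub_dotProduct, dotProduct_sub, dotProduct_sub, dotProduct_comm f r, h4]
  ring

end LeastSquares

section IntegratedLikelihood

/-- The part of the likelihood of the scaled variance `t = s / ŝ` that does not depend on the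
number of regressors, times the prior of `t`. -/
def varKernel (n : ℕ) (t : ℝ) : ℝ :=
  t ^ (-(n : ℝ) / 2) * Real.exp (-(n : ℝ) / (2 * t)) *
    (Real.exp (-(t - 1) ^ 2 / 4) / Real.sqrt (4 * Real.pi))

/-- The integrated likelihood of a regression with `n` observations, `p` regressors and unit
residual variance, after the coefficients are integrated out; the variance is `t`. -/
def evidenceFactor (n p : ℕ) : ℝ :=
  ∫ t in Set.Ioi 0, varKernel n t * (1 + n / t) ^ (-(p : ℝ) / 2)

lemma varKernel_pos (n : ℕ) {t : ℝ} (ht : 0 < t) : 0 < varKernel n t := by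
  unfold varKernel; positivity

lemma rpow_mul_exp_eq (n : ℕ) {t : ℝ} (ht : 0 < t) :
    t ^ (-(n : ℝ) / 2) * Real.exp (-(n : ℝ) / (2 * t)) =
      Real.exp (-(n / 2) * (Real.log t + t⁻¹)) := by
  rw [Real.rpow_def_of_pos ht, ← Real.exp_add]
  congr 1; field_simp; ring

lemma varKernel_le (n : ℕ) {t : ℝ} (ht : 0 < t) :
    varKernel n t ≤ Real.exp (-(t - 1) ^ 2 / 4) / Real.sqrt (4 * Real.pi) := by
  rw [varKernel, rpow_mul_exp_eq n ht]
  refine mul_le_of_le_one_left (by positivity) ?_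
  rw [Real.exp_le_one_iff]
  have := Real.one_sub_inv_le_log_of_pos ht
  have h : 0 ≤ Real.log t + t⁻¹ := by linarith
  have := mul_nonneg (by positivity : (0:ℝ) ≤ (n:ℝ)/2) h
  linarith

lemma one_add_div_rpow_le_one (n p : ℕ) {t : ℝ} (ht : 0 < t) :
    (1 + n / t) ^ (-(p : ℝ) / 2) ≤ 1 := by
  apply Real.rpow_le_one_of_one_le_of_nonpos
  · have : 0 ≤ n / t := by positivity
    linarith
  · have : (0:ℝ) ≤ p := p.cast_nonneg
    linarith

lemma integrableOn_varKernel (n p : ℕ) :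
    IntegrableOn (fun t => varKernel n t * (1 + n / t) ^ (-(p : ℝ) / 2)) (Set.Ioi 0) := by
  have hg : Integrable (fun t : ℝ => Real.exp (-(t - 1) ^ 2 / 4) / Real.sqrt (4 * Real.pi)) := by
    have h := ((integrable_exp_neg_mul_sq (b := 1 / 4) (by norm_num)).comp_sub_right 1).div_const
      (Real.sqrt (4 * Real.pi))
    refine h.congr (ae_of_all _ fun t => ?_)
    dsimp only
    congr 2; ring
  refine Integrable.mono' hg.integrableOn ?_ ?_
  · apply Measurable.aestronglyMeasurable
    unfold varKernel
    fun_prop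
  · filter_upwards [ae_restrict_mem measurableSet_Ioi] with t ht
    have ht : 0 < t := ht
    have h1 := varKernel_pos n ht
    rw [Real.norm_of_nonneg (by positivity)]
    exact (mul_le_of_le_one_right h1.le (one_add_div_rpow_le_one n p ht)).trans (varKernel_le n ht)

lemma evidenceFactor_le_zero (n p : ℕ) : evidenceFactor n p ≤ evidenceFactor n 0 := by
  refine setIntegral_mono_on (integrableOn_varKernel n p) (integrableOn_varKernel n 0)
    measurableSet_Ioi fun t ht => ?_
  have ht : 0 < t := ht
  have := one_add_div_rpow_le_one n p ht
  simpa using mul_le_of_le_one_right (varKernel_pos n ht).le this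

/-- Below the maximum likelihood estimate `t = 1`, both the likelihood and the prior increase. -/
lemma varKernel_monotoneOn (n : ℕ) : MonotoneOn (varKernel n) (Set.Ioc 0 1) := by
  intro s hs t ht hst
  rw [varKernel, varKernel, rpow_mul_exp_eq n hs.1, rpow_mul_exp_eq n ht.1]
  have hlog : Real.log t + t⁻¹ ≤ Real.log s + s⁻¹ := by
    -- `log (t / s) ≤ t / s - 1 ≤ 1 / s - 1 / t`, as `t ≤ 1`
    have h1 := Real.log_le_sub_one_of_pos (div_pos ht.1 hs.1)
    rw [Real.log_div ht.1.ne' hs.1.ne'] at h1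
    have h2 : t / s - 1 ≤ s⁻¹ - t⁻¹ := by
      have hs0 := hs.1
      have ht0 := ht.1
      rw [div_sub_one hs0.ne', inv_sub_inv hs0.ne' ht0.ne']
      apply div_le_div_of_nonneg_left (by linarith) (by positivity)
      have := ht.2
      nlinarith
    linarith
  gcongr ?_ * (?_ / _)
  · apply Real.exp_le_exp.mpr
    have := mul_le_mul_of_nonneg_left hlog (by positivity : (0:ℝ) ≤ (n:ℝ)/2)
    linarith
  · apply Real.exp_le_exp.mpr
    have := ht.2
    have := hs.1
    nlinarith

/-- Regressors cost a polynomial factor only: on `t ≥ 1 / 2` the factor `(1 + n / t)^(-p/2)` is at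
least `(1 + 2 n)^(-p/2)`, and at least half of the mass of the increasing kernel on `(0, 1]` is
there. -/
lemma evidenceFactor_zero_le (n p : ℕ) :
    evidenceFactor n 0 ≤ 2 * (1 + 2 * n) ^ ((p : ℝ) / 2) * evidenceFactor n p := by
  have hint0 : IntegrableOn (varKernel n) (Set.Ioi 0) := by
    simpa using integrableOn_varKernel n 0
  have e0 : evidenceFactor n 0 = ∫ t in Set.Ioi 0, varKernel n t := by simp [evidenceFactor]
  have hsplit : ∫ t in Set.Ioi 0, varKernel n t =
      (∫ t in Set.Ioc 0 (1/2), varKernel n t) + ∫ t in Set.Ioi (1/2), varKernel n t := by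
    rw [← setIntegral_union (Set.Ioc_disjoint_Ioi le_rfl) measurableSet_Ioi
      (hint0.mono_set Set.Ioc_subset_Ioi_self)
      (hint0.mono_set (Set.Ioi_subset_Ioi (by norm_num))),
      Set.Ioc_union_Ioi_eq_Ioi (by norm_num)]
  have hhalf : ∫ t in Set.Ioc 0 (1/2), varKernel n t ≤ ∫ t in Set.Ioi (1/2), varKernel n t := by
    calc ∫ t in Set.Ioc 0 (1/2), varKernel n t ≤ ∫ t in Set.Ioc (0:ℝ) (1/2), varKernel n (1/2) := by
          refine setIntegral_mono_on (hint0.mono_set Set.Ioc_subset_Ioi_self)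
            (integrableOn_const (by simp)) measurableSet_Ioc fun t ht => ?_
          exact varKernel_monotoneOn n ⟨ht.1, by linarith [ht.2]⟩ ⟨by norm_num, by norm_num⟩ ht.2
      _ = ∫ t in Set.Ioc (1/2:ℝ) 1, varKernel n (1/2) := by simp; norm_num
      _ ≤ ∫ t in Set.Ioc (1/2) 1, varKernel n t := by
          refine setIntegral_mono_on (integrableOn_const (by simp))
            (hint0.mono_set fun t ht => lt_trans (by norm_num) ht.1) measurableSet_Ioc
            fun t ht => ?_
          exact varKernel_monotoneOn n ⟨by norm_num, by norm_num⟩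
            ⟨lt_trans (by norm_num) ht.1, ht.2⟩ ht.1.le
      _ ≤ ∫ t in Set.Ioi (1/2), varKernel n t := by
          refine setIntegral_mono_set (hint0.mono_set (Set.Ioi_subset_Ioi (by norm_num))) ?_
            (Set.Ioc_subset_Ioi_self).eventuallyLE
          filter_upwards [ae_restrict_mem measurableSet_Ioi] with t ht
          exact (varKernel_pos n (lt_trans (by norm_num) ht)).le
  have hlow : ∫ t in Set.Ioi (1/2), varKernel n t ≤
      (1 + 2 * n) ^ ((p : ℝ) / 2) * evidenceFactor n p := by
    rw [evidenceFactor, ← integral_const_mul]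
    have hI := (integrableOn_varKernel n p).const_mul ((1 + 2 * (n:ℝ)) ^ ((p : ℝ) / 2))
    calc _ ≤ ∫ t in Set.Ioi (1/2), (1 + 2 * (n:ℝ)) ^ ((p : ℝ) / 2) *
          (varKernel n t * (1 + n / t) ^ (-(p : ℝ) / 2)) := by
          refine setIntegral_mono_on (hint0.mono_set (Set.Ioi_subset_Ioi (by norm_num)))
            (IntegrableOn.mono_set hI (Set.Ioi_subset_Ioi (by norm_num))) measurableSet_Ioi
            fun t ht => ?_
          have ht' : (1/2:ℝ) < t := ht
          have ht0 : 0 < t := lt_trans (by norm_num) ht'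
          have h1 : (1 + (n:ℝ) / t) ≤ 1 + 2 * n := by
            gcongr
            rw [div_le_iff₀ ht0]
            have : (0:ℝ) ≤ n := n.cast_nonneg
            nlinarith
          have h2 : 1 ≤ (1 + 2 * (n:ℝ)) ^ ((p : ℝ) / 2) * (1 + n / t) ^ (-(p : ℝ) / 2) := by
            rw [neg_div, Real.rpow_neg (by positivity), ← div_eq_mul_inv,
              one_le_div (by positivity)]
            exact Real.rpow_le_rpow (by positivity) h1 (by positivity)
          have h3 := varKernel_pos n ht0
          nlinarith
      _ ≤ _ := by
          refine setIntegral_mono_set hI ?_ (Set.Ioi_subset_Ioi (by norm_num)).eventuallyLE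
          filter_upwards [ae_restrict_mem measurableSet_Ioi] with t ht
          have ht : 0 < t := ht
          have h3 := varKernel_pos n ht
          simp only [Pi.zero_apply]
          positivity
  rw [e0, hsplit]
  linarith

lemma evidenceFactor_nonneg (n p : ℕ) : 0 ≤ evidenceFactor n p := by
  refine setIntegral_nonneg measurableSet_Ioi fun t ht => ?_
  have ht : 0 < t := ht
  have := varKernel_pos n ht
  positivity

lemma evidenceFactor_pos (n p : ℕ) : 0 < evidenceFactor n p := by
  have h0 : 0 < evidenceFactor n 0 := by
    have hint0 : IntegrableOn (varKernel n) (Set.Ioi 0) := by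
      simpa using integrableOn_varKernel n 0
    have e0 : evidenceFactor n 0 = ∫ t in Set.Ioi 0, varKernel n t := by simp [evidenceFactor]
    rw [e0, setIntegral_pos_iff_support_of_nonneg_ae ?_ hint0]
    · have : Function.support (varKernel n) ∩ Set.Ioi 0 = Set.Ioi 0 :=
        Set.inter_eq_right.mpr fun t ht => (varKernel_pos n ht).ne'
      rw [this]; simp
    · filter_upwards [ae_restrict_mem measurableSet_Ioi] with t ht
      exact (varKernel_pos n ht).le
  by_contra h
  have h1 : evidenceFactor n p = 0 := le_antisymm (not_lt.mp h) (evidenceFactor_nonneg n p)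
  have := evidenceFactor_zero_le n p
  rw [h1] at this
  linarith

variable {n : ℕ} {κ : Type*} [Fintype κ] [DecidableEq κ]

lemma integratedLikelihood_nonneg (A : Matrix (Fin n) κ ℝ) (y : Fin n → ℝ) :
    0 ≤ integratedLikelihood A y := by
  refine setIntegral_nonneg (MeasurableSet.univ.prod measurableSet_Ioi) fun p hp => ?_
  have hs : (0:ℝ) < p.2 := hp.2
  unfold regLikelihood uipDensity
  positivity

/-- The coefficients and the scale of the variance integrate out explicitly: up to a factor that
depends on the numbers of observations and regressors only, the integrated likelihood is the
maximised one, `ŝ^(-n/2)`. -/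
lemma integratedLikelihood_eq (hn : 0 < n) {A : Matrix (Fin n) κ ℝ} (hA : (Aᵀ * A).det ≠ 0)
    {y : Fin n → ℝ} (hs : 0 < varMLE A y) :
    integratedLikelihood A y =
      varMLE A y ^ (-(n : ℝ) / 2) * evidenceFactor n (Fintype.card κ) := by
  set v := varMLE A y with hv
  set p := Fintype.card κ with hp
  have hn' : (0:ℝ) < n := by exact_mod_cast hn
  have hΛ : (unitInfoCoeff A y).PosDef := by
    refine (gram_posDef hA).smul ?_
    positivity
  set Λ := unitInfoCoeff A y with hΛdef
  have hdet : 0 < Real.sqrt Λ.det := Real.sqrt_pos.mpr hΛ.det_pos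
  -- the factors of the integrand that do not involve the coefficients
  set K : ℝ → ℝ := fun s => s ^ (-(n : ℝ) / 2) * Real.exp (-(n * v) / (2 * s)) *
    ((2 * Real.pi) ^ (-(p : ℝ) / 2) * Real.sqrt Λ.det) *
      (Real.sqrt (unitInfoVar A y / (2 * Real.pi)) *
        Real.exp (-(unitInfoVar A y * (s - v) ^ 2) / 2)) with hK
  have hf : ∀ s, 0 < s → ∀ b, regLikelihood A y b s * uipDensity A y b s =
      K s * Real.exp (-((1 + n * v / s) * ((b - ols A y) ⬝ᵥ (Λ *ᵥ (b - ols A y)))) / 2) := by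
    intro s hs0 b
    have hq : (b - ols A y) ⬝ᵥ ((Aᵀ * A) *ᵥ (b - ols A y)) =
        n * v * ((b - ols A y) ⬝ᵥ (Λ *ᵥ (b - ols A y))) := by
      rw [hΛdef, unitInfoCoeff, Matrix.smul_mulVec, dotProduct_smul, smul_eq_mul, ← mul_assoc,
        mul_inv_cancel₀ (by positivity), one_mul]
    rw [regLikelihood, uipDensity, sqResid_eq hA, hq, hK]
    set x := (b - ols A y) ⬝ᵥ (Λ *ᵥ (b - ols A y))
    have he : Real.exp (-(n * v + n * v * x) / (2 * s)) * Real.exp (-x / 2) =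
        Real.exp (-(n * v) / (2 * s)) * Real.exp (-((1 + n * v / s) * x) / 2) := by
      rw [← Real.exp_add, ← Real.exp_add]
      congr 1; field_simp; ring
    linear_combination (s ^ (-(n : ℝ) / 2) *
      ((2 * Real.pi) ^ (-(p : ℝ) / 2) * Real.sqrt Λ.det) *
      (Real.sqrt (unitInfoVar A y / (2 * Real.pi)) *
        Real.exp (-(unitInfoVar A y * (s - v) ^ 2) / 2))) * he
  have hKpos : ∀ s, 0 < s → 0 ≤ K s := fun s hs0 => by rw [hK]; positivity
  have hinner : ∀ s, 0 < s →
      Integrable (fun b => regLikelihood A y b s * uipDensity A y b s) ∧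
      ∫ b, regLikelihood A y b s * uipDensity A y b s =
        v ^ (-(n : ℝ) / 2) * v⁻¹ *
          (varKernel n (v⁻¹ * s) * (1 + n / (v⁻¹ * s)) ^ (-(p : ℝ) / 2)) := by
    intro s hs0
    have hc : 0 < 1 + n * v / s := by positivity
    obtain ⟨hi, he⟩ := integrable_integral_gaussian_form hΛ hc
    refine ⟨?_, ?_⟩
    · simp_rw [hf s hs0]
      exact (hi.comp_sub_right (ols A y)).const_mul (K s)
    simp_rw [hf s hs0]
    rw [integral_const_mul, integral_sub_right_eq_self
      (fun x => Real.exp (-((1 + n * v / s) * (x ⬝ᵥ (Λ *ᵥ x))) / 2)), he, hK, varKernel]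
    have h1 : Real.sqrt (unitInfoVar A y / (2 * Real.pi)) = v⁻¹ / Real.sqrt (4 * Real.pi) := by
      have : unitInfoVar A y / (2 * Real.pi) = v⁻¹ ^ 2 / (4 * Real.pi) := by
        rw [unitInfoVar, ← hv]; field_simp; ring
      rw [this, Real.sqrt_div (by positivity), Real.sqrt_sq (by positivity)]
    have h2 : (v⁻¹ * s) ^ (-(n : ℝ) / 2) = (v ^ (-(n : ℝ) / 2))⁻¹ * s ^ (-(n : ℝ) / 2) := by
      rw [Real.mul_rpow (by positivity) hs0.le, Real.inv_rpow hs.le]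
    have h3 : (2 * Real.pi) ^ (-(p : ℝ) / 2) * (2 * Real.pi) ^ ((p : ℝ) / 2) = 1 := by
      rw [← Real.rpow_add (by positivity)]
      simp [neg_div]
    have h4 : (n : ℝ) / (v⁻¹ * s) = n * v / s := by field_simp
    have h5 : -(n : ℝ) / (2 * (v⁻¹ * s)) = -(n * v) / (2 * s) := by field_simp
    have h6 : -(v⁻¹ * s - 1) ^ 2 / 4 = -(unitInfoVar A y * (s - v) ^ 2) / 2 := by
      rw [unitInfoVar, ← hv]; field_simp; ring
    have h7 : v ^ (-(n : ℝ) / 2) * (v ^ (-(n : ℝ) / 2))⁻¹ = 1 :=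
      mul_inv_cancel₀ (Real.rpow_pos_of_pos hs _).ne'
    rw [h1, h2, h4, h5, h6]
    have h8 : Real.sqrt Λ.det * (Real.sqrt Λ.det)⁻¹ = 1 := mul_inv_cancel₀ hdet.ne'
    set c1 := s ^ (-(n : ℝ) / 2)
    set c2 := Real.exp (-(n * v) / (2 * s))
    set c3 := (2 * Real.pi) ^ (-(p : ℝ) / 2)
    set c4 := (2 * Real.pi) ^ ((p : ℝ) / 2)
    set c5 := (1 + n * v / s) ^ (-(p : ℝ) / 2)
    set c6 := Real.exp (-(unitInfoVar A y * (s - v) ^ 2) / 2)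
    set c7 := Real.sqrt Λ.det
    set c8 := v ^ (-(n : ℝ) / 2)
    calc _ = (c3 * c4) * (c7 * c7⁻¹) * (c1 * c2 * c5 * c6 * v⁻¹ / Real.sqrt (4 * Real.pi)) := by
          ring
      _ = (c8 * c8⁻¹) * (c1 * c2 * c5 * c6 * v⁻¹ / Real.sqrt (4 * Real.pi)) := by
          rw [h3, h7, h8]; ring
      _ = _ := by ring
  have hFint : IntegrableOn (fun s => v ^ (-(n : ℝ) / 2) * v⁻¹ *
      (varKernel n (v⁻¹ * s) * (1 + n / (v⁻¹ * s)) ^ (-(p : ℝ) / 2))) (Set.Ioi 0) := by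
    have := (integrableOn_Ioi_comp_mul_left_iff
      (fun t => varKernel n t * (1 + n / t) ^ (-(p : ℝ) / 2)) 0 (inv_pos.mpr hs)).mpr
      (by simpa using integrableOn_varKernel n p)
    exact Integrable.const_mul this _
  have hmeas : Measurable
      (fun q : (κ → ℝ) × ℝ => regLikelihood A y q.1 q.2 * uipDensity A y q.1 q.2) := by
    unfold regLikelihood uipDensity sqResid dotProduct Matrix.mulVec dotProduct
    fun_prop
  rw [integratedLikelihood, Measure.volume_eq_prod, ← Measure.prod_restrict, Measure.restrict_univ]
  have hint : Integrable
      (fun q : (κ → ℝ) × ℝ => regLikelihood A y q.1 q.2 * uipDensity A y q.1 q.2)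
      ((volume : Measure (κ → ℝ)).prod (volume.restrict (Set.Ioi 0))) := by
    rw [integrable_prod_iff' hmeas.aestronglyMeasurable]
    refine ⟨?_, ?_⟩
    · filter_upwards [ae_restrict_mem measurableSet_Ioi] with s hs0
      exact (hinner s hs0).1
    · refine Integrable.congr hFint ?_
      filter_upwards [ae_restrict_mem measurableSet_Ioi] with s hs0
      rw [← (hinner s hs0).2]
      refine integral_congr_ae (ae_of_all _ fun b => ?_)
      have hnn : 0 ≤ regLikelihood A y b s * uipDensity A y b s := by
        rw [hf s hs0]
        exact mul_nonneg (hKpos s hs0) (Real.exp_nonneg _)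
      exact (Real.norm_of_nonneg hnn).symm
  rw [integral_prod_symm _ hint, setIntegral_congr_fun measurableSet_Ioi
    (fun s hs0 => (hinner s hs0).2), integral_const_mul,
    integral_comp_mul_left_Ioi (fun t => varKernel n t * (1 + n / t) ^ (-(p : ℝ) / 2)) 0
      (inv_pos.mpr hs), evidenceFactor]
  simp only [mul_zero, inv_inv, smul_eq_mul]
  field_simp

end IntegratedLikelihood

/-! ### Limits of least squares and of posterior weights -/

section MatrixLimits

variable {ι κ μ ν : Type*} [Fintype μ] {l : Filter ι}

lemma tendsto_matrix_mul {A : ι → Matrix κ μ ℝ} {B : ι → Matrix μ ν ℝ} {a : Matrix κ μ ℝ}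
    {b : Matrix μ ν ℝ} (hA : Tendsto A l (𝓝 a)) (hB : Tendsto B l (𝓝 b)) :
    Tendsto (fun i => A i * B i) l (𝓝 (a * b)) :=
  ((continuous_fst.matrix_mul continuous_snd).tendsto (a, b)).comp (hA.prodMk_nhds hB)

lemma tendsto_mulVec {A : ι → Matrix κ μ ℝ} {x : ι → μ → ℝ} {a : Matrix κ μ ℝ}
    {b : μ → ℝ} (hA : Tendsto A l (𝓝 a)) (hx : Tendsto x l (𝓝 b)) :
    Tendsto (fun i => A i *ᵥ x i) l (𝓝 (a *ᵥ b)) :=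
  ((continuous_fst.matrix_mulVec continuous_snd).tendsto (a, b)).comp (hA.prodMk_nhds hx)

lemma tendsto_dotProduct {x y : ι → μ → ℝ} {a b : μ → ℝ} (hx : Tendsto x l (𝓝 a))
    (hy : Tendsto y l (𝓝 b)) : Tendsto (fun i => x i ⬝ᵥ y i) l (𝓝 (a ⬝ᵥ b)) :=
  ((continuous_fst.dotProduct continuous_snd).tendsto (a, b)).comp (hx.prodMk_nhds hy)

lemma tendsto_transpose {A : ι → Matrix κ ν ℝ} {a : Matrix κ ν ℝ} (hA : Tendsto A l (𝓝 a)) :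
    Tendsto (fun i => (A i)ᵀ) l (𝓝 aᵀ) :=
  (continuous_id.matrix_transpose.tendsto a).comp hA

lemma tendsto_matrix_inv [DecidableEq μ] {A : ι → Matrix μ μ ℝ} {a : Matrix μ μ ℝ}
    (hA : Tendsto A l (𝓝 a)) (ha : a.det ≠ 0) : Tendsto (fun i => (A i)⁻¹) l (𝓝 a⁻¹) := by
  have h : ContinuousAt Ring.inverse a.det := by
    rw [Ring.inverse_eq_inv']
    exact continuousAt_inv₀ ha
  exact (continuousAt_matrix_inv a h).tendsto.comp hA

end MatrixLimits

section RegressionLimits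

variable {ι κ μ : Type*} [Fintype μ] {l : Filter ι} {N : ι → ℕ}

/-- The Gram matrix of a design divided by the number of observations. -/
def meanGram {n : ℕ} (A : Matrix (Fin n) κ ℝ) : Matrix κ κ ℝ := (n : ℝ)⁻¹ • (Aᵀ * A)

lemma meanGram_mul {n : ℕ} (E : Matrix (Fin n) μ ℝ) (C : Matrix μ κ ℝ) :
    meanGram (E * C) = Cᵀ * meanGram E * C := by
  simp only [meanGram, Matrix.transpose_mul, Matrix.mul_smul, Matrix.smul_mul, Matrix.mul_assoc]

section

variable [Fintype κ] [DecidableEq κ]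

lemma det_gram_ne_zero {n : ℕ} (A : Matrix (Fin n) κ ℝ) (h : (meanGram A).det ≠ 0) :
    (Aᵀ * A).det ≠ 0 := by
  rw [meanGram, Matrix.det_smul] at h
  exact right_ne_zero_of_mul h

lemma meanGram_inv {n : ℕ} (hn : n ≠ 0) (A : Matrix (Fin n) κ ℝ) (h : (Aᵀ * A).det ≠ 0) :
    (meanGram A)⁻¹ = (n : ℝ) • (Aᵀ * A)⁻¹ := by
  have hn' : (n : ℝ) ≠ 0 := by exact_mod_cast hn
  have := Matrix.inv_smul' (A := Aᵀ * A) (Units.mk0 (n : ℝ)⁻¹ (inv_ne_zero hn'))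
    (isUnit_iff_ne_zero.mpr h)
  simpa [Units.smul_def, meanGram] using this

lemma ols_eq_meanGram {n : ℕ} (hn : n ≠ 0) (A : Matrix (Fin n) κ ℝ) (h : (Aᵀ * A).det ≠ 0)
    (y : Fin n → ℝ) : ols A y = (meanGram A)⁻¹ *ᵥ ((n : ℝ)⁻¹ • (Aᵀ *ᵥ y)) := by
  have hn' : (n : ℝ) ≠ 0 := by exact_mod_cast hn
  rw [ols, meanGram_inv hn A h, Matrix.smul_mulVec, Matrix.mulVec_smul, smul_smul,
    mul_inv_cancel₀ hn', one_smul]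

/-- Least squares in designs `E C` with coordinates `C` in a common array `E` whose mean Gram
matrix converges: the coefficient and the residual variance converge to those of the projection in
the limiting inner product. -/
lemma tendsto_ols_varMLE (hN : Tendsto N l atTop) {E : (i : ι) → Matrix (Fin (N i)) μ ℝ}
    {Γ : Matrix μ μ ℝ} (hE : Tendsto (fun i => meanGram (E i)) l (𝓝 Γ))
    {C : ι → Matrix μ κ ℝ} {c : Matrix μ κ ℝ} (hC : Tendsto C l (𝓝 c))
    {z : μ → ℝ} (hdet : (cᵀ * Γ * c).det ≠ 0) :
    (∀ᶠ i in l, ((E i * C i)ᵀ * (E i * C i)).det ≠ 0) ∧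
    Tendsto (fun i => ols (E i * C i) (E i *ᵥ z)) l
      (𝓝 ((cᵀ * Γ * c)⁻¹ *ᵥ (cᵀ *ᵥ (Γ *ᵥ z)))) ∧
    Tendsto (fun i => varMLE (E i * C i) (E i *ᵥ z)) l
      (𝓝 ((z - c *ᵥ ((cᵀ * Γ * c)⁻¹ *ᵥ (cᵀ *ᵥ (Γ *ᵥ z)))) ⬝ᵥ
        (Γ *ᵥ (z - c *ᵥ ((cᵀ * Γ * c)⁻¹ *ᵥ (cᵀ *ᵥ (Γ *ᵥ z))))))) := by
  have hG : Tendsto (fun i => meanGram (E i * C i)) l (𝓝 (cᵀ * Γ * c)) := by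
    simp_rw [meanGram_mul]
    exact tendsto_matrix_mul (tendsto_matrix_mul (tendsto_transpose hC) hE) hC
  have hev : ∀ᶠ i in l, ((E i * C i)ᵀ * (E i * C i)).det ≠ 0 := by
    have : Tendsto (fun i => (meanGram (E i * C i)).det) l (𝓝 (cᵀ * Γ * c).det) :=
      ((continuous_id.matrix_det).tendsto _).comp hG
    filter_upwards [this.eventually_ne hdet] with i hi
    exact det_gram_ne_zero _ hi
  have hols : Tendsto (fun i => ols (E i * C i) (E i *ᵥ z)) l
      (𝓝 ((cᵀ * Γ * c)⁻¹ *ᵥ (cᵀ *ᵥ (Γ *ᵥ z)))) := by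
    have h1 : Tendsto (fun i => (meanGram (E i * C i))⁻¹ *ᵥ ((C i)ᵀ *ᵥ (meanGram (E i) *ᵥ z))) l
        (𝓝 ((cᵀ * Γ * c)⁻¹ *ᵥ (cᵀ *ᵥ (Γ *ᵥ z)))) :=
      tendsto_mulVec (tendsto_matrix_inv hG hdet)
        (tendsto_mulVec (tendsto_transpose hC) (tendsto_mulVec hE tendsto_const_nhds))
    refine h1.congr' ?_
    filter_upwards [hev, hN.eventually_ne_atTop 0] with i hi hn
    rw [ols_eq_meanGram hn _ hi]
    congr 1
    rw [meanGram, Matrix.transpose_mul, Matrix.smul_mulVec, Matrix.mulVec_smul,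
      ← Matrix.mulVec_mulVec, ← Matrix.mulVec_mulVec]
  refine ⟨hev, hols, ?_⟩
  set b := (cᵀ * Γ * c)⁻¹ *ᵥ (cᵀ *ᵥ (Γ *ᵥ z))
  have hr : Tendsto (fun i => z - C i *ᵥ ols (E i * C i) (E i *ᵥ z)) l (𝓝 (z - c *ᵥ b)) :=
    tendsto_const_nhds.sub (tendsto_mulVec hC hols)
  refine (tendsto_dotProduct hr (tendsto_mulVec hE hr)).congr fun i => ?_
  have h1 : E i *ᵥ z - (E i * C i) *ᵥ ols (E i * C i) (E i *ᵥ z) =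
      E i *ᵥ (z - C i *ᵥ ols (E i * C i) (E i *ᵥ z)) := by
    rw [Matrix.mulVec_sub, Matrix.mulVec_mulVec]
  rw [varMLE, sqResid, h1]
  generalize z - C i *ᵥ ols (E i * C i) (E i *ᵥ z) = r
  rw [meanGram, Matrix.smul_mulVec, dotProduct_smul, ← Matrix.mulVec_mulVec,
    Matrix.dotProduct_mulVec r, Matrix.vecMul_transpose, smul_eq_mul, div_eq_inv_mul]

end

section

variable [DecidableEq κ]

/-- The zero extension of a coefficient vector of a submodel, as a matrix. -/
def extendMat {σ : Type*} (f : σ → κ) : Matrix κ σ ℝ := (1 : Matrix κ κ ℝ).submatrix id f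

lemma mul_extendMat [Fintype κ] {σ m : Type*} (C : Matrix m κ ℝ) (f : σ → κ) :
    C * extendMat f = C.submatrix id f := by
  have := (Matrix.submatrix_mul C (1 : Matrix κ κ ℝ) id id f Function.bijective_id).symm
  rw [Matrix.mul_one] at this
  simpa [extendMat] using this

lemma extendMat_mulVec_apply {σ : Type*} [Fintype σ] {f : σ → κ} (hf : f.Injective) (b : σ → ℝ)
    (s : σ) : (extendMat f *ᵥ b) (f s) = b s := by
  classical
  simp [extendMat, Matrix.mulVec, dotProduct, Matrix.one_apply, hf.eq_iff]

lemma extendMat_mulVec_of_notMem {σ : Type*} [Fintype σ] {f : σ → κ} (b : σ → ℝ) {a : κ}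
    (ha : a ∉ Set.range f) : (extendMat f *ᵥ b) a = 0 := by
  simp only [extendMat, Matrix.mulVec, dotProduct]
  refine Finset.sum_eq_zero fun s _ => ?_
  rw [Matrix.submatrix_apply, id, Matrix.one_apply_ne, zero_mul]
  rintro rfl
  exact ha ⟨s, rfl⟩

lemma extendMat_mulVec_comp {σ : Type*} [Fintype σ] {f : σ → κ} (hf : f.Injective) {γ : κ → ℝ}
    (hγ : ∀ a, γ a ≠ 0 → a ∈ Set.range f) : extendMat f *ᵥ (γ ∘ f) = γ := by
  ext a
  by_cases ha : a ∈ Set.range f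
  · obtain ⟨s, rfl⟩ := ha
    rw [extendMat_mulVec_apply hf, Function.comp]
  · rw [extendMat_mulVec_of_notMem _ ha]
    by_contra h
    exact ha (hγ a (Ne.symm h))

end

/-- Submodels of a regression `y = E (c γ + u)` with `c' Γ u = 0`: a submodel `f` that contains the
support of `γ` is consistent and has limiting residual variance `u' Γ u`; any other has a larger
one. -/
lemma submodel_limits [Fintype κ] [DecidableEq κ] (hN : Tendsto N l atTop)
    {E : (i : ι) → Matrix (Fin (N i)) μ ℝ}
    {Γ : Matrix μ μ ℝ} (hΓ : Γ.PosDef) (hE : Tendsto (fun i => meanGram (E i)) l (𝓝 Γ))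
    {C : ι → Matrix μ κ ℝ} {c : Matrix μ κ ℝ} (hC : Tendsto C l (𝓝 c))
    (hc : Function.Injective c.mulVec) (γ : κ → ℝ) (u : μ → ℝ) (hu : cᵀ *ᵥ (Γ *ᵥ u) = 0)
    {σ : Type*} [Fintype σ] [DecidableEq σ] {f : σ → κ} (hf : f.Injective) :
    ∃ (b : σ → ℝ) (v : ℝ),
      (∀ᶠ i in l, (((E i * C i).submatrix id f)ᵀ * (E i * C i).submatrix id f).det ≠ 0) ∧
      Tendsto (fun i => ols ((E i * C i).submatrix id f) (E i *ᵥ (c *ᵥ γ + u))) l (𝓝 b) ∧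
      Tendsto (fun i => varMLE ((E i * C i).submatrix id f) (E i *ᵥ (c *ᵥ γ + u))) l (𝓝 v) ∧
      ((∀ a, γ a ≠ 0 → a ∈ Set.range f) → b = γ ∘ f ∧ v = u ⬝ᵥ (Γ *ᵥ u)) ∧
      ((∃ a, γ a ≠ 0 ∧ a ∉ Set.range f) → u ⬝ᵥ (Γ *ᵥ u) < v) := by
  have hsub : ∀ i, (E i * C i).submatrix id f = E i * (C i * extendMat f) := fun i => by
    rw [← mul_extendMat, Matrix.mul_assoc]
  simp_rw [hsub]
  set F := extendMat f with hF
  have hFinj : Function.Injective F.mulVec := fun x y hxy => by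
    ext s
    have := congrFun hxy (f s)
    rwa [extendMat_mulVec_apply hf, extendMat_mulVec_apply hf] at this
  have hCF : Tendsto (fun i => C i * F) l (𝓝 (c * F)) :=
    tendsto_matrix_mul hC tendsto_const_nhds
  have hcF : Function.Injective (c * F).mulVec := by
    have : (c * F).mulVec = c.mulVec ∘ F.mulVec := by
      ext x : 1
      exact (Matrix.mulVec_mulVec x c F).symm
    rw [this]
    exact hc.comp hFinj
  have hPD : ((c * F)ᵀ * Γ * (c * F)).PosDef := by
    simpa using hΓ.conjTranspose_mul_mul_same hcF
  have hdet := hPD.det_pos.ne'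
  obtain ⟨h1, h2, h3⟩ := tendsto_ols_varMLE hN hE hCF (z := c *ᵥ γ + u) hdet
  set b := ((c * F)ᵀ * Γ * (c * F))⁻¹ *ᵥ ((c * F)ᵀ *ᵥ (Γ *ᵥ (c *ᵥ γ + u))) with hb
  refine ⟨b, _, h1, h2, h3, ?_, ?_⟩
  · intro hγ
    have hγF : F *ᵥ (γ ∘ f) = γ := extendMat_mulVec_comp hf hγ
    have hbγ : b = γ ∘ f := by
      have : (c * F)ᵀ *ᵥ (Γ *ᵥ (c *ᵥ γ + u)) = ((c * F)ᵀ * Γ * (c * F)) *ᵥ (γ ∘ f) := by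
        rw [Matrix.mulVec_add, Matrix.mulVec_add, Matrix.transpose_mul, ← Matrix.mulVec_mulVec _ Fᵀ,
          ← Matrix.mulVec_mulVec _ Fᵀ, hu, Matrix.mulVec_zero, add_zero]
        conv_lhs => rw [← hγF]
        simp only [Matrix.mulVec_mulVec, Matrix.mul_assoc]
      rw [hb, this, Matrix.mulVec_mulVec, Matrix.nonsing_inv_mul _ (isUnit_iff_ne_zero.mpr hdet),
        Matrix.one_mulVec]
    refine ⟨hbγ, ?_⟩
    rw [hbγ, ← Matrix.mulVec_mulVec, hγF]
    simp
  · rintro ⟨a, ha, haf⟩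
    set w := γ - F *ᵥ b with hw
    have hw0 : w ≠ 0 := by
      intro h
      have h' := congrFun h a
      rw [hw, Pi.sub_apply, extendMat_mulVec_of_notMem _ haf] at h'
      exact ha (by simpa using h')
    have hz : c *ᵥ γ + u - (c * F) *ᵥ b = c *ᵥ w + u := by
      rw [hw, Matrix.mulVec_sub, ← Matrix.mulVec_mulVec b c F]; abel
    have hcw : c *ᵥ w ≠ 0 := fun h => hw0 (hc (by rw [h]; exact (Matrix.mulVec_zero c).symm))
    have hcross : (c *ᵥ w) ⬝ᵥ (Γ *ᵥ u) = 0 := by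
      rw [← Matrix.vecMul_transpose, ← Matrix.dotProduct_mulVec, hu, dotProduct_zero]
    have hcross' : u ⬝ᵥ (Γ *ᵥ (c *ᵥ w)) = 0 := by
      have hsymm : Γᵀ = Γ := by simpa using hΓ.isHermitian.eq
      rw [Matrix.dotProduct_mulVec, dotProduct_comm, ← hsymm, Matrix.vecMul_transpose]
      exact hcross
    have hpos : 0 < (c *ᵥ w) ⬝ᵥ (Γ *ᵥ (c *ᵥ w)) := by
      simpa using hΓ.dotProduct_mulVec_pos hcw
    rw [hz, Matrix.mulVec_add, dotProduct_add, add_dotProduct, add_dotProduct, hcross, hcross']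
    linarith

end RegressionLimits

section Averaging

variable {ι : Type*} {l : Filter ι} {N : ι → ℕ}

/-- The odds of a regression against one with a smaller limiting residual variance vanish
exponentially fast; a factor `n` is all that is needed. -/
lemma tendsto_evidence_ratio (hN : Tendsto N l atTop) {κ κ₀ : Type*} [Fintype κ] [DecidableEq κ]
    [Fintype κ₀] [DecidableEq κ₀] {A : (i : ι) → Matrix (Fin (N i)) κ ℝ}
    {A₀ : (i : ι) → Matrix (Fin (N i)) κ₀ ℝ} {y : (i : ι) → Fin (N i) → ℝ}
    (hA : ∀ᶠ i in l, ((A i)ᵀ * A i).det ≠ 0) (hA₀ : ∀ᶠ i in l, ((A₀ i)ᵀ * A₀ i).det ≠ 0)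
    {v v₀ : ℝ} (hv : Tendsto (fun i => varMLE (A i) (y i)) l (𝓝 v))
    (hv₀ : Tendsto (fun i => varMLE (A₀ i) (y i)) l (𝓝 v₀)) (hpos : 0 < v₀) (hlt : v₀ < v) :
    Tendsto (fun i => (N i : ℝ) *
      (integratedLikelihood (A i) (y i) / integratedLikelihood (A₀ i) (y i))) l (𝓝 0) := by
  set p := Fintype.card κ
  set p₀ := Fintype.card κ₀
  have hv_pos : 0 < v := hpos.trans hlt
  obtain ⟨q, hq0, hq1⟩ := exists_between ((div_lt_one hv_pos).mpr hlt)
  have hqpos : 0 < q := (div_pos hpos hv_pos).trans hq0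
  have hratio : ∀ᶠ i in l, varMLE (A₀ i) (y i) / varMLE (A i) (y i) < q :=
    (hv₀.div hv hv_pos.ne').eventually_lt_const hq0
  have hs1 : Real.sqrt q < 1 := (Real.sqrt_lt' one_pos).mpr (by simpa using hq1)
  have hlim : Tendsto (fun i => 2 * (3:ℝ) ^ p₀ *
      ((N i : ℝ) ^ (p₀ + 1) * Real.sqrt q ^ N i)) l (𝓝 0) := by
    have := ((tendsto_pow_const_mul_const_pow_of_lt_one (p₀ + 1) (Real.sqrt_nonneg q) hs1).comp
      hN).const_mul (2 * (3:ℝ) ^ p₀)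
    simpa using this
  refine squeeze_zero' ?_ ?_ hlim
  · exact Eventually.of_forall fun i => mul_nonneg (Nat.cast_nonneg _)
      (div_nonneg (integratedLikelihood_nonneg _ _) (integratedLikelihood_nonneg _ _))
  filter_upwards [hA, hA₀, hratio, hv.eventually_const_lt hv_pos, hv₀.eventually_const_lt hpos,
    hN.eventually_ge_atTop 1] with i hi hi₀ hr hvi hvi₀ hn
  have hn0 : 0 < N i := hn
  have hn1 : (1:ℝ) ≤ N i := by exact_mod_cast hn
  rw [integratedLikelihood_eq hn0 hi hvi, integratedLikelihood_eq hn0 hi₀ hvi₀]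
  set s := varMLE (A i) (y i)
  set s₀ := varMLE (A₀ i) (y i)
  have hc₀ := evidenceFactor_pos (N i) p₀
  have h1 : s ^ (-(N i : ℝ) / 2) / s₀ ^ (-(N i : ℝ) / 2) ≤ Real.sqrt q ^ N i := by
    have e1 : s ^ (-(N i : ℝ) / 2) / s₀ ^ (-(N i : ℝ) / 2) = (s₀ / s) ^ ((N i : ℝ) / 2) := by
      rw [neg_div, Real.rpow_neg hvi.le, Real.rpow_neg hvi₀.le, Real.div_rpow hvi₀.le hvi.le]
      field_simp
    have e2 : Real.sqrt q ^ N i = q ^ ((N i : ℝ) / 2) := by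
      rw [Real.sqrt_eq_rpow, ← Real.rpow_natCast, ← Real.rpow_mul hqpos.le]
      congr 1; ring
    rw [e1, e2]
    exact Real.rpow_le_rpow (by positivity) hr.le (by positivity)
  have h2 : evidenceFactor (N i) p / evidenceFactor (N i) p₀ ≤ 2 * (3:ℝ) ^ p₀ * (N i : ℝ) ^ p₀ := by
    rw [div_le_iff₀ hc₀]
    refine (evidenceFactor_le_zero (N i) p).trans ((evidenceFactor_zero_le (N i) p₀).trans ?_)
    refine mul_le_mul_of_nonneg_right ?_ hc₀.le
    rw [mul_assoc, ← mul_pow]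
    refine mul_le_mul_of_nonneg_left ?_ zero_le_two
    calc (1 + 2 * (N i : ℝ)) ^ ((p₀ : ℝ) / 2) ≤ (1 + 2 * (N i : ℝ)) ^ (p₀ : ℝ) := by
          apply Real.rpow_le_rpow_of_exponent_le (by linarith)
          have : (0:ℝ) ≤ p₀ := p₀.cast_nonneg
          linarith
      _ = (1 + 2 * (N i : ℝ)) ^ p₀ := Real.rpow_natCast _ _
      _ ≤ (3 * (N i : ℝ)) ^ p₀ := by gcongr; linarith
  calc (N i : ℝ) * (s ^ (-(N i : ℝ) / 2) * evidenceFactor (N i) p /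
        (s₀ ^ (-(N i : ℝ) / 2) * evidenceFactor (N i) p₀))
      = N i * ((s ^ (-(N i : ℝ) / 2) / s₀ ^ (-(N i : ℝ) / 2)) *
        (evidenceFactor (N i) p / evidenceFactor (N i) p₀)) := by
          rw [mul_div_mul_comm]
    _ ≤ N i * (Real.sqrt q ^ N i * (2 * (3:ℝ) ^ p₀ * (N i : ℝ) ^ p₀)) := by
          have := evidenceFactor_nonneg (N i) p
          gcongr
    _ = _ := by ring

/-- Posterior weights `s j w j / ∑ s k w k`: a model whose odds against a model `j₀` of the
collection are `o(1/n)` has posterior weight `o(1/n)`. -/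
lemma tendsto_posterior {J : Type*} {𝓙 : Finset J} {j j₀ : J} (hj : j ∈ 𝓙) (hj₀ : j₀ ∈ 𝓙)
    {s : ι → J → ℝ} {w : J → ℝ} (hs : ∀ i k, 0 ≤ s i k) (hw : ∀ k ∈ 𝓙, 0 < w k)
    (h : Tendsto (fun i => (N i : ℝ) * (s i j / s i j₀)) l (𝓝 0)) (h₀ : ∀ᶠ i in l, 0 < s i j₀) :
    Tendsto (fun i => (N i : ℝ) * (s i j * w j / ∑ k ∈ 𝓙, s i k * w k)) l (𝓝 0) := by
  have h' := h.mul_const (w j / w j₀)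
  rw [zero_mul] at h'
  refine squeeze_zero' (Eventually.of_forall fun i => ?_) ?_ h'
  · refine mul_nonneg (Nat.cast_nonneg _) (div_nonneg (mul_nonneg (hs i j) (hw j hj).le) ?_)
    exact Finset.sum_nonneg fun k hk => mul_nonneg (hs i k) (hw k hk).le
  · filter_upwards [h₀] with i hi
    have hle : s i j₀ * w j₀ ≤ ∑ k ∈ 𝓙, s i k * w k :=
      Finset.single_le_sum (f := fun k => s i k * w k)
        (fun k hk => mul_nonneg (hs i k) (hw k hk).le) hj₀
    have hp := mul_pos hi (hw j₀ hj₀)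
    have hnn := mul_nonneg (hs i j) (hw j hj).le
    calc (N i : ℝ) * (s i j * w j / ∑ k ∈ 𝓙, s i k * w k)
        ≤ N i * (s i j * w j / (s i j₀ * w j₀)) := by gcongr
      _ = _ := by rw [mul_div_mul_comm, mul_assoc]

lemma posterior_nonneg {J : Type*} {𝓙 : Finset J} {s w : J → ℝ} (hs : ∀ k, 0 ≤ s k)
    (hw : ∀ k ∈ 𝓙, 0 < w k) {j : J} (hj : j ∈ 𝓙) : 0 ≤ s j * w j / ∑ k ∈ 𝓙, s k * w k :=
  div_nonneg (mul_nonneg (hs j) (hw j hj).le)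
    (Finset.sum_nonneg fun k hk => mul_nonneg (hs k) (hw k hk).le)

lemma posterior_le_one {J : Type*} {𝓙 : Finset J} {s w : J → ℝ} (hs : ∀ k, 0 ≤ s k)
    (hw : ∀ k ∈ 𝓙, 0 < w k) {j : J} (hj : j ∈ 𝓙) : s j * w j / ∑ k ∈ 𝓙, s k * w k ≤ 1 :=
  div_le_one_of_le₀ (Finset.single_le_sum (f := fun k => s k * w k)
      (fun k hk => mul_nonneg (hs k) (hw k hk).le) hj)
    (Finset.sum_nonneg fun k hk => mul_nonneg (hs k) (hw k hk).le)

lemma sum_posterior {J : Type*} {𝓙 : Finset J} {s w : J → ℝ} (hs : ∀ k, 0 ≤ s k)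
    (hw : ∀ k ∈ 𝓙, 0 < w k) {j₀ : J} (hj₀ : j₀ ∈ 𝓙) (h₀ : 0 < s j₀) :
    ∑ j ∈ 𝓙, s j * w j / ∑ k ∈ 𝓙, s k * w k = 1 := by
  rw [← Finset.sum_div, div_self]
  exact (Finset.sum_pos' (fun k hk => mul_nonneg (hs k) (hw k hk).le)
    ⟨j₀, hj₀, mul_pos h₀ (hw j₀ hj₀)⟩).ne'

/-- A weighted average converges to `b` if every term does or is, with its weight, negligible. -/
lemma tendsto_average {F J : Type*} [NormedAddCommGroup F] [NormedSpace ℝ F] {𝓙 : Finset J}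
    {w : ι → J → ℝ} {x : ι → J → F} {b : F} (hw : ∀ i, ∀ j ∈ 𝓙, 0 ≤ w i j ∧ w i j ≤ 1)
    (hsum : ∀ᶠ i in l, ∑ j ∈ 𝓙, w i j = 1)
    (hx : ∀ j ∈ 𝓙, Tendsto (fun i => x i j) l (𝓝 b) ∨
      (Tendsto (fun i => w i j) l (𝓝 0) ∧ Tendsto (fun i => w i j • x i j) l (𝓝 0))) :
    Tendsto (fun i => ∑ j ∈ 𝓙, w i j • x i j) l (𝓝 b) := by
  have h1 : ∀ j ∈ 𝓙, Tendsto (fun i => w i j • (x i j - b)) l (𝓝 0) := by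
    intro j hj
    rcases hx j hj with h | ⟨h, h'⟩
    · have h0 : Tendsto (fun i => x i j - b) l (𝓝 0) := by simpa using h.sub_const b
      rw [tendsto_zero_iff_norm_tendsto_zero] at h0 ⊢
      refine squeeze_zero (fun _ => norm_nonneg _) (fun i => ?_) h0
      rw [norm_smul, Real.norm_of_nonneg (hw i j hj).1]
      exact mul_le_of_le_one_left (norm_nonneg _) (hw i j hj).2
    · simpa [smul_sub] using h'.sub (h.smul_const b)
  have h2 := (tendsto_finsetSum 𝓙 h1).add_const b
  rw [Finset.sum_const_zero, zero_add] at h2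
  refine h2.congr' ?_
  filter_upwards [hsum] with i hi
  simp_rw [smul_sub]
  rw [Finset.sum_sub_distrib, ← Finset.sum_smul, hi, one_smul, sub_add_cancel]

end Averaging

/-! ### The two-stage designs in the coordinates of the regressors and errors -/

section FitBound

variable {ι κ σ : Type*} [Fintype κ] [DecidableEq κ] [Fintype σ] [DecidableEq σ] {l : Filter ι}
  {N : ι → ℕ}

lemma dotProduct_self_nonneg_real {n : Type*} [Fintype n] (x : n → ℝ) : 0 ≤ x ⬝ᵥ x := by
  simpa using dotProduct_star_self_nonneg x

lemma fit_dotProduct_le {n : ℕ} (A : Matrix (Fin n) σ ℝ) (y : Fin n → ℝ) :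
    (A *ᵥ ols A y) ⬝ᵥ (A *ᵥ ols A y) ≤ y ⬝ᵥ y := by
  by_cases hA : (Aᵀ * A).det = 0
  · rw [ols_eq_zero hA]
    simpa using dotProduct_self_nonneg_real y
  have h := resid_dotProduct hA y (ols A y)
  have h' := dotProduct_self_nonneg_real (y - A *ᵥ ols A y)
  generalize A *ᵥ ols A y = f at *
  rw [sub_dotProduct] at h
  rw [sub_dotProduct, dotProduct_sub, dotProduct_sub, dotProduct_comm f y] at h'
  linarith

lemma two_mul_abs_dotProduct_le {n : Type*} [Fintype n] (x y : n → ℝ) :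
    2 * |x ⬝ᵥ y| ≤ x ⬝ᵥ x + y ⬝ᵥ y := by
  have h1 := dotProduct_self_nonneg_real (x - y)
  have h2 := dotProduct_self_nonneg_real (x + y)
  simp only [sub_dotProduct, dotProduct_sub, add_dotProduct, dotProduct_add,
    dotProduct_comm y x] at h1 h2
  rcases abs_cases (x ⬝ᵥ y) with ⟨h, _⟩ | ⟨h, _⟩ <;> rw [h] <;> linarith

/-- The coordinates in `V` of a least squares fit in the span of `V` stay bounded, whatever the
design, even if the coefficients of the design do not: the fit is no longer than `y`. -/
lemma fit_coordinates_bounded (hN : Tendsto N l atTop) {V : (i : ι) → Matrix (Fin (N i)) κ ℝ}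
    {Q : Matrix κ κ ℝ} (hQ : Q.PosDef) (hV : Tendsto (fun i => meanGram (V i)) l (𝓝 Q))
    {y : (i : ι) → Fin (N i) → ℝ} {c : ℝ}
    (hy : Tendsto (fun i => (N i : ℝ)⁻¹ * (y i ⬝ᵥ y i)) l (𝓝 c)) (C : ι → Matrix κ σ ℝ) :
    ∃ K, 0 < K ∧ ∀ᶠ i in l, ∀ a, |(C i *ᵥ ols (V i * C i) (y i)) a| ≤ K := by
  have hQdet : Q.det ≠ 0 := hQ.det_pos.ne'
  have hinv := tendsto_matrix_inv hV hQdet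
  have hT : Tendsto (fun i => ∑ a, ∑ j, |(meanGram (V i))⁻¹ a j|) l
      (𝓝 (∑ a, ∑ j, |Q⁻¹ a j|)) :=
    tendsto_finsetSum _ fun a _ => tendsto_finsetSum _ fun j _ =>
      ((continuous_apply_apply a j).tendsto _ |>.comp hinv).abs
  have htr : Tendsto (fun i => ∑ j, meanGram (V i) j j) l (𝓝 (∑ j, Q j j)) :=
    tendsto_finsetSum _ fun j _ => (continuous_apply_apply j j).tendsto _ |>.comp hV
  set T := ∑ a, ∑ j, |Q⁻¹ a j| with hTdef
  set R := ∑ j, Q j j with hRdef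
  have hT0 : 0 ≤ T := Finset.sum_nonneg fun a _ => Finset.sum_nonneg fun j _ => abs_nonneg _
  have hR0 : 0 ≤ R := Finset.sum_nonneg fun j _ => hQ.posSemidef.diag_nonneg
  refine ⟨(T + 1) * (R + 1 + (|c| + 1)), by positivity, ?_⟩
  filter_upwards [hT.eventually_lt_const (lt_add_one _), htr.eventually_lt_const (lt_add_one _),
    hy.eventually_lt_const ((le_abs_self c).trans_lt (lt_add_one _)), hN.eventually_ge_atTop 1,
    (((continuous_id.matrix_det).tendsto Q).comp hV).eventually_ne hQdet]
    with i hTi hRi hyi hn hdet a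
  have hn0 : (0:ℝ) < N i := by exact_mod_cast hn
  set d := C i *ᵥ ols (V i * C i) (y i) with hd
  set G := meanGram (V i) with hG
  have hfit : V i *ᵥ d = (V i * C i) *ᵥ ols (V i * C i) (y i) := by
    rw [hd, Matrix.mulVec_mulVec]
  have hff : (V i *ᵥ d) ⬝ᵥ (V i *ᵥ d) ≤ y i ⬝ᵥ y i := by
    rw [hfit]; exact fit_dotProduct_le _ _
  have hdG : d = G⁻¹ *ᵥ (G *ᵥ d) := by
    rw [Matrix.mulVec_mulVec, Matrix.nonsing_inv_mul G (isUnit_iff_ne_zero.mpr hdet),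
      Matrix.one_mulVec]
  have hGjj : ∀ j, G j j = (N i : ℝ)⁻¹ * ((V i).col j ⬝ᵥ (V i).col j) := fun j => by
    simp [hG, meanGram, Matrix.mul_apply, dotProduct]
  have hGjj0 : ∀ j, 0 ≤ G j j := fun j => by
    rw [hGjj]; exact mul_nonneg (by positivity) (dotProduct_self_nonneg_real _)
  have hr : ∀ j, |(G *ᵥ d) j| ≤ R + 1 + (|c| + 1) := by
    intro j
    have e : (G *ᵥ d) j = (N i : ℝ)⁻¹ * ((V i).col j ⬝ᵥ (V i *ᵥ d)) := by
      rw [hG, meanGram, Matrix.smul_mulVec, ← Matrix.mulVec_mulVec]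
      rfl
    have h1 := two_mul_abs_dotProduct_le ((V i).col j) (V i *ᵥ d)
    have h2 : G j j ≤ ∑ j, G j j :=
      Finset.single_le_sum (f := fun j => G j j) (fun j _ => hGjj0 j) (Finset.mem_univ j)
    have h3 : (N i : ℝ)⁻¹ * (2 * |(V i).col j ⬝ᵥ (V i *ᵥ d)|) ≤ (N i : ℝ)⁻¹ *
        ((V i).col j ⬝ᵥ (V i).col j + y i ⬝ᵥ y i) := by
      gcongr; linarith
    rw [mul_add, ← hGjj] at h3
    rw [e, abs_mul, abs_of_pos (inv_pos.mpr hn0)]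
    have h4 : 0 ≤ (N i : ℝ)⁻¹ * |(V i).col j ⬝ᵥ (V i *ᵥ d)| := by positivity
    linarith
  calc |d a| = |∑ j, G⁻¹ a j * (G *ᵥ d) j| := by
        conv_lhs => rw [hdG]
        rfl
    _ ≤ ∑ j, |G⁻¹ a j| * (R + 1 + (|c| + 1)) := by
        refine (Finset.abs_sum_le_sum_abs _ _).trans (Finset.sum_le_sum fun j _ => ?_)
        rw [abs_mul]
        exact mul_le_mul_of_nonneg_left (hr j) (abs_nonneg _)
    _ = (∑ j, |G⁻¹ a j|) * (R + 1 + (|c| + 1)) := by rw [Finset.sum_mul]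
    _ ≤ _ := by
        refine mul_le_mul_of_nonneg_right ?_ (by positivity)
        refine le_trans ?_ hTi.le
        exact Finset.single_le_sum (f := fun a => ∑ j, |G⁻¹ a j|)
          (fun a _ => Finset.sum_nonneg fun j _ => abs_nonneg _) (Finset.mem_univ a)

end FitBound

section Coordinates

variable {n pZ pX : ℕ}

/-- The designs and responses as linear combinations of the columns of `(Z X U)`, where `U` holds
the errors of the `Y` equation (column `0`) and of the `W` equation (column `1`). -/
def dataArray (Z : Matrix (Fin n) (Fin pZ) ℝ) (X : Matrix (Fin n) (Fin pX) ℝ)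
    (U : Matrix (Fin n) (Fin 2) ℝ) : Matrix (Fin n) ((Fin pZ ⊕ Fin pX) ⊕ Fin 2) ℝ :=
  Matrix.fromCols (Matrix.fromCols Z X) U

/-- The coordinates of `V` in `(V U)`. -/
def firstCoef (pZ pX : ℕ) : Matrix ((Fin pZ ⊕ Fin pX) ⊕ Fin 2) (Fin pZ ⊕ Fin pX) ℝ :=
  Matrix.fromRows 1 0

/-- The coordinates of `(V t, X)` in `V`. -/
def slopeCoef (t : Fin pZ ⊕ Fin pX → ℝ) : Matrix (Fin pZ ⊕ Fin pX) (Unit ⊕ Fin pX) ℝ :=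
  Matrix.fromCols (Matrix.replicateCol Unit t) (Matrix.fromRows 0 1)

/-- The coordinates of `(V t, X)` in `(V U)`. -/
def secondCoef (t : Fin pZ ⊕ Fin pX → ℝ) :
    Matrix ((Fin pZ ⊕ Fin pX) ⊕ Fin 2) (Unit ⊕ Fin pX) ℝ :=
  Matrix.fromRows (slopeCoef t) 0

/-- The coordinates of `(V t, X, W - V t)` in `(V U)`, where `W = V θ + ε`. -/
def controlCoef (θ t : Fin pZ ⊕ Fin pX → ℝ) :
    Matrix ((Fin pZ ⊕ Fin pX) ⊕ Fin 2) ((Unit ⊕ Fin pX) ⊕ Unit) ℝ :=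
  Matrix.fromCols (secondCoef t) (Matrix.replicateCol Unit (Sum.elim (θ - t) ![0, 1]))

variable (Z : Matrix (Fin n) (Fin pZ) ℝ) (X : Matrix (Fin n) (Fin pX) ℝ)
  (U : Matrix (Fin n) (Fin 2) ℝ) (W Y : Fin n → ℝ)

lemma fromCols_mul_slopeCoef (t : Fin pZ ⊕ Fin pX → ℝ) :
    Matrix.fromCols Z X * slopeCoef t = withCol (Matrix.fromCols Z X *ᵥ t) X := by
  rw [slopeCoef, Matrix.mul_fromCols, Matrix.fromCols_mul_fromRows, withCol,
    Matrix.replicateCol_mulVec, Matrix.mul_zero, Matrix.mul_one, zero_add]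

lemma dataArray_mul_firstCoef :
    dataArray Z X U * firstCoef pZ pX = Matrix.fromCols Z X := by
  simp [dataArray, firstCoef, Matrix.fromCols_mul_fromRows]

lemma dataArray_mul_secondCoef (t : Fin pZ ⊕ Fin pX → ℝ) :
    dataArray Z X U * secondCoef t = withCol (Matrix.fromCols Z X *ᵥ t) X := by
  simp [dataArray, secondCoef, Matrix.fromCols_mul_fromRows, fromCols_mul_slopeCoef]

lemma dataArray_mulVec (t : Fin pZ ⊕ Fin pX → ℝ) (s : Fin 2 → ℝ) :
    dataArray Z X U *ᵥ Sum.elim t s = Matrix.fromCols Z X *ᵥ t + U *ᵥ s := by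
  rw [dataArray, Matrix.fromCols_mulVec]; rfl

lemma dataArray_mul_controlCoef (θ t : Fin pZ ⊕ Fin pX → ℝ) :
    dataArray Z X U * controlCoef θ t = Matrix.fromCols (withCol (Matrix.fromCols Z X *ᵥ t) X)
      (Matrix.replicateCol Unit
        (Matrix.fromCols Z X *ᵥ θ + U *ᵥ ![0, 1] - Matrix.fromCols Z X *ᵥ t)) := by
  rw [controlCoef, Matrix.mul_fromCols, dataArray_mul_secondCoef, ← Matrix.replicateCol_mulVec,
    dataArray_mulVec, Matrix.mulVec_sub]
  congr 2
  abel

/-- The first stage estimate under `M`, with zeros for the excluded columns. -/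
def firstEstimate (M : FirstModel pZ pX) : Fin pZ ⊕ Fin pX → ℝ :=
  extendMat (Subtype.val : M → Fin pZ ⊕ Fin pX) *ᵥ ols (firstDesign Z X M) W

lemma firstEstimate_apply {M : FirstModel pZ pX} {a : Fin pZ ⊕ Fin pX} (ha : a ∈ M) :
    firstEstimate Z X W M a = ols (firstDesign Z X M) W ⟨a, ha⟩ :=
  extendMat_mulVec_apply Subtype.val_injective _ (⟨a, ha⟩ : M)

lemma firstEstimate_of_notMem {M : FirstModel pZ pX} {a : Fin pZ ⊕ Fin pX} (ha : a ∉ M) :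
    firstEstimate Z X W M a = 0 :=
  extendMat_mulVec_of_notMem _ (by simpa using ha)

lemma fitted_eq (M : FirstModel pZ pX) :
    fitted Z X W M = Matrix.fromCols Z X *ᵥ firstEstimate Z X W M := by
  rw [firstEstimate, Matrix.mulVec_mulVec, mul_extendMat]
  rfl

lemma constrained2SLS_eq (M : FirstModel pZ pX) (L : SecondModel pX) :
    constrained2SLS Z X W Y M L =
      extendMat (Subtype.val : L → Unit ⊕ Fin pX) *ᵥ ols (secondDesign Z X W M L) Y := by
  ext a
  by_cases ha : a ∈ L
  · rw [constrained2SLS, dif_pos ha]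
    exact (extendMat_mulVec_apply Subtype.val_injective _ (⟨a, ha⟩ : L)).symm
  · rw [constrained2SLS, dif_neg ha, extendMat_mulVec_of_notMem _ (by simpa using ha)]

lemma constrained2SLS_of_notMem (M : FirstModel pZ pX) {L : SecondModel pX} {a : Unit ⊕ Fin pX}
    (ha : a ∉ L) : constrained2SLS Z X W Y M L a = 0 := by
  rw [constrained2SLS, dif_neg ha]

lemma firstDesign_eq (M : FirstModel pZ pX) :
    firstDesign Z X M = (dataArray Z X U * firstCoef pZ pX).submatrix id Subtype.val := by
  rw [dataArray_mul_firstCoef]; rfl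

lemma secondDesign_eq_mul (M : FirstModel pZ pX) (L : SecondModel pX) :
    secondDesign Z X W M L = Matrix.fromCols Z X *
      (slopeCoef (firstEstimate Z X W M) * extendMat (Subtype.val : L → Unit ⊕ Fin pX)) := by
  rw [← Matrix.mul_assoc, fromCols_mul_slopeCoef, mul_extendMat, ← fitted_eq]
  rfl

lemma secondDesign_eq (M : FirstModel pZ pX) (L : SecondModel pX) :
    secondDesign Z X W M L =
      (dataArray Z X U * secondCoef (firstEstimate Z X W M)).submatrix id Subtype.val := by
  rw [dataArray_mul_secondCoef, ← fitted_eq]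
  rfl

lemma controlDesign_eq {θ : Fin pZ ⊕ Fin pX → ℝ}
    (hW : W = Matrix.fromCols Z X *ᵥ θ + U *ᵥ ![0, 1]) (M : FirstModel pZ pX)
    (L : SecondModel pX) :
    controlDesign Z X W M L = (dataArray Z X U * controlCoef θ (firstEstimate Z X W M)).submatrix id
      (Sum.map Subtype.val id) := by
  rw [dataArray_mul_controlCoef, ← hW, ← fitted_eq]
  ext k (a | a) <;> rfl

lemma slopeCoef_mulVec_inl (t : Fin pZ ⊕ Fin pX → ℝ) (b : Unit ⊕ Fin pX → ℝ) (j : Fin pZ) :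
    (slopeCoef t *ᵥ b) (Sum.inl j) = t (Sum.inl j) * b (Sum.inl ()) := by
  simp [slopeCoef, Matrix.mulVec, dotProduct]

lemma slopeCoef_mulVec_inr (t : Fin pZ ⊕ Fin pX → ℝ) (b : Unit ⊕ Fin pX → ℝ) (j : Fin pX) :
    (slopeCoef t *ᵥ b) (Sum.inr j) = t (Sum.inr j) * b (Sum.inl ()) + b (Sum.inr j) := by
  simp [slopeCoef, Matrix.mulVec, dotProduct, Matrix.one_apply]

/-- The full second stage is identified if some instrument has a nonzero coefficient. -/
lemma slopeCoef_injective {θ : Fin pZ ⊕ Fin pX → ℝ} (hθ : ∃ j, θ (Sum.inl j) ≠ 0) :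
    Function.Injective (slopeCoef θ).mulVec := by
  obtain ⟨j, hj⟩ := hθ
  intro x y hxy
  have h1 : x (Sum.inl ()) = y (Sum.inl ()) := by
    have := congrFun hxy (Sum.inl j)
    rw [slopeCoef_mulVec_inl, slopeCoef_mulVec_inl] at this
    exact mul_left_cancel₀ hj this
  ext (⟨⟩ | k)
  · exact h1
  · have := congrFun hxy (Sum.inr k)
    rw [slopeCoef_mulVec_inr, slopeCoef_mulVec_inr, h1] at this
    exact add_left_cancel this

lemma secondCoef_mulVec (t : Fin pZ ⊕ Fin pX → ℝ) (b : Unit ⊕ Fin pX → ℝ) :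
    secondCoef t *ᵥ b = Sum.elim (slopeCoef t *ᵥ b) 0 := by
  rw [secondCoef, Matrix.fromRows_mulVec, Matrix.zero_mulVec]

lemma secondCoef_injective {θ : Fin pZ ⊕ Fin pX → ℝ} (hθ : ∃ j, θ (Sum.inl j) ≠ 0) :
    Function.Injective (secondCoef θ).mulVec := by
  intro x y hxy
  refine slopeCoef_injective hθ ?_
  ext a
  simpa [secondCoef_mulVec] using congrFun hxy (Sum.inl a)

lemma controlCoef_mulVec (θ t : Fin pZ ⊕ Fin pX → ℝ) (b : (Unit ⊕ Fin pX) ⊕ Unit → ℝ) :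
    controlCoef θ t *ᵥ b = Sum.elim (slopeCoef t *ᵥ (b ∘ Sum.inl) + b (Sum.inr ()) • (θ - t))
      ![0, b (Sum.inr ())] := by
  rw [controlCoef, Matrix.fromCols_mulVec, secondCoef_mulVec]
  ext (a | a)
  · simp [Matrix.mulVec, dotProduct, Matrix.replicateCol, mul_comm]
  · fin_cases a <;> simp [Matrix.mulVec, dotProduct, Matrix.replicateCol]

lemma controlCoef_injective {θ : Fin pZ ⊕ Fin pX → ℝ} (hθ : ∃ j, θ (Sum.inl j) ≠ 0) :
    Function.Injective (controlCoef θ θ).mulVec := by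
  intro x y hxy
  rw [controlCoef_mulVec, controlCoef_mulVec] at hxy
  have h1 : x ∘ Sum.inl = y ∘ Sum.inl := slopeCoef_injective hθ (by
    ext a
    simpa using congrFun hxy (Sum.inl a))
  have h2 : x (Sum.inr ()) = y (Sum.inr ()) := by simpa using congrFun hxy (Sum.inr 1)
  ext (a | ⟨⟩)
  · exact congrFun h1 a
  · exact h2

lemma continuous_slopeCoef :
    Continuous (slopeCoef : (Fin pZ ⊕ Fin pX → ℝ) → Matrix _ (Unit ⊕ Fin pX) ℝ) := by
  refine continuous_matrix fun a b => ?_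
  rcases b with b | b
  · simpa [slopeCoef] using continuous_apply a
  · simpa [slopeCoef] using continuous_const

lemma continuous_secondCoef :
    Continuous (secondCoef : (Fin pZ ⊕ Fin pX → ℝ) → Matrix _ (Unit ⊕ Fin pX) ℝ) := by
  refine continuous_matrix fun a b => ?_
  rcases a with a | a
  · simpa [secondCoef] using continuous_slopeCoef.matrix_elem a b
  · simpa [secondCoef] using continuous_const

lemma continuous_controlCoef (θ : Fin pZ ⊕ Fin pX → ℝ) : Continuous (controlCoef θ) := by
  refine continuous_matrix fun a b => ?_
  rcases b with b | b
  · simpa [controlCoef] using continuous_secondCoef.matrix_elem a b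
  · rcases a with a | a
    · simp only [controlCoef, Matrix.fromCols_apply_inr, Matrix.replicateCol_apply, Sum.elim_inl,
        Pi.sub_apply]
      fun_prop
    · simpa [controlCoef] using continuous_const

variable {Z X U W Y}

/-- If the columns of `M` are among the covariates in `L`, the fitted value is collinear with
them. -/
lemma det_gram_secondDesign_eq_zero {M : FirstModel pZ pX} {L : SecondModel pX}
    (hW : Sum.inl () ∈ L) (hM : ∀ a ∈ M, ∃ j, a = Sum.inr j ∧ Sum.inr j ∈ L) :
    ((secondDesign Z X W M L)ᵀ * secondDesign Z X W M L).det = 0 := by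
  set t := firstEstimate Z X W M with ht
  set g : Unit ⊕ Fin pX → ℝ := Sum.elim (fun _ => 1) (fun j => -t (Sum.inr j)) with hg
  set v : L → ℝ := g ∘ Subtype.val with hv
  have hv0 : v ≠ 0 := fun h => by
    have := congrFun h ⟨Sum.inl (), hW⟩
    simp [hv, hg] at this
  have hzero : slopeCoef t *ᵥ (extendMat Subtype.val *ᵥ v) = 0 := by
    have hvW : (extendMat (Subtype.val : L → Unit ⊕ Fin pX) *ᵥ v) (Sum.inl ()) = 1 :=
      extendMat_mulVec_apply Subtype.val_injective v (⟨Sum.inl (), hW⟩ : L)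
    ext (j | j)
    · have hj : Sum.inl j ∉ M := fun h => by
        obtain ⟨k, hk, -⟩ := hM _ h
        cases hk
      rw [slopeCoef_mulVec_inl, ht, firstEstimate_of_notMem _ _ _ hj, zero_mul, Pi.zero_apply]
    · rw [slopeCoef_mulVec_inr, hvW, mul_one]
      by_cases hj : Sum.inr j ∈ L
      · rw [extendMat_mulVec_apply Subtype.val_injective v (⟨Sum.inr j, hj⟩ : L)]
        simp [hv, hg]
      · have hjM : Sum.inr j ∉ M := fun h => by
          obtain ⟨k, hk, hkL⟩ := hM _ h
          cases hk
          exact hj hkL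
        rw [extendMat_mulVec_of_notMem v (by simpa using hj), ht,
          firstEstimate_of_notMem _ _ _ hjM]
        simp
  refine Matrix.exists_mulVec_eq_zero_iff.mp ⟨v, hv0, ?_⟩
  rw [← Matrix.mulVec_mulVec, secondDesign_eq_mul, ← Matrix.mulVec_mulVec, ← Matrix.mulVec_mulVec,
    hzero, Matrix.mulVec_zero, Matrix.mulVec_zero]

end Coordinates

/-! ### Consistency given the limits of the moments -/

lemma secondScore_nonneg {n pZ pX : ℕ} (Z : Matrix (Fin n) (Fin pZ) ℝ)
    (X : Matrix (Fin n) (Fin pX) ℝ) (W Y : Fin n → ℝ) (control : Bool) (M : FirstModel pZ pX)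
    (L : SecondModel pX) : 0 ≤ secondScore Z X W Y control M L := by
  cases control
  · simpa [secondScore] using integratedLikelihood_nonneg _ _
  · simpa [secondScore] using integratedLikelihood_nonneg _ _

/-- The coordinates in `(V U)` of the combination `U s` of the errors. -/
abbrev errorCoef (pZ pX : ℕ) (s : Fin 2 → ℝ) : (Fin pZ ⊕ Fin pX) ⊕ Fin 2 → ℝ := Sum.elim 0 s

lemma withCol_mulVec {n pX : ℕ} (w : Fin n → ℝ) (X : Matrix (Fin n) (Fin pX) ℝ)
    (b : Unit ⊕ Fin pX → ℝ) :
    withCol w X *ᵥ b = b (Sum.inl ()) • w + X *ᵥ (b ∘ Sum.inr) := by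
  rw [withCol, Matrix.fromCols_mulVec]
  congr 1
  ext k
  simp [Matrix.mulVec, dotProduct, mul_comm]

/-- Samples of sizes `N i → ∞` from the two regression equations, with errors `U` (column `0` for
`Y`, column `1` for `W`), whose second moments converge along the filter `l`: those of the
regressors to `Q`, those of the errors to `S`, and the mixed ones to zero. -/
structure MomentLimits {ι : Type*} (l : Filter ι) (N : ι → ℕ) {pZ pX : ℕ}
    (Z : (i : ι) → Matrix (Fin (N i)) (Fin pZ) ℝ) (X : (i : ι) → Matrix (Fin (N i)) (Fin pX) ℝ)
    (U : (i : ι) → Matrix (Fin (N i)) (Fin 2) ℝ) (W Y : (i : ι) → Fin (N i) → ℝ)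
    (θ : Fin pZ ⊕ Fin pX → ℝ) (β : Unit ⊕ Fin pX → ℝ)
    (Q : Matrix (Fin pZ ⊕ Fin pX) (Fin pZ ⊕ Fin pX) ℝ) (S : Matrix (Fin 2) (Fin 2) ℝ) : Prop where
  size : Tendsto N l atTop
  posDef_regressors : Q.PosDef
  posDef_errors : S.PosDef
  gram : Tendsto (fun i => meanGram (dataArray (Z i) (X i) (U i))) l (𝓝 (Matrix.fromBlocks Q 0 0 S))
  first_eq : ∀ i, W i = Matrix.fromCols (Z i) (X i) *ᵥ θ + U i *ᵥ ![0, 1]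
  second_eq : ∀ i, Y i = withCol (W i) (X i) *ᵥ β + U i *ᵥ ![1, 0]

namespace MomentLimits

variable {ι : Type*} {l : Filter ι} {N : ι → ℕ} {pZ pX : ℕ}
  {Z : (i : ι) → Matrix (Fin (N i)) (Fin pZ) ℝ} {X : (i : ι) → Matrix (Fin (N i)) (Fin pX) ℝ}
  {U : (i : ι) → Matrix (Fin (N i)) (Fin 2) ℝ} {W Y : (i : ι) → Fin (N i) → ℝ}
  {θ : Fin pZ ⊕ Fin pX → ℝ} {β : Unit ⊕ Fin pX → ℝ}
  {Q : Matrix (Fin pZ ⊕ Fin pX) (Fin pZ ⊕ Fin pX) ℝ} {S : Matrix (Fin 2) (Fin 2) ℝ}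

lemma posDef_fromBlocks {m n : Type*} [Fintype m] [Fintype n] {A : Matrix m m ℝ}
    {B : Matrix n n ℝ} (hA : A.PosDef) (hB : B.PosDef) : (Matrix.fromBlocks A 0 0 B).PosDef := by
  refine Matrix.PosDef.of_dotProduct_mulVec_pos
    (hA.isHermitian.fromBlocks (by simp) hB.isHermitian) fun x hx => ?_
  have hq : star x ⬝ᵥ (Matrix.fromBlocks A 0 0 B *ᵥ x) =
      star (x ∘ Sum.inl) ⬝ᵥ (A *ᵥ (x ∘ Sum.inl)) + star (x ∘ Sum.inr) ⬝ᵥ (B *ᵥ (x ∘ Sum.inr)) := by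
    rw [Matrix.fromBlocks_mulVec]
    simp [dotProduct, Fintype.sum_sum_type]
  rw [hq]
  by_cases h1 : x ∘ Sum.inl = 0
  · have h2 : x ∘ Sum.inr ≠ 0 := fun h2 => hx (by
      ext (a | a)
      · exact congrFun h1 a
      · exact congrFun h2 a)
    exact add_pos_of_nonneg_of_pos (hA.posSemidef.dotProduct_mulVec_nonneg _)
      (hB.dotProduct_mulVec_pos h2)
  · exact add_pos_of_pos_of_nonneg (hA.dotProduct_mulVec_pos h1)
      (hB.posSemidef.dotProduct_mulVec_nonneg _)

lemma fromBlocks_mulVec_error (Q : Matrix (Fin pZ ⊕ Fin pX) (Fin pZ ⊕ Fin pX) ℝ)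
    (S : Matrix (Fin 2) (Fin 2) ℝ) (s : Fin 2 → ℝ) :
    Matrix.fromBlocks Q 0 0 S *ᵥ errorCoef pZ pX s = errorCoef pZ pX (S *ᵥ s) := by
  rw [Matrix.fromBlocks_mulVec]
  simp

lemma error_quadratic (Q : Matrix (Fin pZ ⊕ Fin pX) (Fin pZ ⊕ Fin pX) ℝ)
    (S : Matrix (Fin 2) (Fin 2) ℝ) (s : Fin 2 → ℝ) :
    errorCoef pZ pX s ⬝ᵥ (Matrix.fromBlocks Q 0 0 S *ᵥ errorCoef pZ pX s) =
      s ⬝ᵥ (S *ᵥ s) := by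
  rw [fromBlocks_mulVec_error]
  simp [dotProduct, Fintype.sum_sum_type]

lemma firstCoef_mulVec (b : Fin pZ ⊕ Fin pX → ℝ) : firstCoef pZ pX *ᵥ b = Sum.elim b 0 := by
  rw [firstCoef, Matrix.fromRows_mulVec, Matrix.zero_mulVec, Matrix.one_mulVec]

lemma firstCoef_injective : Function.Injective (firstCoef pZ pX).mulVec := by
  intro x y hxy
  rw [firstCoef_mulVec, firstCoef_mulVec] at hxy
  ext a
  simpa using congrFun hxy (Sum.inl a)

variable (h : MomentLimits l N Z X U W Y θ β Q S)
include h

lemma posDef : (Matrix.fromBlocks Q 0 0 S).PosDef :=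
  posDef_fromBlocks h.posDef_regressors h.posDef_errors

lemma error_pos {s : Fin 2 → ℝ} (hs : s ≠ 0) : 0 < s ⬝ᵥ (S *ᵥ s) := by
  simpa using h.posDef_errors.dotProduct_mulVec_pos hs

lemma first_eq_array (i : ι) : W i = dataArray (Z i) (X i) (U i) *ᵥ
    (firstCoef pZ pX *ᵥ θ + errorCoef pZ pX ![0, 1]) := by
  rw [firstCoef_mulVec, Matrix.mulVec_add, dataArray_mulVec, dataArray_mulVec, h.first_eq i]
  simp

/-- The reduced form of the `Y` equation, whose error also carries that of the `W` equation. -/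
lemma second_eq_slope (i : ι) : Y i = Matrix.fromCols (Z i) (X i) *ᵥ (slopeCoef θ *ᵥ β) +
    U i *ᵥ ![1, β (Sum.inl ())] := by
  have h1 : withCol (W i) (X i) *ᵥ β =
      withCol (Matrix.fromCols (Z i) (X i) *ᵥ θ) (X i) *ᵥ β + U i *ᵥ ![0, β (Sum.inl ())] := by
    have h2 : (![0, β (Sum.inl ())] : Fin 2 → ℝ) = β (Sum.inl ()) • ![0, 1] := by simp
    rw [h2, Matrix.mulVec_smul, withCol_mulVec, withCol_mulVec, h.first_eq i, smul_add]
    abel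
  have h3 : (![1, β (Sum.inl ())] : Fin 2 → ℝ) = ![0, β (Sum.inl ())] + ![1, 0] := by simp
  rw [h.second_eq i, h1, h3, Matrix.mulVec_add, Matrix.mulVec_mulVec, fromCols_mul_slopeCoef,
    add_assoc]

lemma second_eq_array (i : ι) : Y i = dataArray (Z i) (X i) (U i) *ᵥ
    (secondCoef θ *ᵥ β + errorCoef pZ pX ![1, β (Sum.inl ())]) := by
  rw [secondCoef_mulVec, Matrix.mulVec_add, dataArray_mulVec, dataArray_mulVec,
    h.second_eq_slope i]
  simp

/-- In the regression with the first stage residual, the error of the `Y` equation is replaced by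
its part uncorrelated with the error of the `W` equation. -/
lemma second_eq_control (i : ι) (ρ : ℝ) : Y i = dataArray (Z i) (X i) (U i) *ᵥ
    (controlCoef θ θ *ᵥ (Sum.elim β (fun _ => β (Sum.inl ()) + ρ)) + errorCoef pZ pX ![1, -ρ]) := by
  have h2 : (![1, β (Sum.inl ())] : Fin 2 → ℝ) = ![0, β (Sum.inl ()) + ρ] + ![1, -ρ] := by simp
  rw [controlCoef_mulVec, Matrix.mulVec_add, dataArray_mulVec, dataArray_mulVec,
    h.second_eq_slope i, h2, Matrix.mulVec_add]
  simp [add_assoc]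

/-- First stage regressions: models that contain the true one are consistent and share the limiting
residual variance, all others have a larger one. -/
lemma first_limits (M : FirstModel pZ pX) : ∃ (b : M → ℝ) (v : ℝ),
    (∀ᶠ i in l, ((firstDesign (Z i) (X i) M)ᵀ * firstDesign (Z i) (X i) M).det ≠ 0) ∧
    Tendsto (fun i => ols (firstDesign (Z i) (X i) M) (W i)) l (𝓝 b) ∧
    Tendsto (fun i => varMLE (firstDesign (Z i) (X i) M) (W i)) l (𝓝 v) ∧
    ((∀ a, θ a ≠ 0 → a ∈ M) → b = θ ∘ Subtype.val ∧ v = ![0, 1] ⬝ᵥ (S *ᵥ ![0, 1])) ∧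
    ((∃ a, θ a ≠ 0 ∧ a ∉ M) → ![0, 1] ⬝ᵥ (S *ᵥ ![0, 1]) < v) := by
  have horth : (firstCoef pZ pX)ᵀ *ᵥ
      (Matrix.fromBlocks Q 0 0 S *ᵥ errorCoef pZ pX ![0, 1]) = 0 := by
    rw [fromBlocks_mulVec_error, firstCoef, Matrix.transpose_fromRows, Matrix.fromCols_mulVec]
    simp
  have key := submodel_limits h.size h.posDef h.gram tendsto_const_nhds firstCoef_injective θ
    (errorCoef pZ pX ![0, 1]) horth (Subtype.val_injective (p := (· ∈ M)))
  simp_rw [← h.first_eq_array, ← firstDesign_eq, error_quadratic] at key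
  simpa using key

lemma tendsto_firstEstimate (M : FirstModel pZ pX) :
    ∃ t, Tendsto (fun i => firstEstimate (Z i) (X i) (W i) M) l (𝓝 t) ∧
      ((∀ a, θ a ≠ 0 → a ∈ M) → t = θ) := by
  obtain ⟨b, v, -, h1, -, h2, -⟩ := h.first_limits M
  refine ⟨_, tendsto_mulVec tendsto_const_nhds h1, fun hM => ?_⟩
  rw [(h2 hM).1]
  exact extendMat_mulVec_comp Subtype.val_injective (by simpa using hM)

lemma tendsto_firstEstimate_of_subset {M : FirstModel pZ pX} (hM : ∀ a, θ a ≠ 0 → a ∈ M) :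
    Tendsto (fun i => firstEstimate (Z i) (X i) (W i) M) l (𝓝 θ) := by
  obtain ⟨t, ht, hθ⟩ := h.tendsto_firstEstimate M
  rwa [hθ hM] at ht

lemma tendsto_mean_square : ∃ c, Tendsto (fun i => (N i : ℝ)⁻¹ * (Y i ⬝ᵥ Y i)) l (𝓝 c) := by
  set z := secondCoef θ *ᵥ β + errorCoef pZ pX ![1, β (Sum.inl ())] with hz
  refine ⟨_, (tendsto_dotProduct (tendsto_const_nhds (x := z))
    (tendsto_mulVec h.gram (tendsto_const_nhds (x := z)))).congr fun i => ?_⟩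
  rw [h.second_eq_array i, ← hz, meanGram, Matrix.smul_mulVec, dotProduct_smul,
    ← Matrix.mulVec_mulVec, Matrix.dotProduct_mulVec z, Matrix.vecMul_transpose, smul_eq_mul]

lemma tendsto_gram_regressors :
    Tendsto (fun i => meanGram (Matrix.fromCols (Z i) (X i))) l (𝓝 Q) := by
  have h1 : Tendsto (fun i => (firstCoef pZ pX)ᵀ * meanGram (dataArray (Z i) (X i) (U i)) *
      firstCoef pZ pX) l (𝓝 ((firstCoef pZ pX)ᵀ * Matrix.fromBlocks Q 0 0 S * firstCoef pZ pX)) :=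
    tendsto_matrix_mul (tendsto_matrix_mul tendsto_const_nhds h.gram) tendsto_const_nhds
  simp_rw [← meanGram_mul, dataArray_mul_firstCoef] at h1
  have h2 : (firstCoef pZ pX)ᵀ * Matrix.fromBlocks Q 0 0 S * firstCoef pZ pX = Q := by
    rw [firstCoef, Matrix.transpose_fromRows, Matrix.fromCols_mul_fromBlocks,
      Matrix.fromCols_mul_fromRows]
    simp
  rwa [h2] at h1

/-- The posterior weight of a first stage model that omits a relevant column is `o(1 / n)`. -/
lemma tendsto_firstPosterior {𝓜 : Finset (FirstModel pZ pX)} {prM : FirstModel pZ pX → ℝ}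
    (hprM : ∀ M ∈ 𝓜, 0 < prM M) (hθ : Finset.univ.filter (fun a => θ a ≠ 0) ∈ 𝓜)
    {M : FirstModel pZ pX} (hM𝓜 : M ∈ 𝓜) (hM : ∃ a, θ a ≠ 0 ∧ a ∉ M) :
    Tendsto (fun i => (N i : ℝ) * firstPosterior (Z i) (X i) (W i) 𝓜 prM M) l (𝓝 0) := by
  obtain ⟨b, v, h1, -, h3, -, h5⟩ := h.first_limits M
  obtain ⟨b₀, v₀, g1, -, g3, g4, -⟩ := h.first_limits (Finset.univ.filter (fun a => θ a ≠ 0))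
  have hv₀ := (g4 (by simp)).2
  have hpos : 0 < v₀ := by
    rw [hv₀]; exact h.error_pos (by simp)
  have hr := tendsto_evidence_ratio h.size h1 g1 h3 g3 hpos (by rw [hv₀]; exact h5 hM)
  refine tendsto_posterior (s := fun i M => integratedLikelihood (firstDesign (Z i) (X i) M) (W i))
    hM𝓜 hθ (fun i k => integratedLikelihood_nonneg _ _) hprM hr ?_
  filter_upwards [g1, g3.eventually_const_lt hpos, h.size.eventually_gt_atTop 0] with i hi hvi hn
  rw [integratedLikelihood_eq hn hi hvi]
  exact mul_pos (Real.rpow_pos_of_pos hvi _) (evidenceFactor_pos _ _)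

lemma eventually_sum_firstPosterior {𝓜 : Finset (FirstModel pZ pX)} {prM : FirstModel pZ pX → ℝ}
    (hprM : ∀ M ∈ 𝓜, 0 < prM M) (hθ : Finset.univ.filter (fun a => θ a ≠ 0) ∈ 𝓜) :
    ∀ᶠ i in l, ∑ M ∈ 𝓜, firstPosterior (Z i) (X i) (W i) 𝓜 prM M = 1 := by
  obtain ⟨b₀, v₀, g1, -, g3, g4, -⟩ := h.first_limits (Finset.univ.filter (fun a => θ a ≠ 0))
  have hv₀ := (g4 (by simp)).2
  have hpos : 0 < v₀ := by
    rw [hv₀]; exact h.error_pos (by simp)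
  filter_upwards [g1, g3.eventually_const_lt hpos, h.size.eventually_gt_atTop 0] with i hi hvi hn
  refine sum_posterior (s := fun M => integratedLikelihood (firstDesign (Z i) (X i) M) (W i))
    (fun k => integratedLikelihood_nonneg _ _) hprM hθ ?_
  rw [integratedLikelihood_eq hn hi hvi]
  exact mul_pos (Real.rpow_pos_of_pos hvi _) (evidenceFactor_pos _ _)

/-- Second stage regressions without the first stage residual: models that contain the true one are
consistent and share the limiting residual variance, all others have a larger one. -/
lemma second_limits (hid : ∃ j, θ (Sum.inl j) ≠ 0) {M : FirstModel pZ pX}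
    (hM : ∀ a, θ a ≠ 0 → a ∈ M) (L : SecondModel pX) : ∃ (b : L → ℝ) (v : ℝ),
    (∀ᶠ i in l, ((secondDesign (Z i) (X i) (W i) M L)ᵀ *
      secondDesign (Z i) (X i) (W i) M L).det ≠ 0) ∧
    Tendsto (fun i => ols (secondDesign (Z i) (X i) (W i) M L) (Y i)) l (𝓝 b) ∧
    Tendsto (fun i => varMLE (secondDesign (Z i) (X i) (W i) M L) (Y i)) l (𝓝 v) ∧
    ((∀ a, β a ≠ 0 → a ∈ L) → b = β ∘ Subtype.val ∧
      v = ![1, β (Sum.inl ())] ⬝ᵥ (S *ᵥ ![1, β (Sum.inl ())])) ∧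
    ((∃ a, β a ≠ 0 ∧ a ∉ L) → ![1, β (Sum.inl ())] ⬝ᵥ (S *ᵥ ![1, β (Sum.inl ())]) < v) := by
  have horth : (secondCoef θ)ᵀ *ᵥ
      (Matrix.fromBlocks Q 0 0 S *ᵥ errorCoef pZ pX ![1, β (Sum.inl ())]) = 0 := by
    rw [fromBlocks_mulVec_error, secondCoef, Matrix.transpose_fromRows, Matrix.fromCols_mulVec]
    simp
  have hC : Tendsto (fun i => secondCoef (firstEstimate (Z i) (X i) (W i) M)) l
      (𝓝 (secondCoef θ)) :=
    (continuous_secondCoef.tendsto θ).comp (h.tendsto_firstEstimate_of_subset hM)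
  have key := submodel_limits h.size h.posDef h.gram hC (secondCoef_injective hid) β
    (errorCoef pZ pX ![1, β (Sum.inl ())]) horth (Subtype.val_injective (p := (· ∈ L)))
  simp_rw [← h.second_eq_array, ← secondDesign_eq, error_quadratic] at key
  simpa using key

/-- The second stage regressions with the first stage residual, whose coefficient absorbs the
correlation of the errors: those that contain the true model share the limiting residual variance
`v₀`, that of the part of the `Y` error uncorrelated with the `W` error, and all others have a
larger one. -/
lemma control_limits (hid : ∃ j, θ (Sum.inl j) ≠ 0) {M : FirstModel pZ pX}
    (hM : ∀ a, θ a ≠ 0 → a ∈ M) : ∃ v₀, 0 < v₀ ∧ ∀ L : SecondModel pX, ∃ v,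
    (∀ᶠ i in l, ((controlDesign (Z i) (X i) (W i) M L)ᵀ *
      controlDesign (Z i) (X i) (W i) M L).det ≠ 0) ∧
    Tendsto (fun i => varMLE (controlDesign (Z i) (X i) (W i) M L) (Y i)) l (𝓝 v) ∧
    ((∀ a, β a ≠ 0 → a ∈ L) → v = v₀) ∧ ((∃ a, β a ≠ 0 ∧ a ∉ L) → v₀ < v) := by
  set ρ := S 0 1 / S 1 1 with hρ
  have hS11 : 0 < S 1 1 := h.posDef_errors.diag_pos
  have horth : (controlCoef θ θ)ᵀ *ᵥ
      (Matrix.fromBlocks Q 0 0 S *ᵥ errorCoef pZ pX ![1, -ρ]) = 0 := by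
    have hS10 : S 1 0 = S 0 1 := by simpa using h.posDef_errors.isHermitian.apply 0 1
    rw [fromBlocks_mulVec_error, controlCoef, Matrix.transpose_fromCols, Matrix.fromRows_mulVec,
      secondCoef, Matrix.transpose_fromRows, Matrix.fromCols_mulVec]
    ext (a | a)
    · simp
    · simp [Matrix.mulVec, dotProduct, hS10, hρ]
      field_simp
      ring
  refine ⟨![1, -ρ] ⬝ᵥ (S *ᵥ ![1, -ρ]), h.error_pos (by simp), fun L => ?_⟩
  have hC : Tendsto (fun i => controlCoef θ (firstEstimate (Z i) (X i) (W i) M)) l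
      (𝓝 (controlCoef θ θ)) :=
    ((continuous_controlCoef θ).tendsto θ).comp (h.tendsto_firstEstimate_of_subset hM)
  have hinj : Function.Injective (Sum.map (Subtype.val : L → Unit ⊕ Fin pX) (id : Unit → Unit)) :=
    Sum.map_injective.mpr ⟨Subtype.val_injective, Function.injective_id⟩
  obtain ⟨b, v, k1, -, k3, k4, k5⟩ := submodel_limits h.size h.posDef h.gram hC
    (controlCoef_injective hid) (Sum.elim β (fun _ => β (Sum.inl ()) + ρ))
    (errorCoef pZ pX ![1, -ρ]) horth hinj
  simp_rw [← h.second_eq_control,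
    ← controlDesign_eq _ _ _ _ (h.first_eq _)] at k1 k3
  rw [error_quadratic] at k4 k5
  refine ⟨v, k1, k3, fun hL => (k4 ?_).2, fun ⟨a, ha, haL⟩ => k5 ⟨Sum.inl a, by simpa using ha, ?_⟩⟩
  · rintro (a | a) ha
    · exact ⟨Sum.inl ⟨a, hL a (by simpa using ha)⟩, rfl⟩
    · exact ⟨Sum.inr a, rfl⟩
  · rintro ⟨(b | b), hb⟩
    · simp only [Sum.map_inl, Sum.inl.injEq] at hb
      exact haL (hb ▸ b.2)
    · simp at hb

/-- The second stage scores, with or without the first stage residual, under a first stage model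
that contains the true one: the odds of a model that omits a relevant column vanish. -/
lemma secondScore_limits (hid : ∃ j, θ (Sum.inl j) ≠ 0) {M : FirstModel pZ pX}
    (hM : ∀ a, θ a ≠ 0 → a ∈ M) (control : Bool) :
    (∀ᶠ i in l, 0 < secondScore (Z i) (X i) (W i) (Y i) control M
      (Finset.univ.filter (fun a => β a ≠ 0))) ∧
    ∀ L : SecondModel pX, (∃ a, β a ≠ 0 ∧ a ∉ L) → Tendsto (fun i => (N i : ℝ) *
      (secondScore (Z i) (X i) (W i) (Y i) control M L / secondScore (Z i) (X i) (W i) (Y i)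
        control M (Finset.univ.filter (fun a => β a ≠ 0)))) l (𝓝 0) := by
  cases control
  · obtain ⟨b₀, v₀, g1, -, g3, g4, -⟩ :=
      h.second_limits hid hM (Finset.univ.filter (fun a => β a ≠ 0))
    have hv₀ := (g4 (by simp)).2
    have hpos : 0 < v₀ := by
      rw [hv₀]; exact h.error_pos (by simp)
    refine ⟨?_, fun L hL => ?_⟩
    · filter_upwards [g1, g3.eventually_const_lt hpos, h.size.eventually_gt_atTop 0]
        with i hi hvi hn
      simp only [secondScore, Bool.false_eq_true, if_false]
      rw [integratedLikelihood_eq hn hi hvi]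
      exact mul_pos (Real.rpow_pos_of_pos hvi _) (evidenceFactor_pos _ _)
    · obtain ⟨b, v, h1, -, h3, -, h5⟩ := h.second_limits hid hM L
      simp only [secondScore, Bool.false_eq_true, if_false]
      exact tendsto_evidence_ratio h.size h1 g1 h3 g3 hpos (by rw [hv₀]; exact h5 hL)
  · obtain ⟨v₀, hpos, hlim⟩ := h.control_limits hid hM
    obtain ⟨w, g1, g3, g4, -⟩ := hlim (Finset.univ.filter (fun a => β a ≠ 0))
    obtain rfl := g4 (by simp)
    refine ⟨?_, fun L hL => ?_⟩
    · filter_upwards [g1, g3.eventually_const_lt hpos, h.size.eventually_gt_atTop 0]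
        with i hi hvi hn
      simp only [secondScore, if_true]
      rw [integratedLikelihood_eq hn hi hvi]
      exact mul_pos (Real.rpow_pos_of_pos hvi _) (evidenceFactor_pos _ _)
    · obtain ⟨v, h1, h3, -, h5⟩ := hlim L
      simp only [secondScore, if_true]
      exact tendsto_evidence_ratio h.size h1 g1 h3 g3 hpos (h5 hL)

/-- Averaging over the second stage models is consistent under each first stage model that
contains the true one. -/
lemma tendsto_second_average (hid : ∃ j, θ (Sum.inl j) ≠ 0) {M : FirstModel pZ pX}
    (hM : ∀ a, θ a ≠ 0 → a ∈ M) (control : Bool) {𝓛 : Finset (SecondModel pX)}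
    (hβ : Finset.univ.filter (fun a => β a ≠ 0) ∈ 𝓛)
    {prL : FirstModel pZ pX → SecondModel pX → ℝ} (hprL : ∀ L ∈ 𝓛, 0 < prL M L) :
    Tendsto (fun i => ∑ L ∈ 𝓛, secondPosterior (Z i) (X i) (W i) (Y i) control 𝓛 prL M L •
      constrained2SLS (Z i) (X i) (W i) (Y i) M L) l (𝓝 β) := by
  obtain ⟨hpos, hodds⟩ := h.secondScore_limits hid hM control
  refine tendsto_average (fun i L hL =>
    ⟨posterior_nonneg (fun L => secondScore_nonneg _ _ _ _ _ _ L) hprL hL,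
      posterior_le_one (fun L => secondScore_nonneg _ _ _ _ _ _ L) hprL hL⟩) ?_ ?_
  · filter_upwards [hpos] with i hi
    exact sum_posterior (fun L => secondScore_nonneg _ _ _ _ _ _ L) hprL hβ hi
  intro L hL
  obtain ⟨b, v, -, h2, -, h4, -⟩ := h.second_limits hid hM L
  have hlim : Tendsto (fun i => constrained2SLS (Z i) (X i) (W i) (Y i) M L) l
      (𝓝 (extendMat (Subtype.val : L → Unit ⊕ Fin pX) *ᵥ b)) := by
    simp_rw [constrained2SLS_eq]
    exact tendsto_mulVec tendsto_const_nhds h2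
  by_cases hLβ : ∀ a, β a ≠ 0 → a ∈ L
  · left
    rwa [(h4 hLβ).1, extendMat_mulVec_comp Subtype.val_injective (by simpa using hLβ)] at hlim
  · right
    push Not at hLβ
    have h0 : Tendsto (fun i => (N i : ℝ) *
        secondPosterior (Z i) (X i) (W i) (Y i) control 𝓛 prL M L) l (𝓝 0) :=
      tendsto_posterior (s := fun i L => secondScore (Z i) (X i) (W i) (Y i) control M L) hL hβ
        (fun i L => secondScore_nonneg _ _ _ _ _ _ L) hprL (hodds L hLβ) hpos
    have h1 : Tendsto (fun i => secondPosterior (Z i) (X i) (W i) (Y i) control 𝓛 prL M L) l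
        (𝓝 0) := by
      refine squeeze_zero' (Eventually.of_forall fun i =>
        posterior_nonneg (fun L => secondScore_nonneg _ _ _ _ _ _ L) hprL hL) ?_ h0
      filter_upwards [h.size.eventually_ge_atTop 1] with i hn
      exact le_mul_of_one_le_left
        (posterior_nonneg (fun L => secondScore_nonneg _ _ _ _ _ _ L) hprL hL)
        (by exact_mod_cast hn)
    exact ⟨h1, by simpa using h1.smul hlim⟩

/-- Under an arbitrary first stage model the second stage may be nearly collinear, but the estimate
is at most of order `n` if the first stage coefficients are not smaller than order `1 / n`. -/
lemma constrained2SLS_isBigO {M : FirstModel pZ pX}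
    (hsep : ∀ a ∈ M, ∃ c > 0, ∀ᶠ i in l,
      c / (N i : ℝ) ≤ |firstEstimate (Z i) (X i) (W i) M a|) (L : SecondModel pX) :
    ∃ K, ∀ᶠ i in l, ‖constrained2SLS (Z i) (X i) (W i) (Y i) M L‖ ≤ K * N i := by
  obtain ⟨c, hc⟩ := h.tendsto_mean_square
  obtain ⟨t, ht, -⟩ := h.tendsto_firstEstimate M
  obtain ⟨K, hK, hfit⟩ := fit_coordinates_bounded h.size h.posDef_regressors
    h.tendsto_gram_regressors hc (fun i => slopeCoef (firstEstimate (Z i) (X i) (W i) M) *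
      extendMat (Subtype.val : L → Unit ⊕ Fin pX))
  simp_rw [← secondDesign_eq_mul, ← Matrix.mulVec_mulVec, ← constrained2SLS_eq] at hfit
  have htb := ht.norm.eventually_lt_const (lt_add_one ‖t‖)
  -- it suffices to bound the coefficient of the fitted value
  suffices hW : ∃ B, 0 ≤ B ∧ ∀ᶠ i in l,
      |constrained2SLS (Z i) (X i) (W i) (Y i) M L (Sum.inl ())| ≤ B * N i by
    obtain ⟨B, hB, hWi⟩ := hW
    refine ⟨B + K + (‖t‖ + 1) * B, ?_⟩
    filter_upwards [hfit, htb, hWi, h.size.eventually_ge_atTop 1] with i hfi hti hBi hn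
    have hn1 : (1:ℝ) ≤ N i := by exact_mod_cast hn
    set b := constrained2SLS (Z i) (X i) (W i) (Y i) M L
    set τ := firstEstimate (Z i) (X i) (W i) M
    have ht0 : 0 ≤ ‖t‖ := norm_nonneg t
    refine (pi_norm_le_iff_of_nonneg (by positivity)).mpr ?_
    rintro (⟨⟩ | j)
    · rw [Real.norm_eq_abs]
      refine hBi.trans ?_
      gcongr
      have : 0 ≤ (‖t‖ + 1) * B := by positivity
      linarith
    · have h1 := hfi (Sum.inr j)
      rw [slopeCoef_mulVec_inr] at h1
      have h2 : |τ (Sum.inr j)| ≤ ‖t‖ + 1 := (norm_le_pi_norm τ (Sum.inr j)).trans hti.le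
      have h3 : |τ (Sum.inr j) * b (Sum.inl ())| ≤ (‖t‖ + 1) * (B * N i) := by
        rw [abs_mul]; gcongr
      have h4 := abs_sub (τ (Sum.inr j) * b (Sum.inl ()) + b (Sum.inr j))
        (τ (Sum.inr j) * b (Sum.inl ()))
      rw [add_sub_cancel_left] at h4
      rw [Real.norm_eq_abs]
      have h5 : K ≤ K * N i := le_mul_of_one_le_right hK.le hn1
      have h6 : 0 ≤ B * N i := by positivity
      linarith
  by_cases hWL : Sum.inl () ∈ L
  swap
  · refine ⟨0, le_rfl, Eventually.of_forall fun i => ?_⟩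
    rw [constrained2SLS_of_notMem _ _ _ _ _ hWL]
    simp
  by_cases hM : ∀ a ∈ M, ∃ j, a = Sum.inr j ∧ Sum.inr j ∈ L
  -- the design is singular, and its least squares coefficient is zero by convention
  · refine ⟨0, le_rfl, Eventually.of_forall fun i => ?_⟩
    rw [constrained2SLS_eq, ols_eq_zero (det_gram_secondDesign_eq_zero hWL hM), Matrix.mulVec_zero]
    simp
  push Not at hM
  -- a column of `M` that is no regressor in `L`: there the fit has the coordinate `τ a * b`
  obtain ⟨a, ha, haL⟩ := hM
  obtain ⟨c, hc0, hci⟩ := hsep a ha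
  refine ⟨K / c, by positivity, ?_⟩
  filter_upwards [hfit, hci, h.size.eventually_ge_atTop 1] with i hfi hai hn
  have hn0 : (0:ℝ) < N i := by exact_mod_cast hn
  set b := constrained2SLS (Z i) (X i) (W i) (Y i) M L with hb
  set τ := firstEstimate (Z i) (X i) (W i) M
  have h1 : |τ a| * |b (Sum.inl ())| ≤ K := by
    rw [← abs_mul]
    have h2 := hfi a
    rcases a with j | j
    · rwa [slopeCoef_mulVec_inl] at h2
    · have h3 : b (Sum.inr j) = 0 := constrained2SLS_of_notMem _ _ _ _ _ (haL j rfl)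
      rwa [slopeCoef_mulVec_inr, h3, add_zero] at h2
  have h2 : c / N i * |b (Sum.inl ())| ≤ K :=
    (mul_le_mul_of_nonneg_right hai (abs_nonneg _)).trans h1
  rw [div_mul_eq_mul_div, div_le_iff₀ hn0] at h2
  rw [div_mul_eq_mul_div, le_div_iff₀ hc0]
  linarith

/-- Consistency of two-stage model averaging, given the limits of the moments, if an instrument is
relevant and the first stage coefficients are not smaller than order `1 / n`. -/
theorem tendsto_twoSBMA (hid : ∃ j, θ (Sum.inl j) ≠ 0)
    (hsep : ∀ M : FirstModel pZ pX, ∀ a ∈ M, ∃ c > 0, ∀ᶠ i in l,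
      c / (N i : ℝ) ≤ |firstEstimate (Z i) (X i) (W i) M a|)
    {𝓜 : Finset (FirstModel pZ pX)} {𝓛 : Finset (SecondModel pX)}
    (hθ : Finset.univ.filter (fun a => θ a ≠ 0) ∈ 𝓜)
    (hβ : Finset.univ.filter (fun a => β a ≠ 0) ∈ 𝓛)
    {prM : FirstModel pZ pX → ℝ} {prL : FirstModel pZ pX → SecondModel pX → ℝ}
    (hprM : ∀ M ∈ 𝓜, 0 < prM M) (hprL : ∀ M ∈ 𝓜, ∀ L ∈ 𝓛, 0 < prL M L) (control : Bool) :
    Tendsto (fun i => twoSBMA (Z i) (X i) (W i) (Y i) control 𝓜 𝓛 prM prL) l (𝓝 β) := by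
  have hsplit : ∀ i, twoSBMA (Z i) (X i) (W i) (Y i) control 𝓜 𝓛 prM prL =
      ∑ M ∈ 𝓜, firstPosterior (Z i) (X i) (W i) 𝓜 prM M •
        ∑ L ∈ 𝓛, secondPosterior (Z i) (X i) (W i) (Y i) control 𝓛 prL M L •
          constrained2SLS (Z i) (X i) (W i) (Y i) M L := fun i => by
    rw [twoSBMA]
    simp_rw [Finset.smul_sum, smul_smul]
  simp_rw [hsplit]
  have hs : ∀ (i : ι) (M : FirstModel pZ pX),
      0 ≤ integratedLikelihood (firstDesign (Z i) (X i) M) (W i) :=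
    fun i M => integratedLikelihood_nonneg _ _
  refine tendsto_average (fun i M hM => ⟨posterior_nonneg (hs i) hprM hM,
    posterior_le_one (hs i) hprM hM⟩) (h.eventually_sum_firstPosterior hprM hθ) fun M hM => ?_
  by_cases hMθ : ∀ a, θ a ≠ 0 → a ∈ M
  · exact Or.inl (h.tendsto_second_average hid hMθ control hβ (hprL M hM))
  right
  push Not at hMθ
  have h0 := h.tendsto_firstPosterior hprM hθ hM hMθ
  have hnn : ∀ i, 0 ≤ firstPosterior (Z i) (X i) (W i) 𝓜 prM M := fun i =>
    posterior_nonneg (hs i) hprM hM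
  refine ⟨squeeze_zero' (Eventually.of_forall hnn) ?_ h0, ?_⟩
  · filter_upwards [h.size.eventually_ge_atTop 1] with i hn
    exact le_mul_of_one_le_left (hnn i) (by exact_mod_cast hn)
  choose K hK using fun L => h.constrained2SLS_isBigO (hsep M) L
  have h1 := h0.const_mul (∑ L ∈ 𝓛, K L)
  rw [mul_zero] at h1
  refine squeeze_zero_norm' ?_ h1
  filter_upwards [(Finset.eventually_all 𝓛).mpr fun L _ => hK L] with i hi
  rw [norm_smul, Real.norm_of_nonneg (hnn i)]
  calc _ ≤ firstPosterior (Z i) (X i) (W i) 𝓜 prM M * ∑ L ∈ 𝓛, K L * N i := by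
        refine mul_le_mul_of_nonneg_left ((norm_sum_le _ _).trans
          (Finset.sum_le_sum fun L hL => ?_)) (hnn i)
        have hw0 : 0 ≤ secondPosterior (Z i) (X i) (W i) (Y i) control 𝓛 prL M L :=
          posterior_nonneg (fun L => secondScore_nonneg _ _ _ _ _ _ L) (hprL M hM) hL
        have hw1 : secondPosterior (Z i) (X i) (W i) (Y i) control 𝓛 prL M L ≤ 1 :=
          posterior_le_one (fun L => secondScore_nonneg _ _ _ _ _ _ L) (hprL M hM) hL
        rw [norm_smul, Real.norm_of_nonneg hw0]
        exact (mul_le_of_le_one_left (norm_nonneg _) hw1).trans (hi L hL)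
    _ = _ := by rw [← Finset.sum_mul]; ring

end MomentLimits

/-! ### Convergence in probability and normal linear forms -/

section InProbability

variable {Ω : Type*} [MeasurableSpace Ω] {P : Measure Ω}

/-- The filter of the events, for samples of size `n`, whose probability tends to one as
`n → ∞`. Events need not be measurable: `P` is used as an outer measure. -/
def inProb (P : Measure Ω) : Filter (ℕ × Ω) where
  sets := {s | Tendsto (fun n => P {ω | (n, ω) ∉ s}) atTop (𝓝 0)}
  univ_sets := by simp
  sets_of_superset {s t} hs hst := by
    refine tendsto_of_tendsto_of_tendsto_of_le_of_le tendsto_const_nhds hs (fun _ => zero_le)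
      fun n => measure_mono fun ω hω h => hω (hst h)
  inter_sets {s t} hs ht := by
    have h := hs.add ht
    rw [add_zero] at h
    refine tendsto_of_tendsto_of_tendsto_of_le_of_le tendsto_const_nhds h (fun _ => zero_le)
      fun n => ?_
    refine le_trans (measure_mono fun ω hω => ?_) (measure_union_le _ _)
    by_contra h'
    simp only [Set.mem_union, Set.mem_ofPred_eq, not_or, not_not] at h'
    exact hω ⟨h'.1, h'.2⟩

lemma eventually_inProb {A : ℕ → Ω → Prop} :
    (∀ᶠ p in inProb P, A p.1 p.2) ↔ Tendsto (fun n => P {ω | ¬ A n ω}) atTop (𝓝 0) := Iff.rfl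

lemma tendsto_fst_inProb : Tendsto (fun p : ℕ × Ω => p.1) (inProb P) atTop := by
  rw [tendsto_atTop]
  intro m
  refine (eventually_inProb (A := fun n _ => m ≤ n)).mpr (tendsto_const_nhds.congr' ?_)
  filter_upwards [eventually_ge_atTop m] with n hn
  simp [hn]

/-- Convergence in probability to a constant is convergence along `inProb`. -/
lemma tendstoInMeasure_iff_tendsto_inProb {E : Type*} [PseudoMetricSpace E] {f : ℕ → Ω → E}
    {c : E} : TendstoInMeasure P f atTop (fun _ => c) ↔
      Tendsto (fun p : ℕ × Ω => f p.1 p.2) (inProb P) (𝓝 c) := by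
  rw [tendstoInMeasure_iff_dist, Metric.tendsto_nhds]
  refine forall_congr' fun ε => forall_congr' fun _ => ?_
  rw [eventually_inProb (A := fun n ω => dist (f n ω) c < ε)]
  simp only [not_lt]

lemma eventually_inProb_of_le {A : ℕ → Ω → Prop} {r : ℕ → ℝ} (hr : Tendsto r atTop (𝓝 0))
    (h : ∀ᶠ n in atTop, P {ω | ¬ A n ω} ≤ ENNReal.ofReal (r n)) :
    ∀ᶠ p in inProb P, A p.1 p.2 := by
  rw [eventually_inProb]
  have h0 : Tendsto (fun n => ENNReal.ofReal (r n)) atTop (𝓝 0) := by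
    simpa using ENNReal.tendsto_ofReal hr
  exact tendsto_of_tendsto_of_tendsto_of_le_of_le' tendsto_const_nhds h0
    (Eventually.of_forall fun _ => zero_le) h

end InProbability

section Gaussian

variable {Ω : Type*} [MeasurableSpace Ω] {P : Measure Ω}

lemma hasLaw_dotProduct_gaussian {n : ℕ} {ζ : Fin n → Ω → ℝ} {v : NNReal}
    (hζ : ∀ k, HasLaw (ζ k) (gaussianReal 0 v) P) (hind : iIndepFun ζ P) (w : Fin n → ℝ) :
    HasLaw (fun ω => w ⬝ᵥ fun k => ζ k ω) (gaussianReal 0 (v * (w ⬝ᵥ w).toNNReal)) P := by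
  have hg : ∀ k, HasLaw (fun ω => w k * ζ k ω)
      (gaussianReal (w k * 0) (.mk (w k ^ 2) (sq_nonneg _) * v)) P :=
    fun k => gaussianReal_const_mul (hζ k) (w k)
  have hG : ∀ k, HasGaussianLaw (fun ω => w k * ζ k ω) P := fun k => (hg k).hasGaussianLaw
  have hI : iIndepFun (fun k ω => w k * ζ k ω) P :=
    hind.comp (fun k x => w k * x) (fun k => by fun_prop)
  have hsum := iIndepFun.hasGaussianLaw_fun_sum hG hI
  refine ⟨hsum.aemeasurable, ?_⟩
  have hmean : ∀ k, P[fun ω => w k * ζ k ω] = 0 := fun k => by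
    rw [(hg k).integral_eq]; simp
  have hvar : ∀ k, Var[fun ω => w k * ζ k ω; P] = w k ^ 2 * v := fun k => by
    rw [(hg k).variance_eq]; simp
  have e1 : P[fun ω => ∑ k, w k * ζ k ω] = 0 := by
    rw [integral_finsetSum _ fun k _ => (hG k).integrable]
    simp only [hmean, Finset.sum_const_zero]
  have e2 : Var[fun ω => ∑ k, w k * ζ k ω; P] = v * (w ⬝ᵥ w) := by
    have := IndepFun.variance_sum (X := fun k ω => w k * ζ k ω) (s := Finset.univ)
      (fun k _ => (hG k).memLp_two) (fun i _ j _ hij => hI.indepFun hij)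
    have h2 : (∑ k, fun ω => w k * ζ k ω) = fun ω => ∑ k, w k * ζ k ω := by
      ext ω; simp
    rw [h2] at this
    rw [this]
    simp only [hvar, dotProduct, Finset.mul_sum]
    exact Finset.sum_congr rfl fun k _ => by ring
  have h := hsum.map_eq_gaussianReal
  rw [e1, e2, Real.toNNReal_mul v.coe_nonneg, Real.toNNReal_coe] at h
  exact h

/-- Anti-concentration: the normal density is at most `1 / √(2 π s)`. -/
lemma gaussianReal_sq_le {s : NNReal} (hs : s ≠ 0) (m κ : ℝ) (hκ : 0 ≤ κ) :
    gaussianReal 0 s {x | (x + m) ^ 2 ≤ κ ^ 2} ≤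
      ENNReal.ofReal (2 * κ / Real.sqrt (2 * Real.pi * s)) := by
  have hset : {x : ℝ | (x + m) ^ 2 ≤ κ ^ 2} = Set.Icc (-κ - m) (κ - m) := by
    ext x
    simp only [Set.mem_ofPred_eq, sq_le_sq, abs_of_nonneg hκ, abs_le, Set.mem_Icc]
    constructor <;> rintro ⟨h1, h2⟩ <;> constructor <;> linarith
  rw [hset, gaussianReal_apply _ hs]
  have hs' : (0:ℝ) < s := by positivity
  calc ∫⁻ x in Set.Icc (-κ - m) (κ - m), gaussianPDF 0 s x
      ≤ ∫⁻ _ in Set.Icc (-κ - m) (κ - m), ENNReal.ofReal (Real.sqrt (2 * Real.pi * s))⁻¹ := by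
        refine lintegral_mono fun x => ENNReal.ofReal_le_ofReal ?_
        rw [gaussianPDFReal]
        refine mul_le_of_le_one_right (by positivity) (Real.exp_le_one_iff.mpr ?_)
        have : 0 ≤ (x - 0) ^ 2 / (2 * (s:ℝ)) := by positivity
        rw [neg_div]; linarith
    _ = _ := by
        rw [setLIntegral_const, Real.volume_Icc, ← ENNReal.ofReal_mul (by positivity)]
        congr 1; ring

/-- Chebyshev's inequality for a centred normal law. -/
lemma gaussianReal_lt_sq (s : NNReal) {c : ℝ} (hc : 0 < c) :
    gaussianReal 0 s {x | c ^ 2 < x ^ 2} ≤ ENNReal.ofReal (s / c ^ 2) := by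
  have h := meas_ge_le_variance_div_sq (memLp_id_gaussianReal (μ := 0) (v := s) 2) hc
  rw [variance_id_gaussianReal] at h
  refine le_trans (measure_mono fun x hx => ?_) h
  have hx : c ^ 2 < x ^ 2 := hx
  have hm : ∫ x, id x ∂gaussianReal 0 s = 0 := by simp
  simp only [Set.mem_ofPred_eq]
  rw [hm]
  simpa [abs_of_pos hc] using (sq_lt_sq.mp hx).le

variable [IsProbabilityMeasure P]

/-- Disintegration along an independent pair: an event in `(R, T)` is at most as likely as its
most likely section. -/
lemma measure_le_of_sections {𝓡 𝓣 : Type*} [MeasurableSpace 𝓡] [MeasurableSpace 𝓣] {R : Ω → 𝓡}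
    {T : Ω → 𝓣} (hR : Measurable R) (hT : Measurable T) (hind : IndepFun R T P)
    {E : Set (𝓡 × 𝓣)} (hE : MeasurableSet E) {κ : ENNReal}
    (h : ∀ r, P {ω | (r, T ω) ∈ E} ≤ κ) : P {ω | (R ω, T ω) ∈ E} ≤ κ := by
  have h1 : P {ω | (R ω, T ω) ∈ E} = (P.map R).prod (P.map T) E := by
    rw [← (indepFun_iff_map_prod_eq_prod_map_map hR.aemeasurable hT.aemeasurable).mp hind,
      Measure.map_apply (hR.prodMk hT) hE]
    rfl
  have := Measure.isProbabilityMeasure_map (μ := P) hR.aemeasurable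
  have := Measure.isProbabilityMeasure_map (μ := P) hT.aemeasurable
  rw [h1, Measure.prod_apply hE]
  calc ∫⁻ r, P.map T (Prod.mk r ⁻¹' E) ∂P.map R ≤ ∫⁻ _, κ ∂P.map R := by
        refine lintegral_mono fun r => ?_
        rw [Measure.map_apply hT (measurable_prodMk_left hE)]
        exact h r
    _ = κ := by simp

lemma measurable_dotProduct {α : Type*} [MeasurableSpace α] {n : Type*} [Fintype n]
    {w z : α → n → ℝ} (hw : Measurable w) (hz : Measurable z) :
    Measurable fun a => w a ⬝ᵥ z a :=
  Finset.measurable_sum _ fun k _ => ((measurable_pi_apply k).comp hw).mul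
    ((measurable_pi_apply k).comp hz)

variable {𝓡 : Type*} [MeasurableSpace 𝓡] {R : Ω → 𝓡} {n : ℕ} {ζ : Fin n → Ω → ℝ} {v : NNReal}

/-- Chebyshev's inequality for a linear combination of normal variables whose coefficients are
independent of them. -/
lemma measure_lt_sq_dotProduct_le (hR : Measurable R) (hζm : ∀ k, Measurable (ζ k))
    (hζ : ∀ k, HasLaw (ζ k) (gaussianReal 0 v) P) (hind : iIndepFun ζ P)
    (hRζ : IndepFun R (fun ω k => ζ k ω) P) {w : 𝓡 → Fin n → ℝ} (hw : Measurable w) {K : ℝ}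
    (hK : 0 < K) :
    P {ω | K ^ 2 * (w (R ω) ⬝ᵥ w (R ω)) < (w (R ω) ⬝ᵥ fun k => ζ k ω) ^ 2} ≤
      ENNReal.ofReal (v / K ^ 2) := by
  have hw' : Measurable fun q : 𝓡 × (Fin n → ℝ) => w q.1 := hw.comp measurable_fst
  refine measure_le_of_sections (E := {q : 𝓡 × (Fin n → ℝ) |
    K ^ 2 * (w q.1 ⬝ᵥ w q.1) < (w q.1 ⬝ᵥ q.2) ^ 2}) hR (measurable_pi_lambda _ hζm) hRζ
    (measurableSet_lt ((measurable_dotProduct hw' hw').const_mul _)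
      ((measurable_dotProduct hw' measurable_snd).pow_const 2)) fun r => ?_
  have hlaw := hasLaw_dotProduct_gaussian hζ hind (w r)
  simp only [Set.mem_ofPred_eq]
  rw [hlaw.measure_eq (p := fun x => K ^ 2 * (w r ⬝ᵥ w r) < x ^ 2)
    (measurableSet_lt measurable_const (by fun_prop))]
  have hnn := dotProduct_self_nonneg_real (w r)
  rcases hnn.eq_or_lt with h0 | h0
  · rw [← h0]
    simp [gaussianReal_zero_var]
  · have hc : 0 < K * Real.sqrt (w r ⬝ᵥ w r) := mul_pos hK (Real.sqrt_pos.mpr h0)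
    have h := gaussianReal_lt_sq (v * (w r ⬝ᵥ w r).toNNReal) hc
    rw [mul_pow, Real.sq_sqrt hnn] at h
    refine h.trans (ENNReal.ofReal_le_ofReal (le_of_eq ?_))
    rw [NNReal.coe_mul, Real.coe_toNNReal _ hnn]
    field_simp

/-- Anti-concentration of a linear combination of normal variables, shifted by `m`, whose
coefficients and shift are independent of the variables. -/
lemma measure_sq_dotProduct_add_le (hv : v ≠ 0) (hR : Measurable R) (hζm : ∀ k, Measurable (ζ k))
    (hζ : ∀ k, HasLaw (ζ k) (gaussianReal 0 v) P) (hind : iIndepFun ζ P)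
    (hRζ : IndepFun R (fun ω k => ζ k ω) P) {w : 𝓡 → Fin n → ℝ} (hw : Measurable w) {m : 𝓡 → ℝ}
    (hm : Measurable m) {κ : ℝ} (hκ : 0 ≤ κ) :
    P {ω | 0 < w (R ω) ⬝ᵥ w (R ω) ∧ (w (R ω) ⬝ᵥ (fun k => ζ k ω) + m (R ω)) ^ 2 ≤
      κ ^ 2 * (w (R ω) ⬝ᵥ w (R ω))} ≤ ENNReal.ofReal (2 * κ / Real.sqrt (2 * Real.pi * v)) := by
  have hw' : Measurable fun q : 𝓡 × (Fin n → ℝ) => w q.1 := hw.comp measurable_fst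
  refine measure_le_of_sections (E := {q : 𝓡 × (Fin n → ℝ) | 0 < w q.1 ⬝ᵥ w q.1 ∧
    (w q.1 ⬝ᵥ q.2 + m q.1) ^ 2 ≤ κ ^ 2 * (w q.1 ⬝ᵥ w q.1)}) hR (measurable_pi_lambda _ hζm) hRζ
    ((measurableSet_lt measurable_const (measurable_dotProduct hw' hw')).inter (measurableSet_le
      (((measurable_dotProduct hw' measurable_snd).add (hm.comp measurable_fst)).pow_const 2)
      ((measurable_dotProduct hw' hw').const_mul _))) fun r => ?_
  by_cases h0 : 0 < w r ⬝ᵥ w r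
  swap
  · simp [h0]
  have hlaw := hasLaw_dotProduct_gaussian hζ hind (w r)
  simp only [Set.mem_ofPred_eq, h0, true_and]
  rw [hlaw.measure_eq (p := fun x => (x + m r) ^ 2 ≤ κ ^ 2 * (w r ⬝ᵥ w r))
    (measurableSet_le (by fun_prop) measurable_const)]
  have hne : v * (w r ⬝ᵥ w r).toNNReal ≠ 0 := mul_ne_zero hv (by simpa using h0)
  have h := gaussianReal_sq_le hne (m r) (κ * Real.sqrt (w r ⬝ᵥ w r)) (by positivity)
  rw [mul_pow, Real.sq_sqrt h0.le] at h
  refine h.trans (ENNReal.ofReal_le_ofReal (le_of_eq ?_))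
  rw [NNReal.coe_mul, Real.coe_toNNReal _ h0.le, ← mul_assoc 2 κ,
    ← mul_assoc (2 * Real.pi), Real.sqrt_mul (by positivity) (w r ⬝ᵥ w r),
    mul_div_mul_right _ _ (Real.sqrt_pos.mpr h0).ne']

end Gaussian

section Measurability

variable {α : Type*} [MeasurableSpace α] {κ : Type*} [Fintype κ] [DecidableEq κ]

lemma measurable_det {A : α → Matrix κ κ ℝ} (hA : ∀ i j, Measurable fun a => A a i j) :
    Measurable fun a => (A a).det := by
  simp_rw [Matrix.det_apply]
  exact Finset.measurable_sum _ fun σ _ =>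
    (Finset.measurable_prod _ fun i _ => hA (σ i) i).const_smul _

lemma measurable_inv_apply {A : α → Matrix κ κ ℝ} (hA : ∀ i j, Measurable fun a => A a i j)
    (i j : κ) : Measurable fun a => (A a)⁻¹ i j := by
  simp only [Matrix.inv_def, Matrix.smul_apply, Ring.inverse_eq_inv', smul_eq_mul,
    Matrix.adjugate_apply]
  refine (measurable_det hA).inv.mul (measurable_det fun k l => ?_)
  simp only [Matrix.updateRow_apply]
  split_ifs
  · exact measurable_const
  · exact hA k l

lemma measurable_mul_apply {l m n : Type*} [Fintype m] {A : α → Matrix l m ℝ}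
    {B : α → Matrix m n ℝ} (hA : ∀ i j, Measurable fun a => A a i j)
    (hB : ∀ i j, Measurable fun a => B a i j) (i : l) (j : n) :
    Measurable fun a => (A a * B a) i j := by
  simp only [Matrix.mul_apply]
  exact Finset.measurable_sum _ fun k _ => (hA i k).mul (hB k j)

lemma measurable_mulVec {m n : Type*} [Fintype n] {A : α → Matrix m n ℝ} {x : α → n → ℝ}
    (hA : ∀ i j, Measurable fun a => A a i j) (hx : Measurable x) :
    Measurable fun a => A a *ᵥ x a :=
  measurable_pi_lambda _ fun i => measurable_dotProduct (measurable_pi_lambda _ fun j => hA i j) hx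

lemma measurable_ols {n : ℕ} {A : α → Matrix (Fin n) κ ℝ} {y : α → Fin n → ℝ}
    (hA : ∀ i j, Measurable fun a => A a i j) (hy : Measurable y) :
    Measurable fun a => ols (A a) (y a) :=
  measurable_mulVec (measurable_inv_apply (measurable_mul_apply (fun i j => hA j i) hA))
    (measurable_mulVec (fun i j => hA j i) hy)

end Measurability

/-! ### Laws of the errors -/

section Errors

variable {Ω : Type*} [MeasurableSpace Ω] {P : Measure Ω}
  {e : ℕ → Ω → EuclideanSpace ℝ (Fin 2)} {S : Matrix (Fin 2) (Fin 2) ℝ}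

lemma measurable_error (hem : ∀ k, Measurable (e k)) (k : ℕ) (s : Fin 2) :
    Measurable fun ω => e k ω s := by
  have := hem k
  fun_prop

lemma hasLaw_error (hS : S.PosDef) (he : ∀ k, HasLaw (e k) (multivariateGaussian 0 S) P) (k : ℕ)
    (s : Fin 2) : HasLaw (fun ω => e k ω s) (gaussianReal 0 (S s s).toNNReal) P := by
  have h := (measurePreserving_eval_multivariateGaussian (μ := 0) hS.posSemidef (i := s)).hasLaw
  have := h.comp (he k)
  simpa [Function.comp_def] using this

lemma covariance_error (hS : S.PosDef) (he : ∀ k, HasLaw (e k) (multivariateGaussian 0 S) P)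
    (k : ℕ) (s t : Fin 2) : cov[fun ω => e k ω s, fun ω => e k ω t; P] = S s t := by
  rw [← covariance_eval_multivariateGaussian (μ := 0) hS.posSemidef, ← (he k).map_eq,
    covariance_map (by fun_prop) (by fun_prop) (he k).aemeasurable]
  rfl

lemma memLp_error (hS : S.PosDef) (he : ∀ k, HasLaw (e k) (multivariateGaussian 0 S) P) (k : ℕ)
    (s : Fin 2) : MemLp (fun ω => e k ω s) 2 P :=
  (hasLaw_error hS he k s).hasGaussianLaw.memLp_two

lemma integral_error (hS : S.PosDef) (he : ∀ k, HasLaw (e k) (multivariateGaussian 0 S) P) (k : ℕ)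
    (s : Fin 2) : P[fun ω => e k ω s] = 0 := by
  rw [(hasLaw_error hS he k s).integral_eq]; simp

/-- The part of the error of the `Y` equation that is uncorrelated with the error of the `W`
equation. -/
def pureError (S : Matrix (Fin 2) (Fin 2) ℝ) (x : EuclideanSpace ℝ (Fin 2)) : ℝ :=
  x 0 - S 0 1 / S 1 1 * x 1

lemma measurable_pureError (S : Matrix (Fin 2) (Fin 2) ℝ) : Measurable (pureError S) := by
  unfold pureError; fun_prop

/-- The pair of the pure error (`j = 0`) and the error of the `W` equation (`j = 1`). -/
def splitError (S : Matrix (Fin 2) (Fin 2) ℝ) (j : Fin 2) (x : EuclideanSpace ℝ (Fin 2)) : ℝ :=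
  if j = 0 then pureError S x else x 1

lemma measurable_splitError (S : Matrix (Fin 2) (Fin 2) ℝ) (j : Fin 2) :
    Measurable (splitError S j) := by
  unfold splitError
  split_ifs
  · exact measurable_pureError S
  · fun_prop

lemma hasGaussianLaw_splitError (he : ∀ k, HasLaw (e k) (multivariateGaussian 0 S) P) (k : ℕ) :
    HasGaussianLaw (fun ω j => splitError S j (e k ω)) P := by
  let p : Fin 2 → EuclideanSpace ℝ (Fin 2) →L[ℝ] ℝ := fun j => EuclideanSpace.proj j
  let L : EuclideanSpace ℝ (Fin 2) →L[ℝ] Fin 2 → ℝ :=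
    ContinuousLinearMap.pi fun j => if j = 0 then p 0 - (S 0 1 / S 1 1) • p 1 else p 1
  have h := (he k).hasGaussianLaw.map_fun L
  have hL : (fun ω j => splitError S j (e k ω)) = fun ω => L (e k ω) := by
    ext ω j
    fin_cases j <;> simp [L, p, splitError, pureError]
  rw [hL]
  exact h

variable [IsProbabilityMeasure P]

/-- The law of large numbers for the products of the errors. -/
lemma tendsto_mean_error_mul (hS : S.PosDef)
    (he : ∀ k, HasLaw (e k) (multivariateGaussian 0 S) P) (hem : ∀ k, Measurable (e k))
    (hind : iIndepFun e P) (s t : Fin 2) :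
    TendstoInMeasure P (fun (n : ℕ) ω => (∑ k ∈ Finset.range n, e k ω s * e k ω t) / (n : ℝ)) atTop
      (fun _ => S s t) := by
  have hmean : P[fun ω => e 0 ω s * e 0 ω t] = S s t := by
    have := covariance_error hS he 0 s t
    rw [covariance_eq_sub (memLp_error hS he 0 s) (memLp_error hS he 0 t), integral_error hS he,
      zero_mul, sub_zero] at this
    exact this
  have hg : Measurable fun x : EuclideanSpace ℝ (Fin 2) => x s * x t := by fun_prop
  have key := strong_law_ae_real (μ := P) (fun k ω => e k ω s * e k ω t)
    ((memLp_error hS he 0 s).integrable_mul (memLp_error hS he 0 t))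
    (fun i j hij => (hind.indepFun hij).comp hg hg)
    (fun i => (((he i).identDistrib (he 0)).comp hg))
  rw [hmean] at key
  refine tendstoInMeasure_of_tendsto_ae (fun n => ?_) key
  refine Measurable.aestronglyMeasurable ?_
  exact (Finset.measurable_sum _ fun k _ =>
    (measurable_error hem k s).mul (measurable_error hem k t)).div_const _

/-- The pure errors are nondegenerate, as the covariance matrix of the errors is nonsingular. -/
lemma hasLaw_pureError (hS : S.PosDef) (he : ∀ k, HasLaw (e k) (multivariateGaussian 0 S) P) :
    ∃ v : NNReal, v ≠ 0 ∧ ∀ k, HasLaw (fun ω => pureError S (e k ω)) (gaussianReal 0 v) P := by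
  set ρ := S 0 1 / S 1 1 with hρ
  have hS11 : 0 < S 1 1 := hS.diag_pos
  have hS10 : S 1 0 = S 0 1 := by simpa using hS.isHermitian.apply 0 1
  have hpos : 0 < S 0 0 - 2 * (ρ * S 0 1) + ρ ^ 2 * S 1 1 := by
    have h := hS.dotProduct_mulVec_pos (x := ![1, -ρ]) (by simp)
    simp [dotProduct, Matrix.mulVec, hS10] at h
    linarith
  refine ⟨(S 0 0 - 2 * (ρ * S 0 1) + ρ ^ 2 * S 1 1).toNNReal, by simpa using hpos, fun k => ?_⟩
  have hg : HasGaussianLaw (fun ω => pureError S (e k ω)) P :=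
    (hasGaussianLaw_splitError he k).eval 0
  refine ⟨hg.aemeasurable, ?_⟩
  have h1 := hg.map_eq_gaussianReal
  have hm : P[fun ω => pureError S (e k ω)] = 0 := by
    unfold pureError
    rw [integral_sub ((memLp_error hS he k 0).integrable one_le_two)
      (((memLp_error hS he k 1).integrable one_le_two).const_mul _), integral_const_mul,
      integral_error hS he, integral_error hS he]
    simp
  have hv : Var[fun ω => pureError S (e k ω); P] =
      S 0 0 - 2 * (ρ * S 0 1) + ρ ^ 2 * S 1 1 := by
    unfold pureError
    rw [variance_fun_sub (memLp_error hS he k 0) ((memLp_error hS he k 1).const_mul _),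
      covariance_const_mul_right, variance_const_mul, covariance_error hS he,
      ← covariance_self (memLp_error hS he k 0).aemeasurable,
      ← covariance_self (memLp_error hS he k 1).aemeasurable, covariance_error hS he,
      covariance_error hS he]
  rw [hm, hv] at h1
  exact h1

lemma iIndepFun_splitError (hS : S.PosDef)
    (he : ∀ k, HasLaw (e k) (multivariateGaussian 0 S) P) (k : ℕ) :
    iIndepFun (fun j ω => splitError S j (e k ω)) P := by
  have hS11 : 0 < S 1 1 := hS.diag_pos
  have hc : cov[fun ω => pureError S (e k ω), fun ω => e k ω 1; P] = 0 := by
    unfold pureError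
    rw [covariance_fun_sub_left (memLp_error hS he k 0) ((memLp_error hS he k 1).const_mul _)
      (memLp_error hS he k 1), covariance_const_mul_left, covariance_error hS he,
      covariance_error hS he]
    field_simp
    ring
  refine (hasGaussianLaw_splitError he k).iIndepFun_of_covariance_eq_zero fun i j hij => ?_
  fin_cases i <;> fin_cases j
  · exact absurd rfl hij
  · exact hc
  · exact (covariance_comm _ _).trans hc
  · exact absurd rfl hij

/-- The errors of the `W` equation are jointly independent of the pure errors of the `Y`
equation. -/
lemma indepFun_error_pureError (hS : S.PosDef)
    (he : ∀ k, HasLaw (e k) (multivariateGaussian 0 S) P) (hem : ∀ k, Measurable (e k))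
    (hind : iIndepFun e P) (n : ℕ) :
    IndepFun (fun ω (k : Fin n) => e k ω 1) (fun ω (k : Fin n) => pureError S (e k ω)) P := by
  have h := iIndepFun_uncurry' (P := P) (X := fun (k : ℕ) (j : Fin 2) ω => splitError S j (e k ω))
    (fun k j => (measurable_splitError S j).comp (hem k))
    (hind.comp (fun _ x j => splitError S j x)
      (fun _ => measurable_pi_lambda _ (measurable_splitError S)))
    (iIndepFun_splitError hS he)
  have hA : Disjoint (Finset.range n ×ˢ {(1 : Fin 2)}) (Finset.range n ×ˢ {(0 : Fin 2)}) := by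
    rw [Finset.disjoint_left]
    rintro ⟨k, j⟩ hp hp'
    simp only [Finset.mem_product, Finset.mem_singleton] at hp hp'
    exact absurd (hp.2.symm.trans hp'.2) (by decide)
  have h2 := h.indepFun_finset _ _ hA fun p => (measurable_splitError S p.2).comp (hem p.1)
  have hmem : ∀ (j : Fin 2) (k : Fin n), ((k : ℕ), j) ∈ Finset.range n ×ˢ {j} := fun j k => by
    simp
  exact h2.comp (φ := fun x (k : Fin n) => x ⟨((k : ℕ), 1), hmem 1 k⟩)
    (ψ := fun x (k : Fin n) => x ⟨((k : ℕ), 0), hmem 0 k⟩)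
    (measurable_pi_lambda _ fun k => measurable_pi_apply _)
    (measurable_pi_lambda _ fun k => measurable_pi_apply _)

end Errors

/-! ### The first-stage fit purged of the covariates -/

section PartialFit

variable {n pZ pX : ℕ}

/-- The first stage fit of the full model, purged of the covariates: the part of the fitted value
of `W` that only the instruments explain. -/
def partialFit (Z : Matrix (Fin n) (Fin pZ) ℝ) (X : Matrix (Fin n) (Fin pX) ℝ) (W : Fin n → ℝ) :
    Fin n → ℝ :=
  Matrix.fromCols Z X *ᵥ ols (Matrix.fromCols Z X) W -
    X *ᵥ ols X (Matrix.fromCols Z X *ᵥ ols (Matrix.fromCols Z X) W)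

lemma mulVec_eq_zero_of_det_gram {κ : Type*} [Fintype κ] [DecidableEq κ]
    {A : Matrix (Fin n) κ ℝ} (hA : (Aᵀ * A).det ≠ 0) {v : κ → ℝ} (hv : A *ᵥ v = 0) : v = 0 :=
  Matrix.eq_zero_of_mulVec_eq_zero hA (by rw [← Matrix.mulVec_mulVec, hv, Matrix.mulVec_zero])

lemma det_gram_ne_zero_of_injective {κ : Type*} [Fintype κ] [DecidableEq κ]
    {A : Matrix (Fin n) κ ℝ} (hA : ∀ v, A *ᵥ v = 0 → v = 0) : (Aᵀ * A).det ≠ 0 := by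
  intro h
  obtain ⟨v, hv0, hv⟩ := Matrix.exists_mulVec_eq_zero_iff.mpr h
  refine hv0 (hA v ?_)
  rw [← dotProduct_self_eq_zero, dotProduct_mulVec_eq, Matrix.mulVec_mulVec, hv, zero_dotProduct]

lemma fromCols_mulVec_sum_elim (Z : Matrix (Fin n) (Fin pZ) ℝ) (X : Matrix (Fin n) (Fin pX) ℝ)
    (d : Fin pX → ℝ) : Matrix.fromCols Z X *ᵥ Sum.elim 0 d = X *ᵥ d := by
  rw [Matrix.fromCols_mulVec, Sum.elim_comp_inl, Sum.elim_comp_inr, Matrix.mulVec_zero, zero_add]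

variable {Z : Matrix (Fin n) (Fin pZ) ℝ} {X : Matrix (Fin n) (Fin pX) ℝ}
  (hV : ((Matrix.fromCols Z X)ᵀ * Matrix.fromCols Z X).det ≠ 0) (W : Fin n → ℝ)

include hV

lemma det_gram_covariates : (Xᵀ * X).det ≠ 0 := by
  refine det_gram_ne_zero_of_injective fun v hv => ?_
  rw [← fromCols_mulVec_sum_elim Z] at hv
  have h := mulVec_eq_zero_of_det_gram hV hv
  ext j
  exact congrFun h (Sum.inr j)

lemma partialFit_dotProduct_covariates (d : Fin pX → ℝ) : partialFit Z X W ⬝ᵥ (X *ᵥ d) = 0 :=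
  resid_dotProduct (det_gram_covariates hV) _ d

lemma partialFit_dotProduct_fit :
    partialFit Z X W ⬝ᵥ (Matrix.fromCols Z X *ᵥ ols (Matrix.fromCols Z X) W) =
      partialFit Z X W ⬝ᵥ partialFit Z X W := by
  conv_rhs => rw [partialFit, dotProduct_sub]
  rw [← partialFit, partialFit_dotProduct_covariates hV, sub_zero]

lemma partialFit_dotProduct_self :
    partialFit Z X W ⬝ᵥ W = partialFit Z X W ⬝ᵥ partialFit Z X W := by
  have h := resid_dotProduct hV W (ols (Matrix.fromCols Z X) W - Sum.elim (0 : Fin pZ → ℝ) (ols X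
    (Matrix.fromCols Z X *ᵥ ols (Matrix.fromCols Z X) W)))
  rw [Matrix.mulVec_sub, fromCols_mulVec_sum_elim] at h
  replace h : (W - Matrix.fromCols Z X *ᵥ ols (Matrix.fromCols Z X) W) ⬝ᵥ partialFit Z X W = 0 := h
  rw [dotProduct_comm, dotProduct_sub, partialFit_dotProduct_fit hV] at h
  linarith

/-- The purged fit vanishes only if the estimated coefficients of all instruments do. -/
lemma ols_inl_eq_zero (h : partialFit Z X W = 0) (j : Fin pZ) :
    ols (Matrix.fromCols Z X) W (Sum.inl j) = 0 := by
  rw [partialFit, ← fromCols_mulVec_sum_elim Z, ← Matrix.mulVec_sub] at h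
  simpa using congrFun (mulVec_eq_zero_of_det_gram hV h) (Sum.inl j)

/-- The estimation error of two-stage least squares for the coefficient of `W` is the coefficient
in the regression of the `Y` error on the purged fit. -/
lemma twoSLS_error {Y η : Fin n → ℝ} {β : Unit ⊕ Fin pX → ℝ} (hY : Y = withCol W X *ᵥ β + η)
    (hq : 0 < partialFit Z X W ⬝ᵥ partialFit Z X W) :
    (twoSLS Z X W Y (Sum.inl ()) - β (Sum.inl ())) * (partialFit Z X W ⬝ᵥ partialFit Z X W) =
      partialFit Z X W ⬝ᵥ η := by
  set f := Matrix.fromCols Z X *ᵥ ols (Matrix.fromCols Z X) W with hf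
  set q := partialFit Z X W with hqdef
  have hqX := partialFit_dotProduct_covariates hV W
  have hqf : q ⬝ᵥ f = q ⬝ᵥ q := partialFit_dotProduct_fit hV W
  have hqU : ∀ b : Unit ⊕ Fin pX → ℝ, q ⬝ᵥ (withCol f X *ᵥ b) = b (Sum.inl ()) * (q ⬝ᵥ q) :=
    fun b => by
      rw [withCol_mulVec, dotProduct_add, hqX, add_zero, dotProduct_smul, hqf, smul_eq_mul]
  have hdet : ((withCol f X)ᵀ * withCol f X).det ≠ 0 := by
    refine det_gram_ne_zero_of_injective fun b hb => ?_
    have h1 := hqU b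
    rw [hb, dotProduct_zero, eq_comm, mul_eq_zero, or_iff_left hq.ne'] at h1
    rw [withCol_mulVec, h1, zero_smul, zero_add] at hb
    have h2 := mulVec_eq_zero_of_det_gram (det_gram_covariates hV) hb
    ext (⟨⟩ | j)
    · exact h1
    · exact congrFun h2 j
  have hres := resid_dotProduct hdet Y (Sum.elim 1 (-ols X f))
  have hq' : withCol f X *ᵥ Sum.elim 1 (-ols X f) = q := by
    rw [withCol_mulVec, Sum.elim_comp_inr, Matrix.mulVec_neg, ← sub_eq_add_neg]
    simp [hqdef, partialFit, hf]
  have hqY : q ⬝ᵥ Y = β (Sum.inl ()) * (q ⬝ᵥ q) + q ⬝ᵥ η := by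
    rw [hY, dotProduct_add, withCol_mulVec, dotProduct_add, hqX, dotProduct_smul,
      partialFit_dotProduct_self hV, add_zero, smul_eq_mul]
  rw [hq', dotProduct_comm, dotProduct_sub, hqU, hqY] at hres
  replace hres : β (Sum.inl ()) * (q ⬝ᵥ q) + q ⬝ᵥ η -
    twoSLS Z X W Y (Sum.inl ()) * (q ⬝ᵥ q) = 0 := hres
  linarith

/-- If the instruments are irrelevant, the purged fit is explained by the error of the first stage
alone. -/
lemma partialFit_dotProduct_error {θ : Fin pZ ⊕ Fin pX → ℝ} (hθ : ∀ j, θ (Sum.inl j) = 0)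
    {ε : Fin n → ℝ} (hW : W = Matrix.fromCols Z X *ᵥ θ + ε) :
    partialFit Z X W ⬝ᵥ ε = partialFit Z X W ⬝ᵥ partialFit Z X W := by
  have h0 : θ ∘ Sum.inl = 0 := funext hθ
  have h : ε = W - X *ᵥ (θ ∘ Sum.inr) := by
    rw [hW, Matrix.fromCols_mulVec, h0, Matrix.mulVec_zero, zero_add, add_sub_cancel_left]
  rw [h, dotProduct_sub, partialFit_dotProduct_covariates hV, sub_zero,
    partialFit_dotProduct_self hV]

lemma partialFit_dotProduct_le {θ : Fin pZ ⊕ Fin pX → ℝ} (hθ : ∀ j, θ (Sum.inl j) = 0)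
    {ε : Fin n → ℝ} (hW : W = Matrix.fromCols Z X *ᵥ θ + ε) :
    partialFit Z X W ⬝ᵥ partialFit Z X W ≤
      ((Matrix.fromCols Z X)ᵀ *ᵥ ε) ⬝ᵥ ols (Matrix.fromCols Z X) ε := by
  set V := Matrix.fromCols Z X with hVdef
  have hols : ols V W = θ + ols V ε := by
    rw [ols, hW, Matrix.mulVec_add, Matrix.mulVec_add, Matrix.mulVec_mulVec (v := θ),
      Matrix.mulVec_mulVec (v := θ), Matrix.nonsing_inv_mul _ (isUnit_iff_ne_zero.mpr hV),
      Matrix.one_mulVec]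
    rfl
  have h0 : θ ∘ Sum.inl = 0 := funext hθ
  have hVθ : V *ᵥ θ = X *ᵥ (θ ∘ Sum.inr) := by
    rw [hVdef, Matrix.fromCols_mulVec, h0, Matrix.mulVec_zero, zero_add]
  have h1 := partialFit_dotProduct_fit hV W
  rw [← hVdef, hols, Matrix.mulVec_add, dotProduct_add, hVθ,
    partialFit_dotProduct_covariates hV, zero_add] at h1
  have h2 := two_mul_abs_dotProduct_le (partialFit Z X W) (V *ᵥ ols V ε)
  rw [h1, abs_of_nonneg (dotProduct_self_nonneg_real _)] at h2
  have h3 : (V *ᵥ ols V ε) ⬝ᵥ (V *ᵥ ols V ε) = (Vᵀ *ᵥ ε) ⬝ᵥ ols V ε := by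
    rw [dotProduct_mulVec_eq, Matrix.mulVec_mulVec, normal_equations hV]
  linarith

end PartialFit

/-! ### Noise independent of the regressors -/

section Noise

variable {Ω : Type*} [MeasurableSpace Ω] {P : Measure Ω}

/-- If `R` is independent of `(A, B)`, and `A` of `B`, then `(R, A)` is independent of `B`. -/
lemma indepFun_prodMk_left [IsProbabilityMeasure P] {𝓡 𝓢 𝓣 : Type*} [MeasurableSpace 𝓡]
    [MeasurableSpace 𝓢] [MeasurableSpace 𝓣] {R : Ω → 𝓡} {A : Ω → 𝓢} {B : Ω → 𝓣} (hR : Measurable R)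
    (hA : Measurable A) (hB : Measurable B) (hRAB : IndepFun R (fun ω => (A ω, B ω)) P)
    (hAB : IndepFun A B P) : IndepFun (fun ω => (R ω, A ω)) B P := by
  have := Measure.isProbabilityMeasure_map (μ := P) hR.aemeasurable
  have := Measure.isProbabilityMeasure_map (μ := P) hA.aemeasurable
  have := Measure.isProbabilityMeasure_map (μ := P) hB.aemeasurable
  have h1 := (indepFun_iff_map_prod_eq_prod_map_map hR.aemeasurable
    (hA.prodMk hB).aemeasurable).mp hRAB
  have h2 := (indepFun_iff_map_prod_eq_prod_map_map hA.aemeasurable hB.aemeasurable).mp hAB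
  have h3 := (indepFun_iff_map_prod_eq_prod_map_map hR.aemeasurable hA.aemeasurable).mp
    (hRAB.comp measurable_id measurable_fst)
  rw [indepFun_iff_map_prod_eq_prod_map_map (hR.prodMk hA).aemeasurable hB.aemeasurable]
  rw [h2, ← Measure.prodAssoc_prod] at h1
  have h4 : P.map (fun ω => (R ω, A ω)) = (P.map R).prod (P.map A) := h3
  rw [h4]
  apply (MeasurableEquiv.prodAssoc (α := 𝓡) (β := 𝓢) (γ := 𝓣)).map_measurableEquiv_injective
  rw [← h1, Measure.map_map (MeasurableEquiv.measurable _) ((hR.prodMk hA).prodMk hB)]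
  rfl

variable {𝓡 : Type*} [MeasurableSpace 𝓡]

/-- The sequence `ζ` is an independent sample from `N(0, v)` that is independent of `R`. -/
structure IndepNoise (P : Measure Ω) (R : Ω → 𝓡) (ζ : ℕ → Ω → ℝ) (v : NNReal) : Prop where
  measurable_left : Measurable R
  measurable : ∀ k, Measurable (ζ k)
  hasLaw : ∀ k, HasLaw (ζ k) (gaussianReal 0 v) P
  iIndepFun : iIndepFun ζ P
  indepFun : IndepFun R (fun ω k => ζ k ω) P

namespace IndepNoise

variable {R : Ω → 𝓡} {ζ : ℕ → Ω → ℝ} {v : NNReal}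

lemma indepFun_fin (h : IndepNoise P R ζ v) (n : ℕ) :
    IndepFun R (fun ω (k : Fin n) => ζ k ω) P :=
  h.indepFun.comp measurable_id
    (measurable_pi_lambda (fun (x : ℕ → ℝ) (k : Fin n) => x k) fun _ => measurable_pi_apply _)

variable [IsProbabilityMeasure P]

lemma measure_lt_sq_le (h : IndepNoise P R ζ v) {n : ℕ} {w : 𝓡 → Fin n → ℝ} (hw : Measurable w)
    {K : ℝ} (hK : 0 < K) :
    P {ω | K ^ 2 * (w (R ω) ⬝ᵥ w (R ω)) < (w (R ω) ⬝ᵥ fun k => ζ k ω) ^ 2} ≤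
      ENNReal.ofReal (v / K ^ 2) :=
  measure_lt_sq_dotProduct_le h.measurable_left (fun k : Fin n => h.measurable k)
    (fun k => h.hasLaw k) (h.iIndepFun.precomp Fin.val_injective) (h.indepFun_fin n) hw hK

/-- The mean of the products of the noise with coefficients that are independent of it vanishes in
the limit, if their mean square converges. -/
lemma tendsto_mean_mul (h : IndepNoise P R ζ v) {w : (n : ℕ) → 𝓡 → Fin n → ℝ}
    (hw : ∀ n, Measurable (w n)) {c : ℝ}
    (hc : Tendsto (fun p : ℕ × Ω => (p.1 : ℝ)⁻¹ * (w p.1 (R p.2) ⬝ᵥ w p.1 (R p.2)))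
      (inProb P) (𝓝 c)) :
    Tendsto (fun p : ℕ × Ω => (p.1 : ℝ)⁻¹ * (w p.1 (R p.2) ⬝ᵥ fun k => ζ k p.2))
      (inProb P) (𝓝 0) := by
  have hsqrt : Tendsto (fun n : ℕ => Real.sqrt n) atTop atTop :=
    Real.tendsto_sqrt_atTop.comp tendsto_natCast_atTop_atTop
  -- Chebyshev's inequality with `K ^ 2 = √n`
  have h1 : ∀ᶠ p : ℕ × Ω in inProb P, (w p.1 (R p.2) ⬝ᵥ fun k => ζ k p.2) ^ 2 ≤
      Real.sqrt p.1 * (w p.1 (R p.2) ⬝ᵥ w p.1 (R p.2)) := by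
    refine eventually_inProb_of_le (A := fun n ω => (w n (R ω) ⬝ᵥ fun k => ζ k ω) ^ 2 ≤
      Real.sqrt n * (w n (R ω) ⬝ᵥ w n (R ω))) (r := fun n => v / Real.sqrt n)
      (tendsto_const_nhds.div_atTop hsqrt) ?_
    filter_upwards [eventually_ge_atTop 1] with n hn
    have hn' : 0 < Real.sqrt n := Real.sqrt_pos.mpr (by exact_mod_cast hn)
    have := h.measure_lt_sq_le (hw n) (Real.sqrt_pos.mpr hn')
    rw [Real.sq_sqrt hn'.le] at this
    simpa only [not_le] using this
  have h2 : Tendsto (fun p : ℕ × Ω => (Real.sqrt p.1)⁻¹ *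
      ((p.1 : ℝ)⁻¹ * (w p.1 (R p.2) ⬝ᵥ w p.1 (R p.2)))) (inProb P) (𝓝 0) := by
    simpa using ((tendsto_inv_atTop_zero.comp hsqrt).comp tendsto_fst_inProb).mul hc
  have h3 : Tendsto (fun p : ℕ × Ω =>
      ((p.1 : ℝ)⁻¹ * (w p.1 (R p.2) ⬝ᵥ fun k => ζ k p.2)) ^ 2) (inProb P) (𝓝 0) := by
    refine squeeze_zero' (Eventually.of_forall fun p => sq_nonneg _) ?_ h2
    filter_upwards [h1, tendsto_fst_inProb.eventually_ge_atTop 1] with p hp hn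
    have hn' : (0:ℝ) < p.1 := by exact_mod_cast hn
    calc _ = (p.1 : ℝ)⁻¹ ^ 2 * (w p.1 (R p.2) ⬝ᵥ fun k => ζ k p.2) ^ 2 := mul_pow _ _ _
      _ ≤ (p.1 : ℝ)⁻¹ ^ 2 * (Real.sqrt p.1 * (w p.1 (R p.2) ⬝ᵥ w p.1 (R p.2))) := by gcongr
      _ = ((p.1 : ℝ)⁻¹ * Real.sqrt p.1) * ((p.1 : ℝ)⁻¹ * (w p.1 (R p.2) ⬝ᵥ w p.1 (R p.2))) := by
        ring
      _ = _ := by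
        rw [inv_mul_eq_div, Real.sqrt_div_self]
  have h4 := h3.sqrt
  simp only [Real.sqrt_sq_eq_abs, Real.sqrt_zero] at h4
  exact (tendsto_zero_iff_abs_tendsto_zero _).mpr h4

/-- A least squares coefficient with normal noise is not smaller than order `1 / n` in
probability, whatever its mean: its standard deviation is of order `1 / √n`. -/
lemma ols_separated (h : IndepNoise P R ζ v) (hv : v ≠ 0) {κ : Type*} [Fintype κ] [DecidableEq κ]
    {A : (n : ℕ) → 𝓡 → Matrix (Fin n) κ ℝ} (hA : ∀ n i j, Measurable fun r => A n r i j)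
    {m : (n : ℕ) → 𝓡 → Fin n → ℝ} (hm : ∀ n, Measurable (m n)) {G : Matrix κ κ ℝ} (hG : G.PosDef)
    (hlim : Tendsto (fun p : ℕ × Ω => meanGram (A p.1 (R p.2))) (inProb P) (𝓝 G)) (a : κ) :
    ∃ c > 0, ∀ᶠ p : ℕ × Ω in inProb P, c / (p.1 : ℝ) ≤
      |ols (A p.1 (R p.2)) (m p.1 (R p.2) + fun k : Fin p.1 => ζ k p.2) a| := by
  set d := G⁻¹ a a with hd
  have hd0 : 0 < d := hG.inv.diag_pos
  have hGdet : G.det ≠ 0 := hG.det_pos.ne'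
  -- the coefficient is the linear combination of the responses with these weights
  let w : (n : ℕ) → 𝓡 → Fin n → ℝ := fun n r => ((A n r)ᵀ * A n r)⁻¹ a ᵥ* (A n r)ᵀ
  have hw : ∀ n, Measurable (w n) := fun n => measurable_pi_lambda _ fun k =>
    measurable_dotProduct (measurable_pi_lambda _ fun j => measurable_inv_apply
      (measurable_mul_apply (fun i j => hA n j i) (hA n)) a j)
      (measurable_pi_lambda _ fun j => hA n k j)
  have hols : ∀ n r (y : Fin n → ℝ), ols (A n r) y a = w n r ⬝ᵥ y := fun n r y => by
    rw [← Matrix.dotProduct_mulVec]; rfl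
  -- so that these weights have the squared length `(A'A)⁻¹ a a`, which is of order `1 / n`
  have hww : ∀ n (r : 𝓡), ((A n r)ᵀ * A n r).det ≠ 0 →
      w n r ⬝ᵥ w n r = ((A n r)ᵀ * A n r)⁻¹ a a := fun n r hdet => by
    have h1 := hols n r (w n r)
    rw [← h1]
    have h2 : w n r = A n r *ᵥ ((A n r)ᵀ * A n r)⁻¹ a := by
      simp only [w, Matrix.vecMul_transpose]
    rw [ols, h2, Matrix.mulVec_mulVec (M := (A n r)ᵀ), Matrix.mulVec_mulVec,
      Matrix.nonsing_inv_mul _ (isUnit_iff_ne_zero.mpr hdet), Matrix.one_mulVec]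
  -- anti-concentration at `1 / √n` times the length of the weights
  have hsmall : ∀ᶠ p : ℕ × Ω in inProb P, 0 < w p.1 (R p.2) ⬝ᵥ w p.1 (R p.2) →
      (p.1 : ℝ)⁻¹ * (w p.1 (R p.2) ⬝ᵥ w p.1 (R p.2)) <
        (w p.1 (R p.2) ⬝ᵥ (m p.1 (R p.2) + fun k : Fin p.1 => ζ k p.2)) ^ 2 := by
    refine eventually_inProb_of_le (A := fun n ω => 0 < w n (R ω) ⬝ᵥ w n (R ω) →
      (n : ℝ)⁻¹ * (w n (R ω) ⬝ᵥ w n (R ω)) <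
        (w n (R ω) ⬝ᵥ (m n (R ω) + fun k : Fin n => ζ k ω)) ^ 2)
      (r := fun n : ℕ => 2 * Real.sqrt (n : ℝ)⁻¹ / Real.sqrt (2 * Real.pi * v)) ?_
      (Eventually.of_forall fun n => ?_)
    · have : Tendsto (fun n : ℕ => Real.sqrt (n : ℝ)⁻¹) atTop (𝓝 0) := by
        simpa using (tendsto_inv_atTop_nhds_zero_nat (𝕜 := ℝ)).sqrt
      simpa using (this.const_mul 2).div_const (Real.sqrt (2 * Real.pi * v))
    · refine le_trans (measure_mono fun ω hω => ?_) (measure_sq_dotProduct_add_le hv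
        h.measurable_left (fun k : Fin n => h.measurable k) (fun k => h.hasLaw k)
        (h.iIndepFun.precomp Fin.val_injective) (h.indepFun_fin n) (hw n)
        (measurable_dotProduct (hw n) (hm n)) (Real.sqrt_nonneg (n : ℝ)⁻¹))
      simp only [Set.mem_ofPred_eq, Classical.not_imp, not_lt, dotProduct_add] at hω ⊢
      rw [Real.sq_sqrt (by positivity), add_comm]
      exact hω
  have hinv : Tendsto (fun p : ℕ × Ω => (meanGram (A p.1 (R p.2)))⁻¹ a a) (inProb P) (𝓝 d) :=
    tendsto_pi_nhds.mp (tendsto_pi_nhds.mp (tendsto_matrix_inv hlim hGdet) a) a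
  have hdet : ∀ᶠ p : ℕ × Ω in inProb P, (meanGram (A p.1 (R p.2))).det ≠ 0 :=
    ((continuous_id.matrix_det.tendsto G).comp hlim).eventually_ne hGdet
  refine ⟨Real.sqrt (d / 2), Real.sqrt_pos.mpr (by positivity), ?_⟩
  filter_upwards [hsmall, hinv.eventually_const_lt (half_lt_self hd0), hdet,
    tendsto_fst_inProb.eventually_ge_atTop 1] with p hp hpd hpdet hn
  have hn0 : (0:ℝ) < p.1 := by exact_mod_cast hn
  have hgdet := det_gram_ne_zero _ hpdet
  have hmg : (meanGram (A p.1 (R p.2)))⁻¹ a a =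
      p.1 * ((A p.1 (R p.2))ᵀ * A p.1 (R p.2))⁻¹ a a := by
    rw [meanGram_inv (by omega) _ hgdet]; rfl
  have hwv : w p.1 (R p.2) ⬝ᵥ w p.1 (R p.2) = (p.1 : ℝ)⁻¹ * (meanGram (A p.1 (R p.2)))⁻¹ a a := by
    rw [hww _ _ hgdet, hmg, inv_mul_cancel_left₀ hn0.ne']
  rw [hols]
  rw [hwv] at hp
  have hlt := hp (mul_pos (inv_pos.mpr hn0) ((half_pos hd0).trans hpd))
  refine abs_le_of_sq_le_sq' ?_ (abs_nonneg _) |>.2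
  rw [sq_abs, div_pow, Real.sq_sqrt (by positivity)]
  refine le_trans ?_ hlt.le
  rw [div_eq_inv_mul, sq, mul_inv, mul_assoc]
  gcongr

end IndepNoise

end Noise

/-! ### Relevance of an instrument -/

section Sample

lemma meanGram_apply {n : ℕ} {κ : Type*} (A : Matrix (Fin n) κ ℝ) (a b : κ) :
    meanGram A a b = (n : ℝ)⁻¹ * ((fun k => A k a) ⬝ᵥ fun k => A k b) := rfl

/-- If the products of `ε` with the columns of `V` are at most `K` times the lengths of the columns,
then the projection of `ε` on the columns has a squared length that is at most `K ^ 2` times a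
function of the mean Gram matrix. -/
lemma dotProduct_ols_le {n : ℕ} (hn : n ≠ 0) {κ : Type*} [Fintype κ] [DecidableEq κ]
    {V : Matrix (Fin n) κ ℝ} (hV : (Vᵀ * V).det ≠ 0) {ε : Fin n → ℝ} {K : ℝ}
    (hK : ∀ j, ((fun k => V k j) ⬝ᵥ ε) ^ 2 ≤ K ^ 2 * ((fun k => V k j) ⬝ᵥ fun k => V k j)) :
    (Vᵀ *ᵥ ε) ⬝ᵥ ols V ε ≤ K ^ 2 * ∑ j, ∑ l, |(meanGram V)⁻¹ j l| *
      ((meanGram V j j + meanGram V l l) / 2) := by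
  rw [ols_eq_meanGram hn V hV]
  simp only [dotProduct, Matrix.mulVec, Finset.mul_sum]
  refine Finset.sum_le_sum fun j _ => Finset.sum_le_sum fun l _ => ?_
  have hj := hK j
  have hl := hK l
  change (∑ k, V k j * ε k) * ((meanGram V)⁻¹ j l * ((n : ℝ)⁻¹ * ∑ k, V k l * ε k)) ≤ _
  rw [meanGram_apply V j j, meanGram_apply V l l]
  change (∑ k, V k j * ε k) ^ 2 ≤ _ at hj
  change (∑ k, V k l * ε k) ^ 2 ≤ _ at hl
  generalize (∑ k, V k j * ε k) = x at *
  generalize (∑ k, V k l * ε k) = y at *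
  generalize ((fun k => V k j) ⬝ᵥ fun k => V k j) = a at *
  generalize ((fun k => V k l) ⬝ᵥ fun k => V k l) = b at *
  generalize (meanGram V)⁻¹ j l = g
  have hxy : g * (x * y) ≤ |g| * (K ^ 2 * ((a + b) / 2)) := by
    refine (le_abs_self _).trans ?_
    rw [abs_mul]
    refine mul_le_mul_of_nonneg_left ?_ (abs_nonneg g)
    refine abs_le.mpr ⟨?_, ?_⟩ <;> nlinarith [sq_nonneg (x - y), sq_nonneg (x + y)]
  have hn' : 0 ≤ (n : ℝ)⁻¹ := by positivity
  calc _ = (n : ℝ)⁻¹ * (g * (x * y)) := by ring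
    _ ≤ (n : ℝ)⁻¹ * (|g| * (K ^ 2 * ((a + b) / 2))) := by gcongr
    _ = _ := by ring

/-- The matrix of the first `n` pairs of instruments and covariates. -/
def regMat {pZ pX : ℕ} (n : ℕ) (r : ℕ → (Fin pZ → ℝ) × (Fin pX → ℝ)) :
    Matrix (Fin n) (Fin pZ ⊕ Fin pX) ℝ :=
  Matrix.fromCols (Matrix.of fun k => (r k).1) (Matrix.of fun k => (r k).2)

lemma measurable_regMat {pZ pX : ℕ} (n : ℕ) (k : Fin n) (a : Fin pZ ⊕ Fin pX) :
    Measurable fun r => regMat n r k a := by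
  rcases a with a | a
  · exact (measurable_pi_apply a).comp (measurable_fst.comp (measurable_pi_apply (k : ℕ)))
  · exact (measurable_pi_apply a).comp (measurable_snd.comp (measurable_pi_apply (k : ℕ)))

lemma measurable_partialFit {α : Type*} [MeasurableSpace α] {n pZ pX : ℕ}
    {Z : α → Matrix (Fin n) (Fin pZ) ℝ} {X : α → Matrix (Fin n) (Fin pX) ℝ} {W : α → Fin n → ℝ}
    (hZ : ∀ k j, Measurable fun a => Z a k j) (hX : ∀ k j, Measurable fun a => X a k j)
    (hW : Measurable W) : Measurable fun a => partialFit (Z a) (X a) (W a) := by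
  have hV : ∀ k j, Measurable fun a => Matrix.fromCols (Z a) (X a) k j := by
    rintro k (j | j)
    · exact hZ k j
    · exact hX k j
  have hf := measurable_mulVec hV (measurable_ols hV hW)
  exact hf.sub (measurable_mulVec hX (measurable_ols hX hf))

/-- The matrix of the first `n` errors. -/
def errorMat {Ω : Type*} (e : ℕ → Ω → EuclideanSpace ℝ (Fin 2)) (n : ℕ) (ω : Ω) :
    Matrix (Fin n) (Fin 2) ℝ :=
  Matrix.of fun k s => e k ω s

variable {Ω : Type*} {pZ pX : ℕ} {Z : ℕ → Ω → Fin pZ → ℝ} {X : ℕ → Ω → Fin pX → ℝ}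
  {W Y : ℕ → Ω → ℝ} {e : ℕ → Ω → EuclideanSpace ℝ (Fin 2)} {θ : Fin pZ ⊕ Fin pX → ℝ}
  {β : Unit ⊕ Fin pX → ℝ}

lemma errorMat_mulVec_first (n : ℕ) (ω : Ω) :
    errorMat e n ω *ᵥ ![0, 1] = fun k : Fin n => e k ω 1 := by
  ext k
  simp [errorMat, Matrix.mulVec, dotProduct]

lemma errorMat_mulVec_second (n : ℕ) (ω : Ω) :
    errorMat e n ω *ᵥ ![1, 0] = fun k : Fin n => e k ω 0 := by
  ext k
  simp [errorMat, Matrix.mulVec, dotProduct]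

lemma sampleVec_first (hW : ∀ k ω, W k ω = Sum.elim (Z k ω) (X k ω) ⬝ᵥ θ + e k ω 1) (n : ℕ)
    (ω : Ω) : sampleVec W n ω = Matrix.fromCols (sampleMat Z n ω) (sampleMat X n ω) *ᵥ θ +
      fun k : Fin n => e k ω 1 := by
  ext k
  rw [sampleVec, hW]
  rfl

lemma sampleVec_second (hY : ∀ k ω, Y k ω = Sum.elim (fun _ : Unit => W k ω) (X k ω) ⬝ᵥ β +
    e k ω 0) (n : ℕ) (ω : Ω) : sampleVec Y n ω =
      withCol (sampleVec W n ω) (sampleMat X n ω) *ᵥ β + fun k : Fin n => e k ω 0 := by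
  ext k
  rw [sampleVec, hY]
  rfl

variable [MeasurableSpace Ω] {P : Measure Ω} {S : Matrix (Fin 2) (Fin 2) ℝ}
  {Q : Matrix (Fin pZ ⊕ Fin pX) (Fin pZ ⊕ Fin pX) ℝ}

lemma tendsto_meanGram_regMat (hlim : ∀ a b, TendstoInMeasure P
      (fun (n : ℕ) ω => (∑ k ∈ Finset.range n,
        Sum.elim (Z k ω) (X k ω) a * Sum.elim (Z k ω) (X k ω) b) / (n : ℝ))
      atTop (fun _ => Q a b)) :
    Tendsto (fun p : ℕ × Ω => meanGram (regMat p.1 fun k => (Z k p.2, X k p.2))) (inProb P)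
      (𝓝 Q) := by
  refine tendsto_pi_nhds.mpr fun a => tendsto_pi_nhds.mpr fun b => ?_
  refine (tendstoInMeasure_iff_tendsto_inProb.mp (hlim a b)).congr fun p => ?_
  rw [Finset.sum_range, div_eq_inv_mul]
  rcases a with a | a <;> rcases b with b | b <;> rfl

lemma indepNoise_error (hS : S.PosDef) (he : ∀ k, HasLaw (e k) (multivariateGaussian 0 S) P)
    (hem : ∀ k, Measurable (e k)) (hind : iIndepFun e P) (hZ : ∀ k, Measurable (Z k))
    (hX : ∀ k, Measurable (X k))
    (hexo : IndepFun (fun ω k => (Z k ω, X k ω)) (fun ω k => e k ω) P) (s : Fin 2) :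
    IndepNoise P (fun ω k => (Z k ω, X k ω)) (fun k ω => e k ω s) (S s s).toNNReal where
  measurable_left := measurable_pi_lambda _ fun k => (hZ k).prodMk (hX k)
  measurable k := measurable_error hem k s
  hasLaw k := hasLaw_error hS he k s
  iIndepFun := hind.comp (fun _ x => x s) fun _ => by fun_prop
  indepFun := hexo.comp (ψ := fun (x : ℕ → EuclideanSpace ℝ (Fin 2)) k => x k s) measurable_id
    (by fun_prop)

variable [IsProbabilityMeasure P]

/-- The moments of the regressors and errors converge: the mixed ones vanish as the regressors are
exogenous, those of the errors obey the law of large numbers. -/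
lemma tendsto_meanGram_dataArray (hS : S.PosDef)
    (he : ∀ k, HasLaw (e k) (multivariateGaussian 0 S) P)
    (hem : ∀ k, Measurable (e k)) (hind : iIndepFun e P)
    (hnoise : ∀ s, IndepNoise P (fun ω k => (Z k ω, X k ω)) (fun k ω => e k ω s) (S s s).toNNReal)
    (hV : Tendsto (fun p : ℕ × Ω => meanGram (regMat p.1 fun k => (Z k p.2, X k p.2))) (inProb P)
      (𝓝 Q)) :
    Tendsto (fun p : ℕ × Ω => meanGram (dataArray (sampleMat Z p.1 p.2) (sampleMat X p.1 p.2)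
      (errorMat e p.1 p.2))) (inProb P) (𝓝 (Matrix.fromBlocks Q 0 0 S)) := by
  have hQ : ∀ a b, Tendsto (fun p : ℕ × Ω => meanGram (regMat p.1 fun k => (Z k p.2, X k p.2)) a b)
      (inProb P) (𝓝 (Q a b)) := fun a b => tendsto_pi_nhds.mp (tendsto_pi_nhds.mp hV a) b
  have hmix : ∀ a s, Tendsto (fun p : ℕ × Ω => (p.1 : ℝ)⁻¹ *
      ((fun k => regMat p.1 (fun k => (Z k p.2, X k p.2)) k a) ⬝ᵥ fun k => e k p.2 s))
      (inProb P) (𝓝 0) := fun a s =>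
    (hnoise s).tendsto_mean_mul (w := fun n r k => regMat n r k a)
      (fun n => measurable_pi_lambda _ fun k => measurable_regMat n k a) (hQ a a)
  refine tendsto_pi_nhds.mpr fun a => tendsto_pi_nhds.mpr fun b => ?_
  rcases a with a | s <;> rcases b with b | t
  · exact hQ a b
  · exact hmix a t
  · refine (hmix b s).congr fun p => ?_
    rw [dotProduct_comm]; rfl
  · have h := tendstoInMeasure_iff_tendsto_inProb.mp (tendsto_mean_error_mul hS he hem hind s t)
    refine h.congr fun p => ?_
    rw [Finset.sum_range, div_eq_inv_mul]; rfl

/-- Consistency of two-stage least squares identifies the model. If the instruments were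
irrelevant, the purged fit would be bounded in probability, while, given the regressors and the
errors of the first stage, the estimation error of two-stage least squares is normal with a
standard deviation inversely proportional to the length of the purged fit. -/
lemma exists_relevant_instrument (hpZ : 1 ≤ pZ)
    (hY : ∀ k ω, Y k ω = Sum.elim (fun _ : Unit => W k ω) (X k ω) ⬝ᵥ β + e k ω 0)
    (hW : ∀ k ω, W k ω = Sum.elim (Z k ω) (X k ω) ⬝ᵥ θ + e k ω 1) (hS : S.PosDef)
    (he : ∀ k, HasLaw (e k) (multivariateGaussian 0 S) P)
    (hem : ∀ k, Measurable (e k)) (hind : iIndepFun e P)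
    (hnoise : IndepNoise P (fun ω k => (Z k ω, X k ω)) (fun k ω => e k ω 1) (S 1 1).toNNReal)
    (hexo : IndepFun (fun ω k => (Z k ω, X k ω)) (fun ω k => e k ω) P) (hQ : Q.PosDef)
    (hV : Tendsto (fun p : ℕ × Ω => meanGram (regMat p.1 fun k => (Z k p.2, X k p.2))) (inProb P)
      (𝓝 Q))
    (hcons : TendstoInMeasure P (fun n ω => twoSLS (sampleMat Z n ω) (sampleMat X n ω)
      (sampleVec W n ω) (sampleVec Y n ω)) atTop (fun _ => β)) :
    ∃ j, θ (Sum.inl j) ≠ 0 := by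
  by_contra hθ
  push Not at hθ
  have hS11 : 0 < S 1 1 := hS.diag_pos
  have hQdet : Q.det ≠ 0 := hQ.det_pos.ne'
  obtain ⟨v, hv, hξ⟩ := hasLaw_pureError hS he
  set ρ := S 0 1 / S 1 1 with hρ
  let R : Ω → ℕ → (Fin pZ → ℝ) × (Fin pX → ℝ) := fun ω k => (Z k ω, X k ω)
  -- the purged fit as a function of the regressors and the errors of the first stage
  let q : (n : ℕ) → (ℕ → (Fin pZ → ℝ) × (Fin pX → ℝ)) × (Fin n → ℝ) → Fin n → ℝ := fun n x =>
    partialFit (Matrix.of fun k : Fin n => (x.1 k).1) (Matrix.of fun k : Fin n => (x.1 k).2)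
      (regMat n x.1 *ᵥ θ + x.2)
  have hqm : ∀ n, Measurable (q n) := fun n => by
    refine measurable_partialFit (fun k j => ?_) (fun k j => ?_) ?_
    · exact (measurable_regMat n k (Sum.inl j)).comp measurable_fst
    · exact (measurable_regMat n k (Sum.inr j)).comp measurable_fst
    · exact (measurable_mulVec (fun k a => (measurable_regMat n k a).comp measurable_fst)
        measurable_const).add measurable_snd
  let ε : (n : ℕ) → Ω → Fin n → ℝ := fun n ω k => e k ω 1
  let ξ : (n : ℕ) → Ω → Fin n → ℝ := fun n ω k => pureError S (e k ω)
  have hεm : ∀ n, Measurable (ε n) := fun n =>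
    measurable_pi_lambda _ fun k => measurable_error hem k 1
  have hξm : ∀ k, Measurable fun ω => pureError S (e k ω) := fun k =>
    (measurable_pureError S).comp (hem k)
  have hRm : Measurable R := hnoise.measurable_left
  have hindep : ∀ n, IndepFun (fun ω => (R ω, ε n ω)) (ξ n) P := fun n => by
    refine indepFun_prodMk_left hRm (hεm n) (measurable_pi_lambda _ fun k : Fin n => hξm k) ?_
      (indepFun_error_pureError hS he hem hind n)
    refine hexo.comp (ψ := fun (x : ℕ → EuclideanSpace ℝ (Fin 2)) =>
      ((fun k : Fin n => x k 1 : Fin n → ℝ), (fun k : Fin n => pureError S (x k) : Fin n → ℝ)))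
      measurable_id (Measurable.prodMk (by fun_prop) (measurable_pi_lambda _ fun k => ?_))
    exact (measurable_pureError S).comp (measurable_pi_apply _)
  set T : ℕ × Ω → ℝ := fun p => ∑ j, ∑ l, |(meanGram (regMat p.1 (R p.2)))⁻¹ j l| *
    ((meanGram (regMat p.1 (R p.2)) j j + meanGram (regMat p.1 (R p.2)) l l) / 2) with hT
  obtain ⟨B, hB0, hB⟩ : ∃ B > 0, ∀ᶠ p in inProb P, T p ≤ B := by
    have hinv := tendsto_matrix_inv hV hQdet
    have h1 : Tendsto T (inProb P) (𝓝 (∑ j, ∑ l, |Q⁻¹ j l| * ((Q j j + Q l l) / 2))) := by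
      refine tendsto_finsetSum _ fun j _ => tendsto_finsetSum _ fun l _ => ?_
      have e1 := tendsto_pi_nhds.mp (tendsto_pi_nhds.mp hinv j) l
      have e2 := tendsto_pi_nhds.mp (tendsto_pi_nhds.mp hV j) j
      have e3 := tendsto_pi_nhds.mp (tendsto_pi_nhds.mp hV l) l
      exact e1.abs.mul ((e2.add e3).div_const 2)
    refine ⟨|∑ j, ∑ l, |Q⁻¹ j l| * ((Q j j + Q l l) / 2)| + 1, by positivity, ?_⟩
    filter_upwards [h1.eventually_lt_const (lt_of_le_of_lt (le_abs_self _) (lt_add_one _))]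
      with p hp using hp.le
  -- with probability at least `3 / 4`, the first stage noise is at most `K` times its scale
  set N : ℝ := (Fintype.card (Fin pZ ⊕ Fin pX) : ℝ) with hN
  obtain ⟨K, hK0, hK⟩ : ∃ K > 0, N * (S 1 1 / K ^ 2) ≤ 1 / 4 := by
    have hN0 : 0 ≤ N := Nat.cast_nonneg _
    refine ⟨Real.sqrt (4 * (N * S 1 1) + 1), Real.sqrt_pos.mpr (by positivity), ?_⟩
    rw [Real.sq_sqrt (by positivity), mul_div_assoc', div_le_iff₀ (by positivity)]
    linarith
  -- the scale at which the pure error of the second stage has probability at most `1 / 4`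
  set κ : ℝ := Real.sqrt (2 * Real.pi * v) / 8 with hκ
  have hv0 : (0:ℝ) < v := by positivity
  have hκ0 : 0 < κ := by positivity
  set δ := κ / (K * Real.sqrt B) with hδ
  have hδ0 : 0 < δ := by positivity
  let noisy : ℕ → Ω → Prop := fun n ω => ∃ j, K ^ 2 * ((fun k => regMat n (R ω) k j) ⬝ᵥ
    fun k => regMat n (R ω) k j) < ((fun k => regMat n (R ω) k j) ⬝ᵥ ε n ω) ^ 2
  let small : ℕ → Ω → Prop := fun n ω => 0 < q n (R ω, ε n ω) ⬝ᵥ q n (R ω, ε n ω) ∧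
    (q n (R ω, ε n ω) ⬝ᵥ ξ n ω + ρ * (q n (R ω, ε n ω) ⬝ᵥ q n (R ω, ε n ω))) ^ 2 ≤
      κ ^ 2 * (q n (R ω, ε n ω) ⬝ᵥ q n (R ω, ε n ω))
  have hnoisy : ∀ n, P {ω | noisy n ω} ≤ ENNReal.ofReal (1 / 4) := fun n => by
    simp only [noisy, Set.ofPred_exists]
    refine (measure_iUnion_fintype_le P _).trans ?_
    refine (Finset.sum_le_sum fun j _ => hnoise.measure_lt_sq_le (w := fun r k => regMat n r k j)
      (measurable_pi_lambda _ fun k => measurable_regMat n k j) hK0).trans ?_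
    rw [Finset.sum_const, Finset.card_univ, nsmul_eq_mul, ← ENNReal.ofReal_natCast,
      ← ENNReal.ofReal_mul (by positivity), Real.coe_toNNReal _ hS11.le]
    exact ENNReal.ofReal_le_ofReal hK
  have hsmall : ∀ n, P {ω | small n ω} ≤ ENNReal.ofReal (1 / 4) := fun n => by
    refine (measure_sq_dotProduct_add_le hv (hRm.prodMk (hεm n)) (fun k : Fin n => hξm k)
      (fun k => hξ k) ((hind.comp (fun _ => pureError S) fun _ => measurable_pureError S).precomp
      Fin.val_injective) (hindep n) (hqm n) (m := fun x => ρ * (q n x ⬝ᵥ q n x))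
      ((measurable_dotProduct (hqm n) (hqm n)).const_mul ρ) hκ0.le).trans
      (ENNReal.ofReal_le_ofReal (le_of_eq ?_))
    rw [hκ]
    field_simp
    norm_num
  -- the purged fit does not vanish: the estimated coefficient of the first instrument does not
  have hq0 : ∀ᶠ p : ℕ × Ω in inProb P, ols (regMat p.1 (R p.2))
      (regMat p.1 (R p.2) *ᵥ θ + ε p.1 p.2) (Sum.inl ⟨0, hpZ⟩) ≠ 0 := by
    obtain ⟨c, hc, h⟩ := hnoise.ols_separated (by simpa using hS11) (A := fun n r => regMat n r)
      (fun n k a => measurable_regMat n k a) (m := fun n r => regMat n r *ᵥ θ)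
      (fun n => measurable_mulVec (measurable_regMat n) measurable_const) hQ hV
      (Sum.inl ⟨0, hpZ⟩)
    filter_upwards [h, tendsto_fst_inProb.eventually_ge_atTop 1] with p hp hn
    have hn' : (0:ℝ) < p.1 := by exact_mod_cast hn
    exact abs_pos.mp ((div_pos hc hn').trans_le hp)
  have herr : ∀ᶠ p : ℕ × Ω in inProb P, |twoSLS (sampleMat Z p.1 p.2) (sampleMat X p.1 p.2)
      (sampleVec W p.1 p.2) (sampleVec Y p.1 p.2) (Sum.inl ()) - β (Sum.inl ())| < δ :=
    ((tendsto_pi_nhds.mp (tendstoInMeasure_iff_tendsto_inProb.mp hcons) (Sum.inl ())).eventually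
      (Metric.ball_mem_nhds _ hδ0)).mono fun p hp => hp
  have hdet : ∀ᶠ p : ℕ × Ω in inProb P, (meanGram (regMat p.1 (R p.2))).det ≠ 0 :=
    ((continuous_id.matrix_det.tendsto Q).comp hV).eventually_ne hQdet
  -- as `(β̂ - β) q'q = q'η = q'ξ + ρ q'q` for the purged fit `q`, an error below `δ` makes the
  -- right hand side, normal given `q`, at most `κ` times the length of `q`
  have hmain : ∀ᶠ p : ℕ × Ω in inProb P, noisy p.1 p.2 ∨ small p.1 p.2 := by
    filter_upwards [hB, hq0, herr, hdet, tendsto_fst_inProb.eventually_ge_atTop 1]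
      with ⟨n, ω⟩ hTB hq0 herr hdet hn
    refine or_iff_not_imp_left.mpr fun hno => ?_
    simp only [noisy, not_exists, not_lt] at hno
    have hdet' : ((Matrix.fromCols (sampleMat Z n ω) (sampleMat X n ω))ᵀ *
        Matrix.fromCols (sampleMat Z n ω) (sampleMat X n ω)).det ≠ 0 := det_gram_ne_zero _ hdet
    have hWn := sampleVec_first hW n ω
    have hYn := sampleVec_second hY n ω
    set qn := q n (R ω, ε n ω) with hqn
    have hqn' : qn = partialFit (sampleMat Z n ω) (sampleMat X n ω) (sampleVec W n ω) := by
      rw [hWn]; rfl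
    have hpos : 0 < qn ⬝ᵥ qn := by
      refine (dotProduct_self_nonneg_real qn).lt_of_ne' fun h0 => hq0 ?_
      exact ols_inl_eq_zero hdet' _ (dotProduct_self_eq_zero.mp h0) _
    have hle : qn ⬝ᵥ qn ≤ K ^ 2 * B := by
      have h1 := partialFit_dotProduct_le hdet' _ hθ hWn
      rw [← hqn'] at h1
      refine h1.trans ((dotProduct_ols_le (by omega) hdet' hno).trans ?_)
      exact mul_le_mul_of_nonneg_left hTB (sq_nonneg K)
    have h2 := partialFit_dotProduct_error hdet' _ hθ hWn
    have h3 := twoSLS_error hdet' _ hYn (by rwa [← hqn'])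
    rw [← hqn'] at h2 h3
    have hη : (fun k : Fin n => e k ω 0) = ξ n ω + ρ • ε n ω := by
      ext k
      simp [ξ, ε, pureError, hρ]
    rw [hη, dotProduct_add, dotProduct_smul, smul_eq_mul] at h3
    change qn ⬝ᵥ ε n ω = _ at h2
    rw [h2] at h3
    refine ⟨hpos, ?_⟩
    rw [← h3, mul_pow, ← sq_abs]
    have hδκ : δ ^ 2 * (K ^ 2 * B) = κ ^ 2 := by
      rw [hδ, div_pow, mul_pow, Real.sq_sqrt hB0.le]
      field_simp
    calc _ ≤ δ ^ 2 * (qn ⬝ᵥ qn) ^ 2 := by gcongr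
      _ = δ ^ 2 * (qn ⬝ᵥ qn) * (qn ⬝ᵥ qn) := by ring
      _ ≤ δ ^ 2 * (K ^ 2 * B) * (qn ⬝ᵥ qn) := by gcongr
      _ = _ := by rw [hδκ]
  have hev := (eventually_inProb (A := fun n ω => noisy n ω ∨ small n ω)).mp hmain
  obtain ⟨n, hn⟩ := (hev.eventually_lt_const
    (show (0 : ENNReal) < ENNReal.ofReal (1 / 4) by simp)).exists
  have hone : (1 : ENNReal) ≤ ENNReal.ofReal (1 / 4) + ENNReal.ofReal (1 / 4) +
      ENNReal.ofReal (1 / 4) := by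
    calc (1 : ENNReal) = P Set.univ := measure_univ.symm
      _ ≤ P ({ω | noisy n ω} ∪ {ω | small n ω} ∪ {ω | ¬(noisy n ω ∨ small n ω)}) :=
        measure_mono fun ω _ => by
          by_cases h : noisy n ω ∨ small n ω
          · exact Or.inl h
          · exact Or.inr h
      _ ≤ _ := (measure_union_le _ _).trans
        (add_le_add ((measure_union_le _ _).trans (add_le_add (hnoisy n) (hsmall n))) hn.le)
  rw [← ENNReal.ofReal_add (by norm_num) (by norm_num),
    ← ENNReal.ofReal_add (by norm_num) (by norm_num), ← ENNReal.ofReal_one,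
    ENNReal.ofReal_le_ofReal_iff (by norm_num)] at hone
  norm_num at hone

end Sample

end TwoSBMA

end

theorem theorem4 {Ω : Type*} [MeasurableSpace Ω] (P : Measure Ω) [IsProbabilityMeasure P]
    (pZ pX : ℕ) (hpZ : 1 ≤ pZ)
    (Z : ℕ → Ω → Fin pZ → ℝ) (X : ℕ → Ω → Fin pX → ℝ) (W Y : ℕ → Ω → ℝ)
    -- the errors: coordinate `0` is that of the `Y` equation, coordinate `1` that of `W`
    (e : ℕ → Ω → EuclideanSpace ℝ (Fin 2))
    (θ : Fin pZ ⊕ Fin pX → ℝ) (β : Unit ⊕ Fin pX → ℝ)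
    -- the two regression equations
    (hY : ∀ k ω, Y k ω = Sum.elim (fun _ : Unit => W k ω) (X k ω) ⬝ᵥ β + e k ω 0)
    (hW : ∀ k ω, W k ω = Sum.elim (Z k ω) (X k ω) ⬝ᵥ θ + e k ω 1)
    -- independent nondegenerate normal errors, independent of instruments and covariates
    (S : Matrix (Fin 2) (Fin 2) ℝ) (hS : S.PosDef)
    (hem : ∀ k, Measurable (e k)) (he : ∀ k, HasLaw (e k) (multivariateGaussian 0 S) P)
    (hind : iIndepFun e P)
    (hZ : ∀ k, Measurable (Z k)) (hX : ∀ k, Measurable (X k))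
    (hexo : IndepFun (fun ω k => (Z k ω, X k ω)) (fun ω k => e k ω) P)
    -- the mean of the products of the regressors has a nonsingular limit
    (Q : Matrix (Fin pZ ⊕ Fin pX) (Fin pZ ⊕ Fin pX) ℝ) (hQ : Q.PosDef)
    (hlim : ∀ a b, TendstoInMeasure P
      (fun (n : ℕ) ω => (∑ k ∈ Finset.range n,
        Sum.elim (Z k ω) (X k ω) a * Sum.elim (Z k ω) (X k ω) b) / (n : ℝ))
      atTop (fun _ => Q a b))
    -- the collections of models contain the true ones; prior model weights are positive
    (𝓜 : Finset (TwoSBMA.FirstModel pZ pX)) (𝓛 : Finset (TwoSBMA.SecondModel pX))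
    (hθ : Finset.univ.filter (fun a => θ a ≠ 0) ∈ 𝓜)
    (hβ : Finset.univ.filter (fun a => β a ≠ 0) ∈ 𝓛)
    (prM : TwoSBMA.FirstModel pZ pX → ℝ)
    (prL : TwoSBMA.FirstModel pZ pX → TwoSBMA.SecondModel pX → ℝ)
    (hprM : ∀ M ∈ 𝓜, 0 < prM M) (hprL : ∀ M ∈ 𝓜, ∀ L ∈ 𝓛, 0 < prL M L)
    -- two-stage least squares in the full model is consistent
    (hcons : TendstoInMeasure P
      (fun n ω => TwoSBMA.twoSLS (TwoSBMA.sampleMat Z n ω) (TwoSBMA.sampleMat X n ω)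
        (TwoSBMA.sampleVec W n ω) (TwoSBMA.sampleVec Y n ω))
      atTop (fun _ => β))
    (control : Bool) :
    TendstoInMeasure P
      (fun n ω => TwoSBMA.twoSBMA (TwoSBMA.sampleMat Z n ω) (TwoSBMA.sampleMat X n ω)
        (TwoSBMA.sampleVec W n ω) (TwoSBMA.sampleVec Y n ω) control 𝓜 𝓛 prM prL)
      atTop (fun _ => β) := by
  have hnoise := TwoSBMA.indepNoise_error hS he hem hind hZ hX hexo
  have hV := TwoSBMA.tendsto_meanGram_regMat hlim
  have hid := TwoSBMA.exists_relevant_instrument hpZ hY hW hS he hem hind (hnoise 1) hexo hQ hV hcons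
  rw [TwoSBMA.tendstoInMeasure_iff_tendsto_inProb]
  have h : TwoSBMA.MomentLimits (TwoSBMA.inProb P) Prod.fst
      (fun p => TwoSBMA.sampleMat Z p.1 p.2) (fun p => TwoSBMA.sampleMat X p.1 p.2)
      (fun p => TwoSBMA.errorMat e p.1 p.2) (fun p => TwoSBMA.sampleVec W p.1 p.2)
      (fun p => TwoSBMA.sampleVec Y p.1 p.2) θ β Q S :=
    { size := TwoSBMA.tendsto_fst_inProb
      posDef_regressors := hQ
      posDef_errors := hS
      gram := TwoSBMA.tendsto_meanGram_dataArray hS he hem hind hnoise hV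
      first_eq := fun p => by
        rw [TwoSBMA.errorMat_mulVec_first]; exact TwoSBMA.sampleVec_first hW p.1 p.2
      second_eq := fun p => by
        rw [TwoSBMA.errorMat_mulVec_second]; exact TwoSBMA.sampleVec_second hY p.1 p.2 }
  refine h.tendsto_twoSBMA hid (fun M a ha => ?_) hθ hβ hprM hprL control
  have hG : (Q.submatrix (Subtype.val : M → _) Subtype.val).PosDef :=
    hQ.submatrix Subtype.val_injective
  obtain ⟨c, hc, hsep⟩ := (hnoise 1).ols_separated (by simpa using hS.diag_pos)
    (A := fun n r => TwoSBMA.keepCols (TwoSBMA.regMat n r) M)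
    (fun n k j => TwoSBMA.measurable_regMat n k j.1)
    (m := fun n r => TwoSBMA.regMat n r *ᵥ θ)
    (fun n => TwoSBMA.measurable_mulVec (TwoSBMA.measurable_regMat n) measurable_const) hG
    (tendsto_pi_nhds.mpr fun i => tendsto_pi_nhds.mpr fun j =>
      tendsto_pi_nhds.mp (tendsto_pi_nhds.mp hV i.1) j.1) ⟨a, ha⟩
  refine ⟨c, hc, hsep.mono fun p hp => ?_⟩
  rw [TwoSBMA.firstEstimate_apply _ _ _ ha, TwoSBMA.sampleVec_first hW]
  exact hp
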